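/- Let $k$ be a field, let $G,\Gamma,C$ be finite groups, and let $V$ be a finite-dimensional $k$-vector space with commuting linear actions of $G$ and $C$, the action of $G$ being faithful. Let $k[V]=\mathrm{Sym}(V^*)$ with the induced actions. Let $U$ be a finite-dimensional $k$-vector space with commuting linear actions of $\Gamma$ and $G$. Let $\Gamma$ act trivially on $k[V]$ and $C$ act trivially on $U$. Let $R\subseteq k[V]^G$ be a homogeneous Noether normalization, i.e. $R$ is generated as a $k$-algebra by finitely many algebraically independent homogeneous polynomials and $k[V]^G$ is a finitely generated $R$-module, and suppose that $R$ is stable under $C$. Let $\phi:V\to\operatorname{Spec}R$ be the corresponding morphism of schemes. Let $v\in V$ (a $k$-rational point), let $\mathfrak m_{\phi(v)}=\{f\in R: f(v)=0\}$ be the maximal ideal of $R$ corresponding to $\phi(v)$, and let $\Phi_v=\phi^{-1}(\phi(v))$ be the fiber, a closed subscheme of $V$ with coordinate ring $A(\Phi_v)=k[V]/\mathfrak m_{\phi(v)}k[V]$. Suppose that $\Phi_v$ is stable under $C$ and that $G$ acts freely (not necessarily transitively) on $\Phi_v$, in the following sense. The geometric points of $\Phi_v$ are the $k$-algebra homomorphisms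 $w:k[V]\to\bar k$ with $w(f)=f(v)$ for all $f\in R$, where $\bar k$ is an algebraic closure of $k$; this set is stable under $C$, and no $g\neq 1$ in $G$ fixes any of its elements. Put $M:=(U\otimes_k k[V])^G$, a graded $R$-module with a compatible action of $\Gamma\times C$, and let $k=R/R_+$. Then each $\operatorname{Tor}^R_i(M,k)_j$ (homological degree $i$, internal degree $j$) is finite-dimensional, only finitely many of them are non-zero, $(U\otimes_k A(\Phi_v))^G$ is finite-dimensional, and $$\sum_{i\ge 0}(-1)^i\sum_{j\ge 0}\left[\operatorname{Tor}^R_i(M,k)_j\right]=\left[\left(U\otimes_k A(\Phi_v)\right)^G\right]$$ in the Grothendieck group of finite-dimensional $k(\Gamma\times C)$-modules, where $\Gamma\times C$ acts on the right-hand side through $\Gamma$ on $U$ and $C$ on $A(\Phi_v)$, and on the Tor groups by the action induced from the compatible actions on $R$, $M$ and $k$. -/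

import Mathlib

open scoped TensorProduct

universe u

noncomputable section

namespace RelInv

/-! ### Polynomial functions -/

section Polynomials

variable (k : Type*) [Field k] (V : Type*) [AddCommGroup V] [Module k V]

/-- The algebra `k[V]` of polynomial functions on `V`: the symmetric algebra of the dual space. -/
abbrev Poly : Type _ := SymmetricAlgebra k (Module.Dual k V)

/-- The homogeneous polynomials of degree `d`: the span of the products of `d` linear forms. -/
def homogeneousPart (d : ℕ) : Submodule k (Poly k V) :=
  LinearMap.range (SymmetricAlgebra.ι k (Module.Dual k V)) ^ d

variable {k V}

/-- Evaluation of polynomials at the vector `v`. -/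
def evalAt (v : V) : Poly k V →ₐ[k] k :=
  SymmetricAlgebra.lift (Module.Dual.eval k V v)

/-- A linear action on `V` induces an action on `k[V]` by graded algebra automorphisms,
`(h f)(x) = f (h⁻¹ x)`; on linear forms this is the contragredient representation. -/
def polyAct {H : Type*} [Group H] (ρ : Representation k H V) : H →* (Poly k V →ₐ[k] Poly k V) where
  toFun h := SymmetricAlgebra.lift (SymmetricAlgebra.ι k _ ∘ₗ ρ.dual h)
  map_one' := by
    refine SymmetricAlgebra.algHom_ext (LinearMap.ext fun x => ?_)
    simp [-Representation.dual_apply]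
  map_mul' a b := by
    refine SymmetricAlgebra.algHom_ext (LinearMap.ext fun x => ?_)
    simp [-Representation.dual_apply]

theorem polyAct_ι {H : Type*} [Group H] (ρ : Representation k H V) (h : H)
    (x : Module.Dual k V) :
    polyAct ρ h (SymmetricAlgebra.ι k _ x) = SymmetricAlgebra.ι k _ (ρ.dual h x) := by
  simp [polyAct]

/-- The action on `k[V]` as a representation. -/
def polyRep {H : Type*} [Group H] (ρ : Representation k H V) : Representation k H (Poly k V) where
  toFun h := (polyAct ρ h).toLinearMap
  map_one' := by ext x; simp
  map_mul' a b := by ext x; simp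

theorem polyRep_apply {H : Type*} [Group H] (ρ : Representation k H V) (h : H) (f : Poly k V) :
    polyRep ρ h f = polyAct ρ h f := rfl

theorem polyAct_commute {H H' : Type*} [Group H] [Group H'] (ρ : Representation k H V)
    (ρ' : Representation k H' V) (hc : ∀ h h', Commute (ρ h) (ρ' h')) (h : H) (h' : H')
    (f : Poly k V) : polyAct ρ h (polyAct ρ' h' f) = polyAct ρ' h' (polyAct ρ h f) := by
  suffices (polyAct ρ h).comp (polyAct ρ' h') = (polyAct ρ' h').comp (polyAct ρ h) from
    DFunLike.congr_fun this f
  refine SymmetricAlgebra.algHom_ext (LinearMap.ext fun x => ?_)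
  change polyAct ρ h (polyAct ρ' h' (SymmetricAlgebra.ι k _ x)) =
    polyAct ρ' h' (polyAct ρ h (SymmetricAlgebra.ι k _ x))
  rw [polyAct_ι, polyAct_ι, polyAct_ι, polyAct_ι]
  refine congrArg (SymmetricAlgebra.ι k (Module.Dual k V)) (LinearMap.ext fun y => ?_)
  have := DFunLike.congr_fun (hc h⁻¹ h'⁻¹).eq y
  simp only [Module.End.mul_apply] at this
  simp [Representation.dual_apply, Module.Dual.transpose_apply, this]

theorem polyAct_homogeneous {H : Type*} [Group H] (ρ : Representation k H V) (h : H) (d : ℕ) :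
    homogeneousPart k V d ≤ (homogeneousPart k V d).comap (polyRep ρ h) := by
  rw [← Submodule.map_le_iff_le_comap]
  change Submodule.map (polyAct ρ h).toLinearMap _ ≤ _
  rw [homogeneousPart, Submodule.map_pow]
  refine pow_le_pow_left' ?_ d
  rintro _ ⟨_, ⟨x, rfl⟩, rfl⟩
  exact ⟨ρ.dual h x, (polyAct_ι ρ h x).symm⟩

theorem evalAt_polyAct {H : Type*} [Group H] (ρ : Representation k H V) (h : H) (v : V)
    (f : Poly k V) : evalAt v (polyAct ρ h f) = evalAt (ρ h⁻¹ v) f := by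
  suffices (evalAt v).comp (polyAct ρ h) = evalAt (ρ h⁻¹ v) from DFunLike.congr_fun this f
  refine SymmetricAlgebra.algHom_ext (LinearMap.ext fun x => ?_)
  simp [polyAct_ι, evalAt, Representation.dual_apply, Module.Dual.transpose_apply]

/-- The invariant algebra `k[V]^G`. -/
def invariantAlgebra {G : Type*} [Group G] (ρ : Representation k G V) :
    Subalgebra k (Poly k V) where
  carrier := {f | ∀ g, polyAct ρ g f = f}
  mul_mem' ha hb g := by rw [map_mul, ha g, hb g]
  add_mem' ha hb g := by rw [map_add, ha g, hb g]
  algebraMap_mem' r g := AlgHom.commutes _ r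

/-- `R` is a (homogeneous) Noether normalization of the subalgebra `B` of `k[V]`: a polynomial
algebra on finitely many homogeneous generators over which `B` is a finitely generated module. -/
structure IsNoetherNormalization (R B : Subalgebra k (Poly k V)) : Prop where
  le : R ≤ B
  finite : (Subalgebra.inclusion le).Finite
  polynomial : ∃ (n : ℕ) (f : Fin n → Poly k V), AlgebraicIndependent k f ∧
    (∀ i, ∃ d, f i ∈ homogeneousPart k V d) ∧ R = Algebra.adjoin k (Set.range f)

end Polynomials

/-! ### Fibers of `V → Spec R` -/

section Fibers

variable {k : Type*} [Field k] {V : Type*} [AddCommGroup V] [Module k V]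

variable (k V) in
/-- The geometric points of the affine space `V`, that is, the `k`-algebra homomorphisms from
`k[V]` to an algebraic closure of `k`. -/
abbrev GeomPoint : Type _ := Poly k V →ₐ[k] AlgebraicClosure k

/-- The action on points, `(h w)(f) = w (h⁻¹ f)`. -/
def pointAct {H : Type*} [Group H] (ρ : Representation k H V) (h : H) (w : GeomPoint k V) :
    GeomPoint k V :=
  w.comp (polyAct ρ h⁻¹)

/-- The fiber `Φ_v` through `v` of the map `V → Spec R`, given by its geometric points: those at
which every element of `R` takes the same value as at `v`. -/
def fiber (R : Subalgebra k (Poly k V)) (v : V) : Set (GeomPoint k V) :=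
  {w | ∀ f ∈ R, w f = algebraMap k (AlgebraicClosure k) (evalAt v f)}

/-- The maximal ideal `𝔪_{φ(v)}` of `R`. -/
def pointIdeal (R : Subalgebra k (Poly k V)) (v : V) : Ideal R :=
  RingHom.ker ((evalAt v).comp R.val)

/-- The ideal `𝔪_{φ(v)} k[V]`. -/
def fiberIdeal (R : Subalgebra k (Poly k V)) (v : V) : Ideal (Poly k V) :=
  (pointIdeal R v).map R.val

/-- The coordinate ring `A(Φ_v) = k[V] / 𝔪_{φ(v)} k[V]` of the scheme-theoretic fiber. -/
abbrev FiberRing (R : Subalgebra k (Poly k V)) (v : V) : Type _ := Poly k V ⧸ fiberIdeal R v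

theorem fiberIdeal_le_comap {R : Subalgebra k (Poly k V)} {v : V}
    (φ : Poly k V →ₐ[k] Poly k V) (h₁ : ∀ f ∈ R, φ f ∈ R)
    (h₂ : ∀ f ∈ R, evalAt v (φ f) = evalAt v f) :
    fiberIdeal R v ≤ (fiberIdeal R v).comap φ := by
  rw [fiberIdeal, Ideal.map_le_iff_le_comap]
  intro f hf
  have hf' : evalAt v (f : Poly k V) = 0 := hf
  refine Ideal.mem_map_of_mem R.val (x := ⟨φ f, h₁ f f.2⟩) ?_
  change evalAt v (φ f) = 0
  rw [h₂ f f.2, hf']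

theorem fiberIdeal_stable_of_invariant {G : Type*} [Group G] {ρ : Representation k G V}
    {R : Subalgebra k (Poly k V)} (hR : R ≤ invariantAlgebra ρ) (v : V) (g : G) :
    fiberIdeal R v ≤ (fiberIdeal R v).comap (polyAct ρ g) :=
  fiberIdeal_le_comap _ (fun f hf => by rwa [hR hf g]) (fun f hf => by rw [hR hf g])

theorem fiberIdeal_stable_of_fiber {C : Type*} [Group C] {ρ : Representation k C V}
    {R : Subalgebra k (Poly k V)} (hR : ∀ c, ∀ f ∈ R, polyAct ρ c f ∈ R) {v : V}
    (hv : ∀ c, ∀ w ∈ fiber R v, pointAct ρ c w ∈ fiber R v) (c : C) :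
    fiberIdeal R v ≤ (fiberIdeal R v).comap (polyAct ρ c) := by
  refine fiberIdeal_le_comap _ (hR c) fun f hf => ?_
  have := hv c⁻¹ ((Algebra.ofId k (AlgebraicClosure k)).comp (evalAt v)) (fun _ _ => rfl) f hf
  rw [pointAct, inv_inv] at this
  exact (algebraMap k (AlgebraicClosure k)).injective this

/-- The action on `A(Φ_v)` induced from the action on `k[V]`. -/
def fiberRep {H : Type*} [Group H] (ρ : Representation k H V) {R : Subalgebra k (Poly k V)} {v : V}
    (h : ∀ a, fiberIdeal R v ≤ (fiberIdeal R v).comap (polyAct ρ a)) :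
    Representation k H (FiberRing R v) where
  toFun a := (Ideal.quotientMapₐ (fiberIdeal R v) (polyAct ρ a) (h a)).toLinearMap
  map_one' := by
    refine LinearMap.ext fun x => ?_
    obtain ⟨x, rfl⟩ := Ideal.Quotient.mk_surjective x
    change Ideal.Quotient.mk _ (polyAct ρ 1 x) = Ideal.Quotient.mk _ x
    rw [map_one, AlgHom.one_apply]
  map_mul' a b := by
    refine LinearMap.ext fun x => ?_
    obtain ⟨x, rfl⟩ := Ideal.Quotient.mk_surjective x
    change Ideal.Quotient.mk _ (polyAct ρ (a * b) x) =
      Ideal.Quotient.mk _ (polyAct ρ a (polyAct ρ b x))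
    rw [map_mul, AlgHom.mul_apply]

theorem fiberRep_mk {H : Type*} [Group H] (ρ : Representation k H V)
    {R : Subalgebra k (Poly k V)} {v : V}
    (h : ∀ a, fiberIdeal R v ≤ (fiberIdeal R v).comap (polyAct ρ a)) (a : H) (f : Poly k V) :
    fiberRep ρ h a (Ideal.Quotient.mk _ f) = Ideal.Quotient.mk _ (polyAct ρ a f) := rfl

end Fibers

/-! ### Representations of commuting groups -/

section Representations

variable {k : Type*} [Field k] {W : Type*} [AddCommGroup W] [Module k W]
  {G Θ Γ C : Type*} [Group G] [Group Θ] [Group Γ] [Group C]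

/-- The action of `Θ` on the `G`-fixed vectors, when the actions of `Θ` and `G` commute. -/
def residualRep (σ : Representation k G W) (τ : Representation k Θ W)
    (h : ∀ g t x, σ g (τ t x) = τ t (σ g x)) : Representation k Θ σ.invariants :=
  τ.subrepresentation σ.invariants fun t x hx g => by rw [h, hx g]

/-- The action of `Γ × C` on `U ⊗ X` in which `Γ` acts on `U` only and `C` acts on `X` only. -/
def outerTensor {U X : Type*} [AddCommGroup U] [Module k U] [AddCommGroup X] [Module k X]
    (τ : Representation k Γ U) (σ : Representation k C X) : Representation k (Γ × C) (U ⊗[k] X) :=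
  Representation.tprod (τ.comp (MonoidHom.fst Γ C)) (σ.comp (MonoidHom.snd Γ C))

theorem tprod_commute_outerTensor {U X : Type*} [AddCommGroup U] [Module k U]
    [AddCommGroup X] [Module k X] {τG : Representation k G U} {σG : Representation k G X}
    {τ : Representation k Γ U} {σ : Representation k C X}
    (hU : ∀ γ g, Commute (τ γ) (τG g)) (hX : ∀ g c x, σG g (σ c x) = σ c (σG g x))
    (g : G) (t : Γ × C) (x : U ⊗[k] X) :
    (τG.tprod σG) g (outerTensor τ σ t x) = outerTensor τ σ t ((τG.tprod σG) g x) := by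
  induction x with
  | zero => simp
  | add x y hx hy => simp only [map_add, hx, hy]
  | tmul a b =>
    have := DFunLike.congr_fun (hU t.1 g).eq a
    simp only [Module.End.mul_apply] at this
    simp [outerTensor, Representation.tprod_apply, this, hX]

end Representations

/-! ### The Grothendieck group -/

section Grothendieck

variable (k : Type u) [Field k] (Θ : Type*) [Group Θ]

/-- The elements `[X] - [X'] - [X'']`, one for each short exact sequence `0 → X' → X → X'' → 0`
of finite-dimensional `k(Θ)`-modules. -/
def grothRelations : Set (FreeAbelianGroup (FDRep k Θ)) :=
  {z | ∃ (X' X X'' : FDRep k Θ) (f : X' →ₗ[k] X) (g : X →ₗ[k] X''),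
    (∀ t x, f (X'.ρ t x) = X.ρ t (f x)) ∧ (∀ t x, g (X.ρ t x) = X''.ρ t (g x)) ∧
    Function.Injective f ∧ Function.Exact f g ∧ Function.Surjective g ∧
    z = FreeAbelianGroup.of X - FreeAbelianGroup.of X' - FreeAbelianGroup.of X''}

/-- The Grothendieck group of finite-dimensional `k(Θ)`-modules. -/
abbrev Groth : Type _ := FreeAbelianGroup (FDRep k Θ) ⧸ AddSubgroup.closure (grothRelations k Θ)

variable {k Θ}

/-- The class `[X]` of a finite-dimensional representation. -/
def Groth.cls {X : Type u} [AddCommGroup X] [Module k X] (ρ : Representation k Θ X)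
    (_ : FiniteDimensional k X) : Groth k Θ :=
  QuotientAddGroup.mk (FreeAbelianGroup.of (FDRep.of ρ))

end Grothendieck

/-! ### `Tor^R(M, k)` with its grading and group action

For an augmented algebra `R` over the field `k` and an `R`-module `M`, `Tor^R(M, k)` is the
homology of `k ⊗_R -` applied to the bar resolution of `M` by free `R`-modules. Everything
acting compatibly on `R` and `M` acts diagonally on the bar resolution and hence on `Tor`. -/

section Bar

variable (k R M Θ : Type*) [Field k] [CommRing R] [Algebra k R] [AddCommGroup M] [Module k M]
  [Group Θ]

/-- An `R`-module structure on the `k`-vector space `M`, where `R` is an augmented `k`-algebra, a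
group `Θ` acts on `R` and compatibly on `M`, and all of this respects families of
homogeneous parts of `R` and of `M`. -/
structure EquivariantModule where
  /-- The augmentation, whose kernel is `R₊`. -/
  aug : R →ₐ[k] k
  /-- The module structure. -/
  act : R →ₐ[k] Module.End k M
  /-- The action of the group on the algebra. -/
  actR : Θ →* (R →ₐ[k] R)
  /-- The action of the group on the module. -/
  actM : Representation k Θ M
  /-- The homogeneous parts of `R`. -/
  partR : ℕ → Submodule k R
  /-- The homogeneous parts of `M`. -/
  partM : ℕ → Submodule k M
  aug_actR : ∀ t r, aug (actR t r) = aug r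
  actM_act : ∀ t r m, actM t (act r m) = act (actR t r) (actM t m)
  actR_mem : ∀ t j, ∀ r ∈ partR j, actR t r ∈ partR j
  actM_mem : ∀ t j, ∀ m ∈ partM j, actM t m ∈ partM j

/-- The bar complex in homological degree `n`: `R ⊗ ⋯ ⊗ R ⊗ M` with `n` factors `R`. -/
def Bar (n : ℕ) : Type _ := (⨂[k]^n R) ⊗[k] M

instance (n : ℕ) : AddCommGroup (Bar k R M n) := TensorProduct.addCommGroup

instance (n : ℕ) : Module k (Bar k R M n) := inferInstanceAs (Module k ((⨂[k]^n R) ⊗[k] M))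

variable {k R M Θ}

/-- The pure tensors `r₁ ⊗ ⋯ ⊗ rₙ ⊗ m`. -/
def Bar.mk (n : ℕ) : MultilinearMap k (fun _ : Fin n => R) (M →ₗ[k] Bar k R M n) :=
  (TensorProduct.mk k (⨂[k]^n R) M).compMultilinearMap (PiTensorProduct.tprod k)

/-- The linear map on the bar complex given by a multilinear map. -/
def Bar.lift {n : ℕ} {N : Type*} [AddCommGroup N] [Module k N]
    (f : MultilinearMap k (fun _ : Fin n => R) (M →ₗ[k] N)) : Bar k R M n →ₗ[k] N :=
  TensorProduct.lift (PiTensorProduct.lift f)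

theorem Bar.lift_mk {n : ℕ} {N : Type*} [AddCommGroup N] [Module k N]
    (f : MultilinearMap k (fun _ : Fin n => R) (M →ₗ[k] N)) (r : Fin n → R) (m : M) :
    Bar.lift f (Bar.mk n r m) = f r m := by
  change TensorProduct.lift (PiTensorProduct.lift f) (PiTensorProduct.tprod k r ⊗ₜ[k] m) = _
  rw [TensorProduct.lift.tmul, PiTensorProduct.lift.tprod]

theorem Bar.hom_ext {n : ℕ} {N : Type*} [AddCommGroup N] [Module k N]
    {f g : Bar k R M n →ₗ[k] N} (h : ∀ r m, f (Bar.mk n r m) = g (Bar.mk n r m)) : f = g := by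
  refine TensorProduct.ext (PiTensorProduct.ext (MultilinearMap.ext fun r => ?_))
  exact LinearMap.ext fun m => h r m

theorem contractNth_update {n : ℕ} (s : Fin n) (r : Fin (n + 1) → R) (i : Fin (n + 1)) :
    ∃ (l : Fin n) (L : R →ₗ[k] R), ∀ x,
      s.castSucc.contractNth (· * ·) (Function.update r i x) =
        Function.update (s.castSucc.contractNth (· * ·) r) l (L x) := by
  have hs := s.isLt
  rcases le_or_gt (i : ℕ) s with his | his
  · refine ⟨⟨i, by omega⟩,
      if (i : ℕ) < s then LinearMap.id else LinearMap.mulRight k (r s.succ), fun x => ?_⟩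
    funext j
    simp only [Fin.contractNth, Function.update_apply, Fin.ext_iff, Fin.val_castSucc, Fin.val_succ]
    split_ifs <;> first | omega | rfl | skip
    have hj : j.succ = s.succ := by ext; simp; omega
    simp [hj]
  · refine ⟨⟨i - 1, by omega⟩,
      if (s : ℕ) + 1 < i then LinearMap.id else LinearMap.mulLeft k (r s.castSucc), fun x => ?_⟩
    funext j
    simp only [Fin.contractNth, Function.update_apply, Fin.ext_iff, Fin.val_castSucc, Fin.val_succ]
    split_ifs <;> first | omega | rfl | skip
    have hj : j.castSucc = s.castSucc := by ext; simp; omega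
    simp [hj]

/-- The map `r₀ ⊗ ⋯ ⊗ rₙ ⊗ m ↦ r₀ ⊗ ⋯ ⊗ rₛ rₛ₊₁ ⊗ ⋯ ⊗ rₙ ⊗ m`. -/
def Bar.contract {n : ℕ} (s : Fin n) :
    MultilinearMap k (fun _ : Fin (n + 1) => R) (M →ₗ[k] Bar k R M n) where
  toFun r := Bar.mk n (s.castSucc.contractNth (· * ·) r)
  map_update_add' {inst} r i x y := by
    obtain rfl : inst = instDecidableEqFin _ := Subsingleton.elim _ _
    obtain ⟨l, L, h⟩ := contractNth_update (k := k) s r i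
    simp only [h, map_add, MultilinearMap.map_update_add]
  map_update_smul' {inst} r i c x := by
    obtain rfl : inst = instDecidableEqFin _ := Subsingleton.elim _ _
    obtain ⟨l, L, h⟩ := contractNth_update (k := k) s r i
    simp only [h, map_smul, MultilinearMap.map_update_smul]

namespace EquivariantModule

variable (D : EquivariantModule k R M Θ)

/-- The differential of the bar complex,
`r₀ ⊗ ⋯ ⊗ rₙ ⊗ m ↦ ε(r₀) r₁ ⊗ ⋯ ⊗ rₙ ⊗ m + ∑ₛ (-1)ˢ⁺¹ r₀ ⊗ ⋯ ⊗ rₛ rₛ₊₁ ⊗ ⋯ ⊗ rₙ ⊗ m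
+ (-1)ⁿ⁺¹ r₀ ⊗ ⋯ ⊗ rₙ₋₁ ⊗ rₙ m`. -/
def d (n : ℕ) : Bar k R M (n + 1) →ₗ[k] Bar k R M n :=
  Bar.lift
    (LinearMap.uncurryLeft (M := fun _ : Fin (n + 1) => R)
        (D.aug.toLinearMap.smulRight (Bar.mk n))
      + ∑ s : Fin n, (-1 : k) ^ ((s : ℕ) + 1) • Bar.contract s
      + (-1 : k) ^ (n + 1) • MultilinearMap.uncurryRight (M := fun _ : Fin (n + 1) => R)
          (((LinearMap.llcomp k M M (Bar k R M n)).compl₂ D.act.toLinearMap).compMultilinearMap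
            (Bar.mk n)))

theorem d_mk (n : ℕ) (r : Fin (n + 1) → R) (m : M) :
    D.d n (Bar.mk (n + 1) r m) =
      D.aug (r 0) • Bar.mk n (Fin.tail r) m
      + ∑ s : Fin n, (-1 : k) ^ ((s : ℕ) + 1) •
          Bar.mk n (s.castSucc.contractNth (· * ·) r) m
      + (-1 : k) ^ (n + 1) • Bar.mk n (Fin.init r) (D.act (r (Fin.last n)) m) := by
  rw [d, Bar.lift_mk]
  simp [Bar.contract, LinearMap.sum_apply]

/-- The diagonal action on the bar complex. -/
def barRep (n : ℕ) : Representation k Θ (Bar k R M n) where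
  toFun t := Bar.lift ((LinearMap.lcomp k (Bar k R M n) (D.actM t)).compMultilinearMap
    ((Bar.mk n).compLinearMap fun _ => (D.actR t).toLinearMap))
  map_one' := by
    refine Bar.hom_ext fun r m => ?_
    rw [Bar.lift_mk]
    simp
  map_mul' a b := by
    refine Bar.hom_ext fun r m => ?_
    rw [Bar.lift_mk, Module.End.mul_apply, Bar.lift_mk]
    simp [Bar.lift_mk]

theorem barRep_mk (n : ℕ) (t : Θ) (r : Fin n → R) (m : M) :
    D.barRep n t (Bar.mk n r m) = Bar.mk n (fun i => D.actR t (r i)) (D.actM t m) := by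
  simp [barRep, Bar.lift_mk]

theorem d_barRep (n : ℕ) (t : Θ) (x : Bar k R M (n + 1)) :
    D.d n (D.barRep (n + 1) t x) = D.barRep n t (D.d n x) := by
  suffices D.d n ∘ₗ D.barRep (n + 1) t = D.barRep n t ∘ₗ D.d n from DFunLike.congr_fun this x
  refine Bar.hom_ext fun r m => ?_
  have h : ∀ s : Fin n, (s.castSucc.contractNth (· * ·) fun i => D.actR t (r i)) =
      fun i => D.actR t (s.castSucc.contractNth (· * ·) r i) := by
    intro s
    funext i
    simp only [Fin.contractNth]
    split_ifs <;> simp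
  simp only [LinearMap.comp_apply, d_mk, barRep_mk, map_add, map_smul, map_sum, h, D.aug_actR,
    D.actM_act]
  rfl

/-- The part of internal degree `j` of the bar complex. -/
def barPart (n j : ℕ) : Submodule k (Bar k R M n) :=
  Submodule.span k {x | ∃ (a : Fin n → ℕ) (b : ℕ) (r : Fin n → R) (m : M),
    (∀ i, r i ∈ D.partR (a i)) ∧ m ∈ D.partM b ∧ ∑ i, a i + b = j ∧
    x = Bar.mk n r m}

theorem barRep_mem (n j : ℕ) (t : Θ) (x : Bar k R M n) (hx : x ∈ D.barPart n j) :
    D.barRep n t x ∈ D.barPart n j := by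
  suffices D.barPart n j ≤ (D.barPart n j).comap (D.barRep n t) from this hx
  refine Submodule.span_le.2 ?_
  rintro _ ⟨a, b, r, m, hr, hm, hj, rfl⟩
  refine Submodule.subset_span ⟨a, b, fun i => D.actR t (r i), D.actM t m,
    fun i => D.actR_mem t _ _ (hr i), D.actM_mem t _ _ hm, hj, D.barRep_mk n t r m⟩

/-- The cycles of homological degree `i` and internal degree `j`. -/
def cycles : (i j : ℕ) → Submodule k (Bar k R M i)
  | 0, j => D.barPart 0 j
  | i + 1, j => LinearMap.ker (D.d i) ⊓ D.barPart (i + 1) j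

/-- The boundaries of homological degree `i` and internal degree `j`. -/
def boundaries (i j : ℕ) : Submodule k (Bar k R M i) :=
  (D.barPart (i + 1) j).map (D.d i)

theorem cycles_stable (i j : ℕ) (t : Θ) :
    D.cycles i j ≤ (D.cycles i j).comap (D.barRep i t) := by
  intro x hx
  cases i with
  | zero => exact D.barRep_mem 0 j t x hx
  | succ i =>
    refine ⟨?_, D.barRep_mem _ j t x hx.2⟩
    have h : D.d i x = 0 := hx.1
    change D.d i (D.barRep (i + 1) t x) = 0
    rw [d_barRep, h, map_zero]

theorem boundaries_stable (i j : ℕ) (t : Θ) :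
    D.boundaries i j ≤ (D.boundaries i j).comap (D.barRep i t) := by
  rintro _ ⟨y, hy, rfl⟩
  exact ⟨D.barRep (i + 1) t y, D.barRep_mem _ j t y hy, D.d_barRep i t y⟩

/-- `Tor_i^R(M, k)_j`. -/
abbrev Tor (i j : ℕ) : Type _ :=
  D.cycles i j ⧸ (D.boundaries i j).submoduleOf (D.cycles i j)

/-- The action on `Tor_i^R(M, k)_j`. -/
def torRep (i j : ℕ) : Representation k Θ (D.Tor i j) :=
  ((D.barRep i).subrepresentation (D.cycles i j) (D.cycles_stable i j)).quotient
    ((D.boundaries i j).submoduleOf (D.cycles i j)) fun t _ hx => D.boundaries_stable i j t hx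

end EquivariantModule

end Bar

/-! ### Relative invariants -/

section RelativeInvariants

variable {k : Type*} [Field k] {V U : Type*} [AddCommGroup V] [Module k V] [AddCommGroup U]
  [Module k U] {G Γ C : Type*} [Group G] [Group Γ] [Group C]

/-- The relative invariants `M = (U ⊗ k[V])^G`. -/
abbrev relativeInvariants (ρG : Representation k G V) (τG : Representation k G U) :
    Submodule k (U ⊗[k] Poly k V) :=
  (τG.tprod (polyRep ρG)).invariants

/-- Multiplication of `U ⊗ k[V]` by the elements of `k[V]`. -/
def mulPoly : Poly k V →ₐ[k] Module.End k (U ⊗[k] Poly k V) :=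
  (Module.End.lTensorAlgHom k (Poly k V) U).comp (Algebra.lmul k (Poly k V))

theorem mulPoly_tmul (f : Poly k V) (u : U) (p : Poly k V) :
    mulPoly f (u ⊗ₜ[k] p) = u ⊗ₜ (f * p) := rfl

theorem tprod_mulPoly {H : Type*} [Group H] (ρ : Representation k H V) (τ : Representation k H U)
    (h : H) (f : Poly k V) (x : U ⊗[k] Poly k V) :
    (τ.tprod (polyRep ρ)) h (mulPoly f x) =
      mulPoly (polyAct ρ h f) ((τ.tprod (polyRep ρ)) h x) := by
  induction x with
  | zero => simp
  | add x y hx hy => simp only [map_add, hx, hy]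
  | tmul u p =>
    simp only [mulPoly_tmul, Representation.tprod_apply, TensorProduct.map_tmul, polyRep_apply,
      map_mul]

theorem outerTensor_mulPoly (ρ : Representation k C V) (τ : Representation k Γ U)
    (t : Γ × C) (f : Poly k V) (x : U ⊗[k] Poly k V) :
    outerTensor τ (polyRep ρ) t (mulPoly f x) =
      mulPoly (polyAct ρ t.2 f) (outerTensor τ (polyRep ρ) t x) := by
  induction x with
  | zero => simp
  | add x y hx hy => simp only [map_add, hx, hy]
  | tmul u p =>
    simp [mulPoly_tmul, outerTensor, Representation.tprod_apply, polyRep_apply]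

/-- The homogeneous part `U ⊗ k[V]_j` of `U ⊗ k[V]`. -/
def tensorPart (j : ℕ) : Submodule k (U ⊗[k] Poly k V) :=
  LinearMap.range ((homogeneousPart k V j).subtype.lTensor U)

theorem outerTensor_mem_tensorPart (ρ : Representation k C V) (τ : Representation k Γ U)
    (t : Γ × C) (j : ℕ) (x : U ⊗[k] Poly k V) (hx : x ∈ tensorPart j) :
    outerTensor τ (polyRep ρ) t x ∈ tensorPart j := by
  obtain ⟨y, rfl⟩ := hx
  induction y with
  | zero => simp
  | add x y hx hy => simp only [map_add]; exact add_mem hx hy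
  | tmul u p =>
    exact ⟨τ t.1 u ⊗ₜ ⟨polyRep ρ t.2 p, polyAct_homogeneous ρ t.2 j p.2⟩, rfl⟩

/-- The module `M = (U ⊗ k[V])^G` over a `C`-stable subalgebra `R` of `k[V]^G`, with its grading
and the action of `Γ × C` in which `Γ` acts on `U` only and `C` acts on `k[V]` only. The
augmentation of `R` is the evaluation at `0`. -/
def relativeInvariantsModule (ρG : Representation k G V) (ρC : Representation k C V)
    (hV : ∀ g c, Commute (ρG g) (ρC c))
    (τΓ : Representation k Γ U) (τG : Representation k G U)
    (hU : ∀ γ g, Commute (τΓ γ) (τG g))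
    (R : Subalgebra k (Poly k V)) (hR : R ≤ invariantAlgebra ρG)
    (hRC : ∀ c, ∀ f ∈ R, polyAct ρC c f ∈ R) :
    EquivariantModule k R (relativeInvariants ρG τG) (Γ × C) where
  aug := (evalAt 0).comp R.val
  act :=
    { toFun r := (mulPoly (r : Poly k V)).restrict fun x hx g => by
        rw [tprod_mulPoly, hR r.2 g, hx g]
      map_one' := by ext x; simp
      map_mul' a b := by ext x; simp; rfl
      map_zero' := by ext x; simp
      map_add' a b := by ext x; simp; rfl
      commutes' c := by ext x; simp }
  actR :=
    { toFun t := ((polyAct ρC t.2).comp R.val).codRestrict R fun r => hRC t.2 r r.2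
      map_one' := by ext x; simp
      map_mul' a b := by ext x; simp; rfl }
  actM := residualRep (τG.tprod (polyRep ρG)) (outerTensor τΓ (polyRep ρC))
    (tprod_commute_outerTensor hU (polyAct_commute ρG ρC hV))
  partR j := (homogeneousPart k V j).comap R.val.toLinearMap
  partM j := (tensorPart j).comap (relativeInvariants ρG τG).subtype
  aug_actR t r := by
    change evalAt 0 (polyAct ρC t.2 r) = evalAt 0 (r : Poly k V)
    rw [evalAt_polyAct, map_zero]
  actM_act t r m := Subtype.ext (outerTensor_mulPoly ρC τΓ t r m)
  actR_mem t j r hr := polyAct_homogeneous ρC t.2 j hr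
  actM_mem t j m hm := outerTensor_mem_tensorPart ρC τΓ t j m hm

/-- The fixed space `(U ⊗ A(Φ_v))^G`. -/
abbrev fiberInvariants (ρG : Representation k G V) (τG : Representation k G U)
    (R : Subalgebra k (Poly k V)) (hR : R ≤ invariantAlgebra ρG) (v : V) :
    Submodule k (U ⊗[k] FiberRing R v) :=
  (τG.tprod (fiberRep ρG (fiberIdeal_stable_of_invariant hR v))).invariants

/-- The action of `Γ × C` on `(U ⊗ A(Φ_v))^G` in which `Γ` acts on `U` only and `C` acts on
`A(Φ_v)` only. -/
def fiberInvariantsRep (ρG : Representation k G V) (ρC : Representation k C V)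
    (hV : ∀ g c, Commute (ρG g) (ρC c))
    (τΓ : Representation k Γ U) (τG : Representation k G U)
    (hU : ∀ γ g, Commute (τΓ γ) (τG g))
    (R : Subalgebra k (Poly k V)) (hR : R ≤ invariantAlgebra ρG)
    (hRC : ∀ c, ∀ f ∈ R, polyAct ρC c f ∈ R) (v : V)
    (hv : ∀ c, ∀ w ∈ fiber R v, pointAct ρC c w ∈ fiber R v) :
    Representation k (Γ × C) (fiberInvariants ρG τG R hR v) :=
  residualRep (τG.tprod (fiberRep ρG (fiberIdeal_stable_of_invariant hR v)))
    (outerTensor τΓ (fiberRep ρC (fiberIdeal_stable_of_fiber hRC hv)))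
    (tprod_commute_outerTensor hU fun g c x => by
      obtain ⟨f, rfl⟩ := Ideal.Quotient.mk_surjective x
      rw [fiberRep_mk, fiberRep_mk, fiberRep_mk, fiberRep_mk, polyAct_commute ρG ρC hV])

end RelativeInvariants

end RelInv

end

open RelInv

/-! The groups Tor^R(M, k) are the homology of the bar complex built with the augmentation
"evaluation at 0". The idea is to keep the bar complex and replace this augmentation by evaluation
at v. Only the term ε(r₀) r₁ ⊗ ⋯ ⊗ m of the differential changes. It does not change for constant
r₀, and if r₀ has positive degree, what is left after dropping r₀ has smaller internal degree. So
the new differential δ is the graded differential d plus terms of lower internal degree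
(`augBd_sub_augBd_mem_filt`): it filters the complex with the old complex as associated graded.
Since the fiber is stable under C, evaluation at v is C-invariant on R, and everything stays
equivariant. Euler characteristics are therefore the same for d and δ (`alternating_sum_eq_cls`),
and it remains to find the homology of δ, which is Tor^R(M, R/𝔪) with 𝔪 the ideal of φ(v).

In positive degrees it vanishes. By freeness and Dedekind's independence of characters, some trace ∑
g(s) is congruent to 1 modulo 𝔪 k[V]^G (`exists_one_sub_trace_mem`), whatever the characteristic. As
𝔪 annihilates Tor^R(M, R/𝔪) (`smulLast_mem_range`), the map x ↦ ∑ g(s x) is there a left inverse to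
the inclusion of M in U ⊗ k[V] (`Bar.ker_augBd_le_of_one_sub_mem`). So it suffices that
Tor^R_i(k[V], R/𝔪) = 0 for i > 0. Let R have n generators. Integrality over R puts into 𝔪 k[V] monic
polynomials in n different coordinates; they form a regular sequence, and dividing by them one at a
time reduces the claim to Tor_i = 0 for i > n (`Bar.ker_augBd_le_of_isRegularSeq`). In degree zero
the same trace identifies M/𝔪M with (U ⊗ A(Φ_v))^G (`restrictRelative_surjective`,
`restrictRelative_eq_zero_iff`).

Finiteness: the kernel of an augmentation of R is generated by a regular sequence of length n.
Running through it with a two-sided bar complex L ⊗ Bar(M) shows that Tor_i vanishes for i > n and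
has finite total dimension (`Bar.ker_augBd_le`, `Bar.augCycles_le_finite`). Hence the graded
homology vanishes in internal degrees from some J on, and the part F_J of internal degree below J
has the homology of the whole complex for δ as well. F_J is finite-dimensional in each homological
degree but never stops, because constants are allowed as tensor factors; the Euler characteristics
are cut off at a homological degree p, where the two truncation terms coincide. -/

noncomputable section

namespace RelInv

/-! ### The bar differential by recursion on the first tensor factor -/

section BarRecursion

variable {k R M : Type*} [Field k] [CommRing R] [Algebra k R] [AddCommGroup M] [Module k M]

namespace Bar

/-- Prepending a tensor factor. -/
def cons (n : ℕ) : R →ₗ[k] Bar k R M n →ₗ[k] Bar k R M (n + 1) :=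
  LinearMap.mk₂ k (fun r x => Bar.lift ((Bar.mk (k := k) (R := R) (M := M) (n + 1)).curryLeft r) x)
    (fun r r' x => by
      rw [← LinearMap.add_apply]
      refine DFunLike.congr_fun (Bar.hom_ext fun a m => ?_) x
      simp [Bar.lift_mk])
    (fun c r x => by
      rw [← LinearMap.smul_apply]
      refine DFunLike.congr_fun (Bar.hom_ext fun a m => ?_) x
      simp [Bar.lift_mk])
    (fun r x y => map_add _ _ _) (fun c r x => map_smul _ _ _)

theorem cons_mk (n : ℕ) (r : R) (a : Fin n → R) (m : M) :
    cons n r (Bar.mk (k := k) n a m) = Bar.mk (n + 1) (Fin.cons r a) m := by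
  simp [cons, Bar.lift_mk]

/-- Splitting off the first tensor factor. -/
def uncons (n : ℕ) : Bar k R M (n + 1) →ₗ[k] R ⊗[k] Bar k R M n :=
  Bar.lift (LinearMap.uncurryLeft (M := fun _ : Fin (n + 1) => R)
    { toFun r := ((TensorProduct.mk k R (Bar k R M n) r).compRight k
        (M := M)).compMultilinearMap (Bar.mk n)
      map_add' r r' := by ext; simp
      map_smul' c r := by ext; simp })

theorem uncons_mk (n : ℕ) (r : Fin (n + 1) → R) (m : M) :
    uncons n (Bar.mk (k := k) (n + 1) r m) = r 0 ⊗ₜ Bar.mk n (Fin.tail r) m := by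
  simp [uncons, Bar.lift_mk]

/-- `R ⊗ R^{⊗ n} ⊗ M ≃ R^{⊗ (n + 1)} ⊗ M`. -/
def consEquiv (n : ℕ) : R ⊗[k] Bar k R M n ≃ₗ[k] Bar k R M (n + 1) :=
  LinearEquiv.ofLinearMap (TensorProduct.lift (cons n)) (uncons n)
    (Bar.hom_ext fun r m => by simp [uncons_mk, cons_mk])
    (TensorProduct.ext (LinearMap.ext fun r => Bar.hom_ext fun a m => by
      simp [uncons_mk, cons_mk]))

theorem consEquiv_tmul (n : ℕ) (r : R) (x : Bar k R M n) :
    consEquiv n (r ⊗ₜ x) = cons n r x := rfl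

@[simp]
theorem consEquiv_symm_cons (n : ℕ) (r : R) (x : Bar k R M n) :
    (consEquiv n).symm (cons n r x) = r ⊗ₜ x := by
  rw [← consEquiv_tmul, LinearEquiv.symm_apply_apply]

theorem cons_ext {n : ℕ} {N : Type*} [AddCommGroup N] [Module k N]
    {f g : Bar k R M (n + 1) →ₗ[k] N} (h : ∀ r x, f (cons n r x) = g (cons n r x)) : f = g := by
  refine Bar.hom_ext fun r m => ?_
  rw [← Fin.cons_self_tail r, ← cons_mk, h]

variable (k R M) in
/-- `R` acts on the first tensor factor. -/
def consMul (n : ℕ) : R →ₗ[k] Bar k R M (n + 1) →ₗ[k] Bar k R M (n + 1) :=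
  LinearMap.mk₂ k (fun r x => consEquiv n ((LinearMap.mulLeft k r).rTensor _
      ((consEquiv n).symm x)))
    (fun r r' x => by
      rw [← map_add, ← LinearMap.add_apply, ← LinearMap.rTensor_add]
      congr 3
      ext; simp [add_mul])
    (fun c r x => by
      rw [← map_smul, ← LinearMap.smul_apply, ← LinearMap.rTensor_smul]
      congr 3
      ext; simp)
    (fun r x y => by simp) (fun c r x => by simp)

@[simp]
theorem consMul_cons (n : ℕ) (r r' : R) (x : Bar k R M n) :
    consMul k R M n r (cons n r' x) = cons n (r * r') x := by
  simp [consMul, consEquiv_tmul]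

theorem mk_zero_surjective : Function.Surjective (Bar.mk (k := k) (R := R) (M := M) 0 ![]) := by
  intro x
  suffices LinearMap.range (Bar.mk (k := k) (R := R) (M := M) 0 ![]) = ⊤ from
    LinearMap.range_eq_top.1 this x
  rw [← Submodule.ker_mkQ (LinearMap.range _), LinearMap.ker_eq_top]
  refine Bar.hom_ext fun r m => ?_
  rw [Subsingleton.elim r ![]]
  exact (Submodule.Quotient.mk_eq_zero _).2 ⟨m, rfl⟩

/-- Functoriality in the module. -/
def map {N : Type*} [AddCommGroup N] [Module k N] (n : ℕ) :
    (M →ₗ[k] N) →ₗ[k] Bar k R M n →ₗ[k] Bar k R N n :=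
  LinearMap.lTensorHom (⨂[k]^n R)

section Map

variable {N P : Type*} [AddCommGroup N] [Module k N] [AddCommGroup P] [Module k P]

@[simp]
theorem map_mk (n : ℕ) (f : M →ₗ[k] N) (r : Fin n → R) (m : M) :
    map n f (Bar.mk (k := k) n r m) = Bar.mk n r (f m) := rfl

@[simp]
theorem map_cons (n : ℕ) (f : M →ₗ[k] N) (r : R) (x : Bar k R M n) :
    map (n + 1) f (cons n r x) = cons n r (map n f x) := by
  suffices map (n + 1) f ∘ₗ cons n r = cons n r ∘ₗ map n f from DFunLike.congr_fun this x
  exact Bar.hom_ext fun a m => by simp [cons_mk]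

theorem map_comp (n : ℕ) (g : N →ₗ[k] P) (f : M →ₗ[k] N) (x : Bar k R M n) :
    map n (g ∘ₗ f) x = map n g (map n f x) :=
  LinearMap.lTensor_comp_apply _ _ _ _

@[simp]
theorem map_id (n : ℕ) (x : Bar k R M n) : map n LinearMap.id x = x :=
  LinearMap.lTensor_id_apply _ _ _

theorem map_injective (n : ℕ) {f : M →ₗ[k] N} (hf : Function.Injective f) :
    Function.Injective (map (R := R) n f) :=
  Module.Flat.lTensor_preserves_injective_linearMap _ hf

theorem map_surjective (n : ℕ) {f : M →ₗ[k] N} (hf : Function.Surjective f) :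
    Function.Surjective (map (R := R) n f) :=
  LinearMap.lTensor_surjective _ hf

theorem map_exact (n : ℕ) {f : M →ₗ[k] N} {g : N →ₗ[k] P} (hfg : Function.Exact f g)
    (hg : Function.Surjective g) : Function.Exact (map (R := R) n f) (map (R := R) n g) :=
  lTensor_exact _ hfg hg

end Map

variable (k R M) in
/-- Insertion of the factor `a` at all places, with alternating signs. -/
def insertion (a : R) : (n : ℕ) → Bar k R M n →ₗ[k] Bar k R M (n + 1)
  | 0 => cons 0 a
  | n + 1 => cons (n + 1) a -
      TensorProduct.lift ((cons (n + 1)).compl₂ (insertion a n)) ∘ₗ (consEquiv n).symm.toLinearMap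

theorem insertion_zero (a : R) (x : Bar k R M 0) : insertion k R M a 0 x = cons 0 a x := rfl

theorem insertion_succ (a : R) (n : ℕ) (r : R) (x : Bar k R M n) :
    insertion k R M a (n + 1) (cons n r x) =
      cons (n + 1) a (cons n r x) - cons (n + 1) r (insertion k R M a n x) := by
  simp [insertion]

/-- Only the summand with `a` in front sees the difference: there `r` multiplies `a` instead of the
old first factor. -/
theorem insertion_consMul (a r : R) (n : ℕ) (x : Bar k R M (n + 1)) :
    consMul k R M (n + 1) r (insertion k R M a (n + 1) x) =
      insertion k R M a (n + 1) (consMul k R M n r x) - cons (n + 1) a (consMul k R M n r x) +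
        cons (n + 1) (r * a) x := by
  suffices consMul k R M (n + 1) r ∘ₗ insertion k R M a (n + 1) =
      insertion k R M a (n + 1) ∘ₗ consMul k R M n r - cons (n + 1) a ∘ₗ consMul k R M n r +
        cons (n + 1) (r * a) from DFunLike.congr_fun this x
  refine cons_ext fun r' y => ?_
  simp [insertion_succ]
  abel

variable (M) in
/-- The map `r ⊗ x ↦ ε(r) x`. -/
def augFirst (ε : R →ₐ[k] k) (n : ℕ) : Bar k R M (n + 1) →ₗ[k] Bar k R M n :=
  TensorProduct.lift ((LinearMap.lsmul k (Bar k R M n)) ∘ₗ ε.toLinearMap) ∘ₗ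
    (consEquiv n).symm.toLinearMap

@[simp]
theorem augFirst_cons (ε : R →ₐ[k] k) (n : ℕ) (r : R) (x : Bar k R M n) :
    augFirst M ε n (cons n r x) = ε r • x := by
  simp [augFirst]

theorem augFirst_consMul (ε : R →ₐ[k] k) (n : ℕ) (r : R) (x : Bar k R M (n + 1)) :
    augFirst M ε n (consMul k R M n r x) = ε r • augFirst M ε n x := by
  suffices augFirst M ε n ∘ₗ consMul k R M n r = ε r • augFirst M ε n from
    DFunLike.congr_fun this x
  exact cons_ext fun r' y => by simp [mul_smul]

/-! ### The bar differential of an `R`-module, and homotopies for it -/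

variable [Module R M] [IsScalarTower k R M]

variable (k R M) in
/-- The action of `R` on the last tensor factor. -/
def smulLast (n : ℕ) : R →ₗ[k] Bar k R M n →ₗ[k] Bar k R M n :=
  map n ∘ₗ (Algebra.lsmul k k M).toLinearMap

@[simp]
theorem smulLast_mk (n : ℕ) (a : R) (r : Fin n → R) (m : M) :
    smulLast k R M n a (Bar.mk n r m) = Bar.mk n r (a • m) := rfl

@[simp]
theorem smulLast_cons (n : ℕ) (a r : R) (x : Bar k R M n) :
    smulLast k R M (n + 1) a (cons n r x) = cons n r (smulLast k R M n a x) :=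
  map_cons n _ r x

theorem smulLast_mul (n : ℕ) (a b : R) (x : Bar k R M n) :
    smulLast k R M n (a * b) x = smulLast k R M n a (smulLast k R M n b x) := by
  simp only [smulLast, LinearMap.comp_apply]
  rw [← map_comp]
  simp [Module.End.mul_eq_comp]

variable (k R M) in
/-- The differential of the bar resolution. -/
def bd : (n : ℕ) → Bar k R M (n + 1) →ₗ[k] Bar k R M n
  | 0 => TensorProduct.lift (smulLast k R M 0) ∘ₗ (consEquiv 0).symm.toLinearMap
  | n + 1 => TensorProduct.lift (consMul k R M n - (cons n).compl₂ (bd n)) ∘ₗ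
      (consEquiv (n + 1)).symm.toLinearMap

theorem bd_zero (r : R) (x : Bar k R M 0) : bd k R M 0 (cons 0 r x) = smulLast k R M 0 r x := by
  simp [bd]

theorem bd_succ (n : ℕ) (r : R) (x : Bar k R M (n + 1)) :
    bd k R M (n + 1) (cons (n + 1) r x) = consMul k R M n r x - cons n r (bd k R M n x) := by
  simp [bd]

/-- The bar resolution is a complex of `R`-modules, with `R` acting on the first factor. In the
lowest degree no factor is left after the differential, and the action becomes the one on `M`
(`bd_consMul_zero`). -/
theorem bd_consMul_one (n : ℕ) (r : R) (x : Bar k R M (n + 2)) :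
    bd k R M (n + 1) (consMul k R M (n + 1) r x) = consMul k R M n r (bd k R M (n + 1) x) := by
  suffices bd k R M (n + 1) ∘ₗ consMul k R M (n + 1) r = consMul k R M n r ∘ₗ bd k R M (n + 1) from
    DFunLike.congr_fun this x
  refine cons_ext fun r' y => ?_
  have h : consMul k R M n (r * r') = consMul k R M n r ∘ₗ consMul k R M n r' :=
    cons_ext fun _ _ => by simp [mul_assoc]
  simp [bd_succ, h]

theorem bd_consMul_zero (r : R) (x : Bar k R M 1) :
    bd k R M 0 (consMul k R M 0 r x) = smulLast k R M 0 r (bd k R M 0 x) := by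
  suffices bd k R M 0 ∘ₗ consMul k R M 0 r = smulLast k R M 0 r ∘ₗ bd k R M 0 from
    DFunLike.congr_fun this x
  refine cons_ext fun r' y => ?_
  simp [bd_zero, smulLast_mul]

theorem bd_bd (n : ℕ) (x : Bar k R M (n + 2)) : bd k R M n (bd k R M (n + 1) x) = 0 := by
  suffices bd k R M n ∘ₗ bd k R M (n + 1) = 0 from DFunLike.congr_fun this x
  clear x
  induction n with
  | zero =>
    refine cons_ext fun r x => ?_
    simp [bd_succ, bd_zero, bd_consMul_zero]
  | succ n ih =>
    refine cons_ext fun r x => ?_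
    have h := DFunLike.congr_fun ih x
    simp only [LinearMap.comp_apply, LinearMap.zero_apply] at h
    simp [bd_succ, bd_consMul_one, h]

theorem map_bd {N : Type*} [AddCommGroup N] [Module k N] [Module R N] [IsScalarTower k R N]
    (f : M →ₗ[R] N) (n : ℕ) (x : Bar k R M (n + 1)) :
    map n (f.restrictScalars k) (bd k R M n x) =
      bd k R N n (map (n + 1) (f.restrictScalars k) x) := by
  suffices map n (f.restrictScalars k) ∘ₗ bd k R M n =
    bd k R N n ∘ₗ map (n + 1) (f.restrictScalars k) from DFunLike.congr_fun this x
  clear x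
  induction n with
  | zero =>
    refine cons_ext fun r x => ?_
    simp only [LinearMap.comp_apply, map_cons, bd_zero]
    suffices map 0 (f.restrictScalars k) ∘ₗ smulLast k R M 0 r =
      smulLast k R N 0 r ∘ₗ map 0 (f.restrictScalars k) from DFunLike.congr_fun this x
    exact Bar.hom_ext fun a m => by simp
  | succ n ih =>
    refine cons_ext fun r x => ?_
    have h1 := DFunLike.congr_fun ih x
    simp only [LinearMap.comp_apply] at h1
    have h2 : map (n + 1) (f.restrictScalars k) ∘ₗ consMul k R M n r =
        consMul k R N n r ∘ₗ map (n + 1) (f.restrictScalars k) := cons_ext fun r' y => by simp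
    have h3 := DFunLike.congr_fun h2 x
    simp only [LinearMap.comp_apply] at h3
    simp only [LinearMap.comp_apply, map_cons, bd_succ, map_sub, h1, h3]

theorem bd_insertion_zero (a : R) (x : Bar k R M 0) :
    bd k R M 0 (insertion k R M a 0 x) = smulLast k R M 0 a x := bd_zero a x

/-- Inserting `a` before and after a factor `r` produces the products `a r` and `r a` with opposite
signs, which cancel because `R` is commutative. Only the product of `a` with the element of `M` at
the end survives, so insertion is a null-homotopy of multiplication by `a`. -/
theorem bd_insertion (a : R) (n : ℕ) (x : Bar k R M (n + 1)) :
    bd k R M (n + 1) (insertion k R M a (n + 1) x) + insertion k R M a n (bd k R M n x) =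
      smulLast k R M (n + 1) a x := by
  suffices bd k R M (n + 1) ∘ₗ insertion k R M a (n + 1) + insertion k R M a n ∘ₗ bd k R M n =
      smulLast k R M (n + 1) a from DFunLike.congr_fun this x
  clear x
  induction n with
  | zero =>
    refine cons_ext fun r x => ?_
    simp only [LinearMap.add_apply, LinearMap.comp_apply, insertion_succ, map_sub, bd_succ,
      consMul_cons, bd_zero, insertion_zero, smulLast_cons, mul_comm a r]
    abel
  | succ n ih =>
    refine cons_ext fun r x => ?_
    have h := DFunLike.congr_fun ih x
    simp only [LinearMap.add_apply, LinearMap.comp_apply] at h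
    simp only [LinearMap.add_apply, LinearMap.comp_apply, insertion_succ, map_sub, bd_succ,
      consMul_cons, smulLast_cons, insertion_consMul, ← h, map_add, mul_comm a r]
    abel

variable (M) in
/-- The differential of `k ⊗_R -` applied to the bar resolution. -/
def augBd (ε : R →ₐ[k] k) (n : ℕ) : Bar k R M (n + 1) →ₗ[k] Bar k R M n :=
  augFirst M ε n - bd k R M n

theorem augBd_cons (ε : R →ₐ[k] k) (n : ℕ) (r : R) (x : Bar k R M n) :
    augBd M ε n (cons n r x) = ε r • x - bd k R M n (cons n r x) := by
  simp [augBd]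

theorem augBd_augBd (ε : R →ₐ[k] k) (n : ℕ) (x : Bar k R M (n + 2)) :
    augBd M ε n (augBd M ε (n + 1) x) = 0 := by
  suffices augBd M ε n ∘ₗ augBd M ε (n + 1) = 0 from DFunLike.congr_fun this x
  refine cons_ext fun r x => ?_
  have h := bd_bd n (cons (n + 1) r x)
  rw [bd_succ, map_sub] at h
  simp only [LinearMap.comp_apply, augBd_cons, bd_succ, map_sub, map_smul, LinearMap.zero_apply]
  simp only [augBd, LinearMap.sub_apply, augFirst_consMul, smul_sub]
  rw [← h]
  abel

theorem map_augBd {N : Type*} [AddCommGroup N] [Module k N] [Module R N] [IsScalarTower k R N]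
    (ε : R →ₐ[k] k) (f : M →ₗ[R] N) (n : ℕ) (x : Bar k R M (n + 1)) :
    map n (f.restrictScalars k) (augBd M ε n x) =
      augBd N ε n (map (n + 1) (f.restrictScalars k) x) := by
  have h : map n (f.restrictScalars k) ∘ₗ augFirst M ε n =
    augFirst N ε n ∘ₗ map (n + 1) (f.restrictScalars k) := cons_ext fun r y => by simp
  have h' := DFunLike.congr_fun h x
  simp only [LinearMap.comp_apply] at h'
  simp only [augBd, LinearMap.sub_apply, map_sub, map_bd, h']

/-- Elements of the kernel of the augmentation annihilate the homology. -/
theorem smulLast_mem_range (ε : R →ₐ[k] k) {a : R} (ha : ε a = 0) (n : ℕ) (x : Bar k R M (n + 1))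
    (hx : augBd M ε n x = 0) :
    smulLast k R M (n + 1) a x ∈ LinearMap.range (augBd M ε (n + 1)) := by
  -- The summand with `a` in front contributes ε(a) = 0, so insertion anticommutes with `augFirst`.
  -- Hence, up to sign, it is a null-homotopy for `augBd` as well as for `bd`.
  have h1 : augFirst M ε (n + 1) ∘ₗ insertion k R M a (n + 1) +
      insertion k R M a n ∘ₗ augFirst M ε n = 0 := by
    refine cons_ext fun r y => ?_
    simp [insertion_succ, ha]
  have h2 := DFunLike.congr_fun h1 x
  simp only [LinearMap.add_apply, LinearMap.comp_apply, LinearMap.zero_apply] at h2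
  have h3 := congrArg (insertion k R M a n) hx
  simp only [augBd, LinearMap.sub_apply, map_sub, map_zero] at h3
  refine ⟨-insertion k R M a (n + 1) x, ?_⟩
  rw [← bd_insertion]
  simp only [augBd, LinearMap.sub_apply, map_neg]
  rw [eq_neg_of_add_eq_zero_left h2, sub_eq_zero.1 h3]
  abel

end Bar

/-- The differential in its recursive form. -/
theorem EquivariantModule.d_eq_augBd {Θ : Type*} [Group Θ] [Module R M] [IsScalarTower k R M]
    (D : EquivariantModule k R M Θ) (hact : ∀ r m, D.act r m = r • m) (n : ℕ) :
    D.d n = Bar.augBd M D.aug n := by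
  -- `bd` collects all terms of the differential except the augmentation term, with the opposite
  -- sign.
  have key : ∀ (n : ℕ) (r : Fin (n + 1) → R) (m : M),
      Bar.bd k R M n (Bar.mk (n + 1) r m) = ∑ s : Fin n, (-1 : k) ^ (s : ℕ) •
        Bar.mk n (s.castSucc.contractNth (· * ·) r) m
      + (-1 : k) ^ n • Bar.mk n (Fin.init r) (r (Fin.last n) • m) := by
    intro n
    induction n with
    | zero =>
      intro r m
      rw [← Fin.cons_self_tail r, ← Bar.cons_mk, Bar.bd_zero]
      simp
      congr 2
      exact Subsingleton.elim _ _
    | succ n ih =>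
      intro r m
      obtain ⟨a, r, rfl⟩ : ∃ a r', r = Fin.cons a r' := ⟨_, _, (Fin.cons_self_tail r).symm⟩
      have h0 : ((0 : Fin (n + 1)).castSucc.contractNth (· * ·)
          (Fin.cons a r : Fin (n + 2) → R)) = Fin.cons (a * r 0) (Fin.tail r) := by
        funext i
        refine Fin.cases ?_ (fun j => ?_) i
        · simp [Fin.contractNth]
        · simp [Fin.contractNth, Fin.tail]
      have h1 : ∀ s : Fin n, (s.succ.castSucc.contractNth (· * ·)
          (Fin.cons a r : Fin (n + 2) → R)) =
            Fin.cons a (s.castSucc.contractNth (· * ·) r) := by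
        intro s
        funext i
        refine Fin.cases ?_ (fun j => ?_) i
        · simp [Fin.contractNth]
        · simp [Fin.contractNth]
      have h2 : Fin.init (Fin.cons a r : Fin (n + 2) → R) = Fin.cons a (Fin.init r) := by
        funext i
        refine Fin.cases ?_ (fun j => ?_) i
        · simp [Fin.init]
        · simp [Fin.init]
      rw [← Bar.cons_mk, Bar.bd_succ, ih, Fin.sum_univ_succ, h0, h2]
      simp only [h1]
      rw [← Fin.cons_self_tail r, ← Bar.cons_mk, Bar.consMul_cons, Fin.cons_self_tail,
        Bar.cons_mk]
      simp only [map_add, map_sum, map_smul, Bar.cons_mk, Fin.val_zero, pow_zero, one_smul,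
        Fin.val_succ, pow_succ, mul_neg, mul_one, neg_smul, Finset.sum_neg_distrib,
        ← Fin.succ_last, Fin.cons_succ]
      abel
  refine Bar.hom_ext fun r m => ?_
  rw [D.d_mk, Bar.augBd, LinearMap.sub_apply, key]
  conv_rhs => rw [← Fin.cons_self_tail r, ← Bar.cons_mk, Bar.augFirst_cons, Fin.cons_self_tail]
  simp only [pow_succ, mul_neg, mul_one, neg_smul, Finset.sum_neg_distrib, hact]
  abel

end BarRecursion

/-! ### Exactness in short exact sequences of complexes -/

section Chase

variable {R A₁ A₀ B₂ B₁ B₀ C₂ C₁ C₀ : Type*} [CommRing R]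
  [AddCommGroup A₁] [Module R A₁] [AddCommGroup A₀] [Module R A₀] [AddCommGroup B₂] [Module R B₂]
  [AddCommGroup B₁] [Module R B₁] [AddCommGroup B₀] [Module R B₀] [AddCommGroup C₂] [Module R C₂]
  [AddCommGroup C₁] [Module R C₁] [AddCommGroup C₀] [Module R C₀]
  {a : A₁ →ₗ[R] A₀} {b₁ : B₂ →ₗ[R] B₁} {b₀ : B₁ →ₗ[R] B₀} {c₁ : C₂ →ₗ[R] C₁} {c₀ : C₁ →ₗ[R] C₀}
  {i₁ : A₁ →ₗ[R] B₁} {i₀ : A₀ →ₗ[R] B₀} {p₂ : B₂ →ₗ[R] C₂} {p₁ : B₁ →ₗ[R] C₁} {p₀ : B₀ →ₗ[R] C₀}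

/-- This is the part of the long exact sequence in which the homology of C lies between that of B in
the same degree and that of A one degree lower. The submodule `Z` stands for the cycles of A;
keeping it abstract covers the lowest degree, where no differential leaves A₀. -/
theorem ker_le_range_of_shortExact (hi : ∀ x, i₀ (a x) = b₀ (i₁ x))
    (h₁ : ∀ x, p₁ (b₁ x) = c₁ (p₂ x)) (h₀ : ∀ x, p₀ (b₀ x) = c₀ (p₁ x))
    (e₀ : Function.Exact i₀ p₀) (e₁ : Function.Exact i₁ p₁) (s₁ : Function.Surjective p₁)
    {Z : Submodule R A₀} (hZ : ∀ x, i₀ x ∈ LinearMap.range b₀ → x ∈ Z)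
    (hA : Z ≤ LinearMap.range a) (hB : LinearMap.ker b₀ ≤ LinearMap.range b₁) :
    LinearMap.ker c₀ ≤ LinearMap.range c₁ := by
  intro z hz
  obtain ⟨z, rfl⟩ := s₁ z
  obtain ⟨x, hx⟩ := (e₀ (b₀ z)).1 (by rw [h₀]; exact hz)
  obtain ⟨u, rfl⟩ := hA (hZ x ⟨z, hx.symm⟩)
  obtain ⟨q, hq⟩ := hB (show z - i₁ u ∈ LinearMap.ker b₀ by simp [← hi, hx])
  refine ⟨p₂ q, ?_⟩
  rw [← h₁, hq, map_sub, e₁.apply_apply_eq_zero, sub_zero]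

theorem exists_fg_map_eq {N P : Type*} [AddCommGroup N] [Module R N] [AddCommGroup P] [Module R P]
    (f : N →ₗ[R] P) {E : Submodule R P} (hE : E.FG) (h : E ≤ LinearMap.range f) :
    ∃ Y : Submodule R N, Y.FG ∧ Y.map f = E := by
  classical
  obtain ⟨S, rfl⟩ := hE
  choose g hg using fun x : S => h (Submodule.subset_span x.2)
  refine ⟨Submodule.span R (Set.range g), ⟨S.attach.image g, by simp⟩, ?_⟩
  rw [Submodule.map_span, ← Set.range_comp]
  congr 1
  ext x
  simp [hg]

/-- The same chase with "zero" weakened to "finitely generated modulo boundaries". The connecting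
map sends a cycle of C to an element of `WA` whose image in B is a boundary. Such images form a
submodule of a finitely generated module, which is finitely generated since R is noetherian; `Y`
lifts its generators. -/
theorem ker_le_fg_of_shortExact [IsNoetherianRing R] (hi : ∀ x, i₀ (a x) = b₀ (i₁ x))
    (h₁ : ∀ x, p₁ (b₁ x) = c₁ (p₂ x)) (h₀ : ∀ x, p₀ (b₀ x) = c₀ (p₁ x))
    (e₀ : Function.Exact i₀ p₀) (e₁ : Function.Exact i₁ p₁) (s₁ : Function.Surjective p₁)
    {Z : Submodule R A₀} (hZ : ∀ x, i₀ x ∈ LinearMap.range b₀ → x ∈ Z)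
    (hA : ∃ W : Submodule R A₀, W.FG ∧ Z ≤ W ⊔ LinearMap.range a)
    (hB : ∃ W : Submodule R B₁, W.FG ∧ LinearMap.ker b₀ ≤ W ⊔ LinearMap.range b₁) :
    ∃ W : Submodule R C₁, W.FG ∧ LinearMap.ker c₀ ≤ W ⊔ LinearMap.range c₁ := by
  obtain ⟨WA, hWA, hA⟩ := hA
  obtain ⟨WB, hWB, hB⟩ := hB
  have hE : (WA.map i₀ ⊓ LinearMap.range b₀).FG := by
    have : IsNoetherian R (WA.map i₀) := isNoetherian_of_fg_of_noetherian _ (hWA.map _)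
    exact Submodule.FG.of_le (hWA.map i₀) inf_le_left
  obtain ⟨Y, hY, hYE⟩ := exists_fg_map_eq b₀ hE inf_le_right
  refine ⟨(WB ⊔ Y).map p₁, (hWB.sup hY).map _, ?_⟩
  intro z hz
  obtain ⟨z, rfl⟩ := s₁ z
  obtain ⟨x, hx⟩ := (e₀ (b₀ z)).1 (by rw [h₀]; exact hz)
  obtain ⟨w, hw, _, ⟨u, rfl⟩, rfl⟩ := Submodule.mem_sup.1 (hA (hZ x ⟨z, hx.symm⟩))
  have hy : i₀ w ∈ Y.map b₀ := by
    rw [hYE]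
    refine ⟨⟨w, hw, rfl⟩, z - i₁ u, ?_⟩
    rw [map_sub, ← hi, ← hx, map_add, add_sub_cancel_right]
  obtain ⟨y, hy, hyw⟩ := hy
  have hk : z - i₁ u - y ∈ LinearMap.ker b₀ := by
    rw [LinearMap.mem_ker, map_sub, map_sub, ← hi, ← hx, map_add, hyw]
    abel
  obtain ⟨v, hv, _, ⟨q, rfl⟩, hq⟩ := Submodule.mem_sup.1 (hB hk)
  refine Submodule.mem_sup.2 ⟨p₁ (v + y), ⟨v + y, add_mem (Submodule.mem_sup_left hv)
    (Submodule.mem_sup_right hy), rfl⟩, c₁ (p₂ q), ⟨_, rfl⟩, ?_⟩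
  have : z = v + y + b₁ q + i₁ u := by
    rw [sub_sub, eq_comm, sub_eq_iff_eq_add] at hq
    rw [hq]
    abel
  rw [this, map_add p₁ _ (i₁ u), e₁.apply_apply_eq_zero, add_zero, ← h₁, ← map_add]

end Chase

/-! ### The two-sided bar complex -/

section TwoSided

variable {k R M L : Type*} [Field k] [CommRing R] [Algebra k R] [AddCommGroup M] [Module k M]
  [Module R M] [IsScalarTower k R M] [AddCommGroup L] [Module k L] [Module R L]
  [IsScalarTower k R L]

namespace Bar

variable (k R M L) in
/-- The differential of `L ⊗_R -` applied to the bar resolution of `M`. -/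
def tensorBd (n : ℕ) : L ⊗[k] Bar k R M (n + 1) →ₗ[R] L ⊗[k] Bar k R M n :=
  TensorProduct.AlgebraTensorModule.lift
    { toFun l := ((LinearMap.toSpanSingleton R L l).restrictScalars k).rTensor _ ∘ₗ
          (consEquiv n).symm.toLinearMap - TensorProduct.mk k L _ l ∘ₗ bd k R M n
      map_add' l l' := cons_ext fun r x => by simp [TensorProduct.add_tmul]; abel
      map_smul' s l := cons_ext fun r x => by
        simp [smul_sub, TensorProduct.smul_tmul', smul_comm r s l] }

theorem tensorBd_tmul_cons (n : ℕ) (l : L) (r : R) (x : Bar k R M n) :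
    tensorBd k R M L n (l ⊗ₜ cons n r x) = (r • l) ⊗ₜ x - l ⊗ₜ bd k R M n (cons n r x) := by
  simp [tensorBd]

variable (k R M) in
/-- `R` acts on the first tensor factor, and on the last one if there is no other. -/
theorem tensorBd_tmul_consMul (n : ℕ) (l : L) (r : R) (x : Bar k R M (n + 1)) :
    tensorBd k R M L n (l ⊗ₜ consMul k R M n r x) + l ⊗ₜ bd k R M n (consMul k R M n r x) =
      tensorBd k R M L n ((r • l) ⊗ₜ x) + (r • l) ⊗ₜ bd k R M n x := by
  suffices (tensorBd k R M L n).restrictScalars k ∘ₗ TensorProduct.mk k L _ l ∘ₗ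
      consMul k R M n r + TensorProduct.mk k L _ l ∘ₗ bd k R M n ∘ₗ consMul k R M n r =
      (tensorBd k R M L n).restrictScalars k ∘ₗ TensorProduct.mk k L _ (r • l) +
        TensorProduct.mk k L _ (r • l) ∘ₗ bd k R M n from DFunLike.congr_fun this x
  refine cons_ext fun r' y => ?_
  simp [tensorBd_tmul_cons, mul_comm r r', mul_smul]

theorem tensorBd_tensorBd (n : ℕ) (z : L ⊗[k] Bar k R M (n + 2)) :
    tensorBd k R M L n (tensorBd k R M L (n + 1) z) = 0 := by
  induction z with
  | zero => simp
  | add x y hx hy => simp [hx, hy]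
  | tmul l x =>
    suffices (tensorBd k R M L n).restrictScalars k ∘ₗ
        (tensorBd k R M L (n + 1)).restrictScalars k ∘ₗ TensorProduct.mk k L _ l = 0 from
      DFunLike.congr_fun this x
    refine cons_ext fun r y => ?_
    have h1 := tensorBd_tmul_consMul k R M n l r y
    have h2 := bd_bd n (cons (n + 1) r y)
    rw [bd_succ, map_sub, sub_eq_zero] at h2
    rw [h2] at h1
    simp only [LinearMap.comp_apply, LinearMap.restrictScalars_apply, TensorProduct.mk_apply,
      tensorBd_tmul_cons, map_sub, bd_succ, TensorProduct.tmul_sub, LinearMap.zero_apply]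
    rw [← eq_sub_iff_add_eq] at h1
    rw [h1]
    abel

section Functoriality

variable {L' : Type*} [AddCommGroup L'] [Module k L'] [Module R L'] [IsScalarTower k R L']

theorem rTensor_tensorBd (f : L →ₗ[R] L') (n : ℕ) (z : L ⊗[k] Bar k R M (n + 1)) :
    TensorProduct.AlgebraTensorModule.rTensor k (Bar k R M n) f (tensorBd k R M L n z) =
      tensorBd k R M L' n (TensorProduct.AlgebraTensorModule.rTensor k (Bar k R M (n + 1)) f z) := by
  induction z with
  | zero => simp
  | add x y hx hy => simp only [map_add, hx, hy]
  | tmul l x =>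
    suffices (TensorProduct.AlgebraTensorModule.rTensor k (Bar k R M n) f).restrictScalars k ∘ₗ
        (tensorBd k R M L n).restrictScalars k ∘ₗ TensorProduct.mk k L _ l =
        (tensorBd k R M L' n).restrictScalars k ∘ₗ TensorProduct.mk k L' _ (f l) from
      DFunLike.congr_fun this x
    refine cons_ext fun r y => ?_
    simp [tensorBd_tmul_cons]

end Functoriality

variable (k R M L) in
/-- The cycles of the two-sided bar complex. -/
def tensorCycles : (n : ℕ) → Submodule R (L ⊗[k] Bar k R M n)
  | 0 => ⊤
  | n + 1 => LinearMap.ker (tensorBd k R M L n)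

/-- Contracting homotopy for `L = R`. -/
theorem tensorBd_self (n : ℕ) (a : R) (x : Bar k R M n) :
    tensorBd k R M R n (1 ⊗ₜ cons n a x) = a ⊗ₜ x - 1 ⊗ₜ bd k R M n (cons n a x) := by
  simp [tensorBd_tmul_cons]

/-- For L = R the complex is the bar resolution itself, and a ⊗ x ↦ 1 ⊗ (a ⊗ x) contracts it. -/
theorem ker_tensorBd_self_le (n : ℕ) :
    LinearMap.ker (tensorBd k R M R n) ≤ LinearMap.range (tensorBd k R M R (n + 1)) := by
  have key : (tensorBd k R M R (n + 1)).restrictScalars k ∘ₗ TensorProduct.mk k R _ 1 ∘ₗ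
      (consEquiv (n + 1)).toLinearMap + TensorProduct.mk k R _ 1 ∘ₗ (consEquiv n).toLinearMap ∘ₗ
        (tensorBd k R M R n).restrictScalars k = LinearMap.id := by
    refine TensorProduct.ext (LinearMap.ext fun a => cons_ext fun r x => ?_)
    simp [consEquiv_tmul, tensorBd_tmul_cons, bd_succ, TensorProduct.tmul_sub, mul_comm a r]
  intro z hz
  have h := DFunLike.congr_fun key z
  have hz' : tensorBd k R M R n z = 0 := hz
  simp only [LinearMap.add_apply, LinearMap.comp_apply, LinearMap.restrictScalars_apply, hz',
    map_zero, add_zero, LinearMap.id_apply] at h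
  exact ⟨_, h⟩

/-- Modulo boundaries r ⊗ m equals 1 ⊗ r m, so in degree zero the homology for L = R is generated by
the classes 1 ⊗ m with m in a generating set of M. -/
theorem tensorCycles_self_zero [Module.Finite R M] :
    ∃ W : Submodule R (R ⊗[k] Bar k R M 0), W.FG ∧
      tensorCycles k R M R 0 ≤ W ⊔ LinearMap.range (tensorBd k R M R 0) := by
  obtain ⟨S, hS⟩ := Module.Finite.fg_top (R := R) (M := M)
  set e : M → R ⊗[k] Bar k R M 0 := fun m => 1 ⊗ₜ Bar.mk 0 ![] m with he
  classical
  refine ⟨Submodule.span R (e '' S), ⟨S.image e, by simp⟩, ?_⟩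
  set T := Submodule.span R (e '' S) ⊔ LinearMap.range (tensorBd k R M R 0) with hT
  have hsmul : ∀ (r : R) (m : M), r • e m - e (r • m) ∈ T := by
    intro r m
    refine Submodule.mem_sup_right ⟨1 ⊗ₜ cons 0 r (Bar.mk 0 ![] m), ?_⟩
    rw [tensorBd_self, bd_zero, smulLast_mk]
    simp [he, TensorProduct.smul_tmul']
  have hm : ∀ m : M, e m ∈ T := by
    intro m
    have : m ∈ Submodule.span R (S : Set M) := by rw [hS]; trivial
    induction this using Submodule.span_induction with
    | mem x hx => exact Submodule.mem_sup_left (Submodule.subset_span ⟨x, hx, rfl⟩)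
    | zero => simp [he]
    | add x y _ _ hx hy =>
      have : e (x + y) = e x + e y := by simp [he, TensorProduct.tmul_add]
      rw [this]
      exact add_mem hx hy
    | smul r x _ hx =>
      have := sub_mem (T.smul_mem r hx) (hsmul r x)
      rwa [sub_sub_cancel] at this
  intro z _
  induction z with
  | zero => exact zero_mem _
  | add x y hx hy => exact add_mem (hx trivial) (hy trivial)
  | tmul r x =>
    obtain ⟨m, rfl⟩ := mk_zero_surjective x
    have := T.smul_mem r (hm m)
    simpa [he, TensorProduct.smul_tmul'] using this

/-! ### Short exact sequences in the left argument of the two-sided complex -/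

section ShortExact

variable {L₁ L₂ L₃ : Type*} [AddCommGroup L₁] [Module k L₁] [Module R L₁] [IsScalarTower k R L₁]
  [AddCommGroup L₂] [Module k L₂] [Module R L₂] [IsScalarTower k R L₂]
  [AddCommGroup L₃] [Module k L₃] [Module R L₃] [IsScalarTower k R L₃]
  {f : L₁ →ₗ[R] L₂} {g : L₂ →ₗ[R] L₃}

theorem mem_tensorCycles_of_rTensor_mem_range (hf : Function.Injective f) (n : ℕ)
    (x : L₁ ⊗[k] Bar k R M n)
    (hx : TensorProduct.AlgebraTensorModule.rTensor k (Bar k R M n) f x ∈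
      LinearMap.range (tensorBd k R M L₂ n)) : x ∈ tensorCycles k R M L₁ n := by
  cases n with
  | zero => trivial
  | succ n =>
    obtain ⟨y, hy⟩ := hx
    have hinj : Function.Injective
        (TensorProduct.AlgebraTensorModule.rTensor k (Bar k R M n) f) :=
      Module.Flat.rTensor_preserves_injective_linearMap (f.restrictScalars k) hf
    refine hinj ?_
    rw [rTensor_tensorBd, ← hy, tensorBd_tensorBd, map_zero]

theorem ker_tensorBd_le_of_shortExact (hf : Function.Injective f) (hfg : Function.Exact f g)
    (hg : Function.Surjective g) (n : ℕ)
    (h₁ : tensorCycles k R M L₁ n ≤ LinearMap.range (tensorBd k R M L₁ n))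
    (h₂ : LinearMap.ker (tensorBd k R M L₂ n) ≤ LinearMap.range (tensorBd k R M L₂ (n + 1))) :
    LinearMap.ker (tensorBd k R M L₃ n) ≤ LinearMap.range (tensorBd k R M L₃ (n + 1)) :=
  ker_le_range_of_shortExact (rTensor_tensorBd f n) (rTensor_tensorBd g (n + 1))
    (rTensor_tensorBd g n)
    (rTensor_exact (Bar k R M n) (f := f.restrictScalars k) (g := g.restrictScalars k) hfg hg)
    (rTensor_exact (Bar k R M (n + 1)) (f := f.restrictScalars k) (g := g.restrictScalars k) hfg hg)
    (LinearMap.rTensor_surjective _ (g := g.restrictScalars k) hg)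
    (mem_tensorCycles_of_rTensor_mem_range hf n) h₁ h₂

theorem tensorCycles_le_fg_of_shortExact [IsNoetherianRing R] (hf : Function.Injective f)
    (hfg : Function.Exact f g) (hg : Function.Surjective g)
    (h₁ : ∀ n, ∃ W : Submodule R (L₁ ⊗[k] Bar k R M n), W.FG ∧
      tensorCycles k R M L₁ n ≤ W ⊔ LinearMap.range (tensorBd k R M L₁ n))
    (h₂ : ∀ n, ∃ W : Submodule R (L₂ ⊗[k] Bar k R M n), W.FG ∧
      tensorCycles k R M L₂ n ≤ W ⊔ LinearMap.range (tensorBd k R M L₂ n)) (n : ℕ) :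
    ∃ W : Submodule R (L₃ ⊗[k] Bar k R M n), W.FG ∧
      tensorCycles k R M L₃ n ≤ W ⊔ LinearMap.range (tensorBd k R M L₃ n) := by
  have surj : ∀ n, Function.Surjective
      (TensorProduct.AlgebraTensorModule.rTensor k (Bar k R M n) g) := fun n =>
    LinearMap.rTensor_surjective _ (g := g.restrictScalars k) hg
  cases n with
  -- In degree zero every element is a cycle, and right exactness is enough.
  | zero =>
    obtain ⟨W, hW, h⟩ := h₂ 0
    refine ⟨W.map (TensorProduct.AlgebraTensorModule.rTensor k (Bar k R M 0) g), hW.map _, ?_⟩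
    intro z _
    obtain ⟨z, rfl⟩ := surj 0 z
    obtain ⟨w, hw, _, ⟨u, rfl⟩, rfl⟩ := Submodule.mem_sup.1 (h (x := z) trivial)
    rw [map_add, rTensor_tensorBd]
    exact Submodule.add_mem_sup ⟨w, hw, rfl⟩ ⟨_, rfl⟩
  | succ n =>
    exact ker_le_fg_of_shortExact (rTensor_tensorBd f n) (rTensor_tensorBd g (n + 1))
      (rTensor_tensorBd g n)
      (rTensor_exact (Bar k R M n) (f := f.restrictScalars k) (g := g.restrictScalars k) hfg hg)
      (rTensor_exact (Bar k R M (n + 1)) (f := f.restrictScalars k) (g := g.restrictScalars k)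
        hfg hg)
      (surj (n + 1)) (mem_tensorCycles_of_rTensor_mem_range hf n) (h₁ n) (h₂ (n + 1))

end ShortExact

end Bar

end TwoSided

/-! ### Regular sequences -/

section RegularSequences

/-- The ideal generated by the first `s` members of a sequence. -/
def prefixIdeal {S : Type*} [CommRing S] {n : ℕ} (y : Fin n → S) (s : ℕ) : Ideal S :=
  Ideal.span (y '' {j | (j : ℕ) < s})

/-- Every member of the sequence is a nonzerodivisor modulo the preceding ones. -/
def IsRegularSeq {S : Type*} [CommRing S] {n : ℕ} (y : Fin n → S) : Prop :=
  ∀ (s : Fin n) (q : S), y s * q ∈ prefixIdeal y s → q ∈ prefixIdeal y s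

variable {S : Type*} [CommRing S] {n : ℕ} {y : Fin n → S}

variable (y) in
theorem prefixIdeal_zero : prefixIdeal y 0 = ⊥ := by
  simp [prefixIdeal]

variable (y) in
theorem prefixIdeal_succ (s : Fin n) :
    prefixIdeal y (s + 1) = prefixIdeal y s ⊔ Ideal.span {y s} := by
  rw [prefixIdeal, prefixIdeal, ← Ideal.span_union, ← Set.image_singleton, ← Set.image_union]
  congr 2
  ext j
  simp [Fin.ext_iff]
  omega

variable (y) in
theorem prefixIdeal_le_succ (s : Fin n) : prefixIdeal y s ≤ prefixIdeal y (s + 1) := by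
  rw [prefixIdeal_succ]
  exact le_sup_left

theorem IsRegularSeq.lsmul_injective (hy : IsRegularSeq y) (s : Fin n) :
    Function.Injective (LinearMap.lsmul S (S ⧸ prefixIdeal y s) (y s)) := by
  rw [injective_iff_map_eq_zero]
  intro q hq
  obtain ⟨q, rfl⟩ := Ideal.Quotient.mk_surjective q
  refine Ideal.Quotient.eq_zero_iff_mem.2 (hy s q ?_)
  exact Ideal.Quotient.eq_zero_iff_mem.1 hq

variable (y) in
theorem exact_lsmul_factor (s : Fin n) :
    Function.Exact (LinearMap.lsmul S (S ⧸ prefixIdeal y s) (y s))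
      (Submodule.factor (prefixIdeal_le_succ y s)) := by
  intro q
  obtain ⟨q, rfl⟩ := Ideal.Quotient.mk_surjective q
  constructor
  · intro hq
    have hq' : q ∈ prefixIdeal y (s + 1) := Ideal.Quotient.eq_zero_iff_mem.1 hq
    rw [prefixIdeal_succ] at hq'
    obtain ⟨a, ha, b, hb, rfl⟩ := Submodule.mem_sup.1 hq'
    obtain ⟨b, rfl⟩ := Ideal.mem_span_singleton'.1 hb
    refine ⟨Ideal.Quotient.mk _ b, ?_⟩
    rw [map_add, Ideal.Quotient.eq_zero_iff_mem.2 ha, zero_add, mul_comm]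
    rfl
  · rintro ⟨r, hr⟩
    obtain ⟨r, rfl⟩ := Ideal.Quotient.mk_surjective r
    rw [← hr]
    have : y s * r ∈ prefixIdeal y (s + 1) := Ideal.mul_mem_right _ _ (Ideal.subset_span ⟨s, by simp, rfl⟩)
    exact Ideal.Quotient.eq_zero_iff_mem.2 this

/-- Modulo `J` the polynomial `p` stays monic, and a monic polynomial is a nonzerodivisor over any
coefficient ring. -/
theorem mem_map_C_of_monic_mul_mem {B : Type*} [CommRing B] {J : Ideal B} {p q : Polynomial B}
    (hp : p.Monic) (h : p * q ∈ J.map Polynomial.C) : q ∈ J.map Polynomial.C := by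
  have key : J.map Polynomial.C = RingHom.ker (Polynomial.mapRingHom (Ideal.Quotient.mk J)) := by
    rw [Polynomial.ker_mapRingHom, Ideal.mk_ker]
  rw [key, RingHom.mem_ker] at h ⊢
  rw [map_mul] at h
  exact ((hp.map (Ideal.Quotient.mk J)).mul_right_eq_zero_iff).1 h

/-- Regard the ring as polynomials in X_s over the ring in the other variables. The ideal is
generated by constants, as s ∉ T, and p_s(X_s) is monic, so `mem_map_C_of_monic_mul_mem` applies. -/
theorem MvPolynomial.mem_span_of_aeval_X_mul_mem {σ k : Type*} [CommRing k]
    {p : σ → Polynomial k} (hp : ∀ j, (p j).Monic) {T : Set σ} {s : σ} (hs : s ∉ T)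
    {q : MvPolynomial σ k}
    (h : Polynomial.aeval (MvPolynomial.X s) (p s) * q ∈
      Ideal.span ((fun j => Polynomial.aeval (MvPolynomial.X j : MvPolynomial σ k) (p j)) '' T)) :
    q ∈ Ideal.span
      ((fun j => Polynomial.aeval (MvPolynomial.X j : MvPolynomial σ k) (p j)) '' T) := by
  classical
  let e : MvPolynomial σ k ≃ₐ[k] Polynomial (MvPolynomial {j // j ≠ s} k) :=
    (MvPolynomial.renameEquiv k (Equiv.optionSubtypeNe s).symm).trans
      (MvPolynomial.optionEquivLeft k _)
  have es : e (MvPolynomial.X s) = Polynomial.X := by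
    simp [e, MvPolynomial.optionEquivLeft_X_none]
  have ej : ∀ j (hj : j ≠ s), e (MvPolynomial.X j) = Polynomial.C (MvPolynomial.X ⟨j, hj⟩) := by
    intro j hj
    simp [e, Equiv.optionSubtypeNe_symm_of_ne hj, MvPolynomial.optionEquivLeft_X_some]
  set J : Ideal (MvPolynomial {j // j ≠ s} k) := Ideal.span
    ((fun j => Polynomial.aeval (MvPolynomial.X j : MvPolynomial {j // j ≠ s} k) (p j)) ''
      {j | (j : σ) ∈ T}) with hJ
  have hmap : (Ideal.span ((fun j => Polynomial.aeval (MvPolynomial.X j : MvPolynomial σ k) (p j))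
      '' T)).map e = J.map Polynomial.C := by
    rw [hJ, Ideal.map_span, Ideal.map_span, ← Set.image_comp, ← Set.image_comp]
    congr 1
    have hC : ∀ (j : σ) (hj : j ≠ s), e (Polynomial.aeval (MvPolynomial.X j) (p j)) =
        Polynomial.C (Polynomial.aeval (MvPolynomial.X ⟨j, hj⟩) (p j)) := by
      intro j hj
      refine (Polynomial.aeval_algHom_apply e.toAlgHom _ _).symm.trans ?_
      change Polynomial.aeval (e (MvPolynomial.X j)) (p j) = _
      rw [ej j hj]
      exact Polynomial.aeval_algHom_apply
        (IsScalarTower.toAlgHom k (MvPolynomial {j // j ≠ s} k) _) _ _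
    ext f
    constructor
    · rintro ⟨j, hj, rfl⟩
      have hjs : j ≠ s := fun h => hs (h ▸ hj)
      exact ⟨⟨j, hjs⟩, hj, (hC j hjs).symm⟩
    · rintro ⟨⟨j, hjs⟩, hj, rfl⟩
      exact ⟨j, hj, hC j hjs⟩
  have h' := Ideal.mem_map_of_mem e h
  rw [hmap, map_mul] at h'
  have hmonic : (e (Polynomial.aeval (MvPolynomial.X s) (p s))).Monic := by
    have : e (Polynomial.aeval (MvPolynomial.X s) (p s)) =
        (p s).map (algebraMap k (MvPolynomial {j // j ≠ s} k)) := by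
      have h1 := Polynomial.aeval_algHom_apply e.toAlgHom (MvPolynomial.X s) (p s)
      change Polynomial.aeval (e (MvPolynomial.X s)) (p s) = _ at h1
      rw [es] at h1
      rw [← Polynomial.aeval_X_left_eq_map]
      exact h1.symm
    rw [this]
    exact (hp s).map _
  have h2 := mem_map_C_of_monic_mul_mem hmonic h'
  rw [← hmap] at h2
  have h3 := Ideal.mem_map_of_mem e.symm h2
  have h4 : ((Ideal.span ((fun j => Polynomial.aeval (MvPolynomial.X j : MvPolynomial σ k) (p j))
      '' T)).map e).map e.symm = Ideal.span
        ((fun j => Polynomial.aeval (MvPolynomial.X j : MvPolynomial σ k) (p j)) '' T) := by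
    exact Ideal.map_of_equiv e.toRingEquiv
  rwa [h4, AlgEquiv.symm_apply_apply] at h3

/-- Monic polynomials in distinct variables form a regular sequence. -/
theorem isRegularSeq_aeval {σ k S : Type*} [CommRing k] [CommRing S] [Algebra k S]
    (e : MvPolynomial σ k ≃ₐ[k] S) {n : ℕ} (i : Fin n ↪ σ) {p : Fin n → Polynomial k}
    (hp : ∀ j, (p j).Monic) :
    IsRegularSeq fun j => Polynomial.aeval (e (MvPolynomial.X (i j))) (p j) := by
  classical
  intro s q hq
  set y : Fin n → S := fun j => Polynomial.aeval (e (MvPolynomial.X (i j))) (p j) with hy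
  -- Outside the image of `i` any monic polynomial would do: the ideal involves only indices in the
  -- image.
  let p' : σ → Polynomial k := Function.extend i p fun _ => 1
  have hpi : ∀ l, p' (i l) = p l := fun l => i.injective.extend_apply _ _ _
  have hp' : ∀ j, (p' j).Monic := by
    intro j
    by_cases hj : ∃ l, i l = j
    · obtain ⟨l, rfl⟩ := hj
      rw [hpi]
      exact hp l
    · rw [show p' j = 1 from Function.extend_apply' _ _ _ hj]
      exact Polynomial.monic_one
  have hy' : ∀ j, e (Polynomial.aeval (MvPolynomial.X (i j)) (p' (i j))) = y j := by
    intro j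
    rw [hpi]
    exact (Polynomial.aeval_algHom_apply e.toAlgHom _ _).symm
  have hmap : (Ideal.span ((fun j => Polynomial.aeval (MvPolynomial.X j : MvPolynomial σ k) (p' j))
      '' (i '' {j | (j : ℕ) < s}))).map e.toRingEquiv = prefixIdeal y s := by
    rw [prefixIdeal, Ideal.map_span, ← Set.image_comp, ← Set.image_comp]
    congr 1
    exact Set.image_congr fun j _ => hy' j
  have key := MvPolynomial.mem_span_of_aeval_X_mul_mem hp' (T := i '' {j | (j : ℕ) < s})
    (s := i s) (q := e.symm q) (by simp)
  rw [← hmap] at hq ⊢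
  rw [Ideal.mem_map_of_equiv] at hq ⊢
  obtain ⟨x, hx, hxq⟩ := hq
  refine ⟨e.symm q, key ?_, e.apply_symm_apply q⟩
  convert hx
  apply e.injective
  rw [map_mul, hy', e.apply_symm_apply]
  exact hxq.symm

end RegularSequences

/-! ### Vanishing and finiteness of the homology of the bar complex -/

section Vanishing

variable {k R : Type*} [Field k] [CommRing R] [Algebra k R]

namespace Bar

section

variable {M : Type*} [AddCommGroup M] [Module k M]

variable (M) in
/-- For `L = R / ker ε` the two-sided bar complex is the bar complex of `ε`. -/
def augEquiv (ε : R →ₐ[k] k) (n : ℕ) :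
    (R ⧸ RingHom.ker ε) ⊗[k] Bar k R M n ≃ₗ[k] Bar k R M n :=
  (TensorProduct.congr (Ideal.quotientKerAlgEquivOfSurjective (f := ε)
    fun c => ⟨algebraMap k R c, ε.commutes c⟩).toLinearEquiv (LinearEquiv.refl k _)) ≪≫ₗ
    TensorProduct.lid k _

theorem augEquiv_mk_tmul (ε : R →ₐ[k] k) (n : ℕ) (r : R) (x : Bar k R M n) :
    augEquiv M ε n (Ideal.Quotient.mk _ r ⊗ₜ x) = ε r • x := rfl

theorem augEquiv_smul (ε : R →ₐ[k] k) (n : ℕ) (r : R)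
    (z : (R ⧸ RingHom.ker ε) ⊗[k] Bar k R M n) :
    augEquiv M ε n (r • z) = ε r • augEquiv M ε n z := by
  induction z with
  | zero => simp
  | add x y hx hy => simp only [smul_add, map_add, hx, hy]
  | tmul l x =>
    obtain ⟨l, rfl⟩ := Ideal.Quotient.mk_surjective l
    have : r • (Ideal.Quotient.mk (RingHom.ker ε) l) = Ideal.Quotient.mk _ (r * l) := rfl
    rw [TensorProduct.smul_tmul', this, augEquiv_mk_tmul, augEquiv_mk_tmul, map_mul, mul_smul]

variable [Module R M] [IsScalarTower k R M]

theorem ker_tensorBd_quotient_bot_le (n : ℕ) :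
    LinearMap.ker (tensorBd k R M (R ⧸ (⊥ : Ideal R)) n) ≤
      LinearMap.range (tensorBd k R M (R ⧸ (⊥ : Ideal R)) (n + 1)) := by
  -- With the zero module on the left, the chase transports exactness along the isomorphism R ≅ R/0.
  refine ker_tensorBd_le_of_shortExact (L₁ := PUnit) (f := (0 : PUnit →ₗ[R] R))
    (g := Submodule.mkQ (⊥ : Ideal R)) (Function.injective_of_subsingleton _) ?_
    (Submodule.mkQ_surjective _) n ?_ (ker_tensorBd_self_le n)
  · intro x
    change Ideal.Quotient.mk ⊥ x = 0 ↔ _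
    rw [Ideal.Quotient.eq_zero_iff_mem]
    simp [eq_comm]
  · intro z _
    have : z = 0 := Subsingleton.elim _ _
    rw [this]
    exact zero_mem _

theorem tensorCycles_quotient_bot_le_fg [IsNoetherianRing R] [Module.Finite R M] (n : ℕ) :
    ∃ W : Submodule R ((R ⧸ (⊥ : Ideal R)) ⊗[k] Bar k R M n), W.FG ∧
      tensorCycles k R M (R ⧸ (⊥ : Ideal R)) n ≤
        W ⊔ LinearMap.range (tensorBd k R M (R ⧸ (⊥ : Ideal R)) n) := by
  refine tensorCycles_le_fg_of_shortExact (L₁ := PUnit) (f := (0 : PUnit →ₗ[R] R))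
    (g := Submodule.mkQ (⊥ : Ideal R)) (Function.injective_of_subsingleton _) ?_
    (Submodule.mkQ_surjective _) ?_ ?_ n
  · intro x
    change Ideal.Quotient.mk ⊥ x = 0 ↔ _
    rw [Ideal.Quotient.eq_zero_iff_mem]
    simp [eq_comm]
  · intro n
    refine ⟨⊥, Submodule.fg_bot, fun z _ => ?_⟩
    have : z = 0 := Subsingleton.elim _ _
    rw [this]
    exact zero_mem _
  · rintro (_ | n)
    · exact tensorCycles_self_zero
    · exact ⟨⊥, Submodule.fg_bot, (ker_tensorBd_self_le n).trans le_sup_right⟩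

/-- Each member of the regular sequence raises the flat dimension of the quotient by at most one.
The kernel at index `m` consists of the cycles of homological degree m + 1, so `s ≤ m` says that the
degree exceeds s. -/
theorem ker_tensorBd_quotient_le {n : ℕ} {z : Fin n → R} (hz : IsRegularSeq z) (s : ℕ)
    (hs : s ≤ n) (m : ℕ) (hm : s ≤ m) :
    LinearMap.ker (tensorBd k R M (R ⧸ prefixIdeal z s) m) ≤
      LinearMap.range (tensorBd k R M (R ⧸ prefixIdeal z s) (m + 1)) := by
  induction s generalizing m with
  | zero =>
    rw [prefixIdeal_zero]
    exact ker_tensorBd_quotient_bot_le m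
  | succ s ih =>
    obtain ⟨m, rfl⟩ : ∃ m', m = m' + 1 := ⟨m - 1, by omega⟩
    exact ker_tensorBd_le_of_shortExact (hz.lsmul_injective ⟨s, hs⟩)
      (exact_lsmul_factor z ⟨s, hs⟩) (Submodule.factor_surjective (prefixIdeal_le_succ z ⟨s, hs⟩))
      (m + 1) (ih (by omega) m (by omega)) (ih (by omega) (m + 1) (by omega))

theorem tensorCycles_quotient_le_fg [IsNoetherianRing R] [Module.Finite R M] {n : ℕ}
    {z : Fin n → R} (hz : IsRegularSeq z) (s : ℕ) (hs : s ≤ n) (m : ℕ) :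
    ∃ W : Submodule R ((R ⧸ prefixIdeal z s) ⊗[k] Bar k R M m), W.FG ∧
      tensorCycles k R M (R ⧸ prefixIdeal z s) m ≤
        W ⊔ LinearMap.range (tensorBd k R M (R ⧸ prefixIdeal z s) m) := by
  induction s generalizing m with
  | zero =>
    rw [prefixIdeal_zero]
    exact tensorCycles_quotient_bot_le_fg m
  | succ s ih =>
    exact tensorCycles_le_fg_of_shortExact (hz.lsmul_injective ⟨s, hs⟩)
      (exact_lsmul_factor z ⟨s, hs⟩) (Submodule.factor_surjective (prefixIdeal_le_succ z ⟨s, hs⟩))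
      (ih (by omega)) (ih (by omega)) m

theorem augEquiv_tensorBd (ε : R →ₐ[k] k) (n : ℕ)
    (z : (R ⧸ RingHom.ker ε) ⊗[k] Bar k R M (n + 1)) :
    augEquiv M ε n (tensorBd k R M _ n z) = augBd M ε n (augEquiv M ε (n + 1) z) := by
  induction z with
  | zero => simp
  | add x y hx hy => simp only [map_add, hx, hy]
  | tmul l x =>
    obtain ⟨l, rfl⟩ := Ideal.Quotient.mk_surjective l
    suffices (augEquiv M ε n).toLinearMap ∘ₗ (tensorBd k R M _ n).restrictScalars k ∘ₗ
        TensorProduct.mk k _ _ (Ideal.Quotient.mk (RingHom.ker ε) l) =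
        ε l • augBd M ε n from by
      have h := DFunLike.congr_fun this x
      rw [augEquiv_mk_tmul, map_smul]
      exact h
    refine cons_ext fun r y => ?_
    have : r • (Ideal.Quotient.mk (RingHom.ker ε) l) = Ideal.Quotient.mk _ (r * l) := rfl
    simp only [LinearMap.comp_apply, LinearMap.restrictScalars_apply, TensorProduct.mk_apply,
      tensorBd_tmul_cons, this, map_sub, LinearEquiv.coe_coe, augEquiv_mk_tmul, LinearMap.smul_apply,
      augBd_cons, smul_sub, smul_smul]
    rw [map_mul, mul_comm]

variable (M) in
/-- The cycles of the bar complex. -/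
def augCycles (ε : R →ₐ[k] k) : (n : ℕ) → Submodule k (Bar k R M n)
  | 0 => ⊤
  | n + 1 => LinearMap.ker (augBd M ε n)

theorem augEquiv_symm_mem_tensorCycles (ε : R →ₐ[k] k) (n : ℕ) {x : Bar k R M n}
    (hx : x ∈ augCycles M ε n) : (augEquiv M ε n).symm x ∈ tensorCycles k R M _ n := by
  cases n with
  | zero => trivial
  | succ n =>
    apply (augEquiv M ε n).injective
    rw [augEquiv_tensorBd, LinearEquiv.apply_symm_apply, map_zero]
    exact hx

/-- `Tor^R_i(M, k) = 0` for `i > n` if the kernel of `R → k` is generated by a regular sequence of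
length `n`. -/
theorem ker_augBd_le (ε : R →ₐ[k] k) {n : ℕ} {z : Fin n → R} (hz : IsRegularSeq z)
    (hε : prefixIdeal z n = RingHom.ker ε) (m : ℕ) (hm : n ≤ m) :
    LinearMap.ker (augBd M ε m) ≤ LinearMap.range (augBd M ε (m + 1)) := by
  intro x hx
  have h := ker_tensorBd_quotient_le (k := k) (M := M) hz n le_rfl m hm
  rw [hε] at h
  obtain ⟨u, hu⟩ := h (augEquiv_symm_mem_tensorCycles ε (m + 1) hx)
  exact ⟨augEquiv M ε _ u, by rw [← augEquiv_tensorBd, hu, LinearEquiv.apply_symm_apply]⟩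

/-- `Tor^R_i(M, k)` is finite-dimensional. -/
theorem augCycles_le_finite [IsNoetherianRing R] [Module.Finite R M] (ε : R →ₐ[k] k) {n : ℕ}
    {z : Fin n → R} (hz : IsRegularSeq z) (hε : prefixIdeal z n = RingHom.ker ε) (m : ℕ) :
    ∃ W : Submodule k (Bar k R M m), W.FG ∧
      augCycles M ε m ≤ W ⊔ LinearMap.range (augBd M ε m) := by
  classical
  have h := tensorCycles_quotient_le_fg (k := k) (M := M) hz n le_rfl m
  rw [hε] at h
  obtain ⟨_, ⟨S, rfl⟩, h⟩ := h
  -- On R / ker ε the ring R acts through ε, so an R-span turns into a k-span of the same finite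
  -- set.
  refine ⟨Submodule.span k (augEquiv M ε m '' S), ⟨S.image (augEquiv M ε m), by simp⟩, ?_⟩
  intro x hx
  obtain ⟨w, hw, _, ⟨u, rfl⟩, hwu⟩ := Submodule.mem_sup.1
    (h (augEquiv_symm_mem_tensorCycles ε m hx))
  have hx' : x = augEquiv M ε m w + augBd M ε m (augEquiv M ε _ u) := by
    rw [← augEquiv_tensorBd, ← map_add, hwu, LinearEquiv.apply_symm_apply]
  rw [hx']
  refine Submodule.add_mem_sup ?_ ⟨_, rfl⟩
  clear hwu hx'
  induction hw using Submodule.span_induction with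
  | mem y hy => exact Submodule.subset_span ⟨y, hy, rfl⟩
  | zero => rw [map_zero]; exact zero_mem _
  | add y y' _ _ hy hy' => rw [map_add]; exact add_mem hy hy'
  | smul r y _ hy => rw [augEquiv_smul]; exact Submodule.smul_mem _ _ hy

/-! ### The case of a module over a finite extension -/

/-- The kernel of ε annihilates the homology by `smulLast_mem_range`, and S acts on the homology by
functoriality; hence the ideal of S generated by that kernel annihilates it too. -/
theorem smul_mem_range_augBd {S : Type*} [CommRing S] [Algebra R S] [Module S M]
    [IsScalarTower R S M] (ε : R →ₐ[k] k) {y : S}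
    (hy : y ∈ (RingHom.ker ε).map (algebraMap R S)) (n : ℕ) (x : Bar k R M (n + 1))
    (hx : augBd M ε n x = 0) :
    map (n + 1) ((Algebra.lsmul R R M y).restrictScalars k) x ∈
      LinearMap.range (augBd M ε (n + 1)) := by
  induction hy using Submodule.span_induction with
  | mem y hy =>
    obtain ⟨a, ha, rfl⟩ := hy
    have : (Algebra.lsmul R R M (algebraMap R S a)).restrictScalars k = Algebra.lsmul k k M a := by
      ext m
      simp
    rw [this]
    exact smulLast_mem_range ε ha n x hx
  | zero =>
    have : (Algebra.lsmul R R M (0 : S)).restrictScalars k = 0 := by ext; simp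
    rw [this]
    simp
  | add y y' _ _ hy hy' =>
    have : (Algebra.lsmul R R M (y + y')).restrictScalars k =
      (Algebra.lsmul R R M y).restrictScalars k + (Algebra.lsmul R R M y').restrictScalars k := by
      ext; simp
    rw [this, map_add]
    exact add_mem hy hy'
  | smul s y _ hy =>
    have : (Algebra.lsmul R R M (s • y)).restrictScalars k =
      (Algebra.lsmul R R M s).restrictScalars k ∘ₗ (Algebra.lsmul R R M y).restrictScalars k := by
      ext; simp
    rw [this, map_comp]
    obtain ⟨u, hu⟩ := hy
    exact ⟨_, by rw [← hu, map_augBd]⟩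

/-- In the long exact sequence of 0 → N → N → N' → 0, if f induces zero on Tor_{n+1}(N), this group
is a quotient of Tor_{n+2}(N'), which vanishes by `h`. -/
theorem ker_augBd_le_of_regular {N N' : Type*} [AddCommGroup N] [Module k N] [Module R N]
    [IsScalarTower k R N] [AddCommGroup N'] [Module k N'] [Module R N'] [IsScalarTower k R N']
    (ε : R →ₐ[k] k) {f : N →ₗ[R] N} {g : N →ₗ[R] N'} (hf : Function.Injective f)
    (hfg : Function.Exact f g) (hg : Function.Surjective g) (n : ℕ)
    (h₀ : ∀ x, augBd N ε n x = 0 →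
      map (n + 1) (f.restrictScalars k) x ∈ LinearMap.range (augBd N ε (n + 1)))
    (h : LinearMap.ker (augBd N' ε (n + 1)) ≤ LinearMap.range (augBd N' ε (n + 2))) :
    LinearMap.ker (augBd N ε n) ≤ LinearMap.range (augBd N ε (n + 1)) := by
  intro x hx
  obtain ⟨u, hu⟩ := h₀ x hx
  have e : ∀ m, Function.Exact (map (R := R) m (f.restrictScalars k))
    (map (R := R) m (g.restrictScalars k)) := fun m => map_exact m hfg hg
  obtain ⟨w, hw⟩ := h (show map (n + 2) (g.restrictScalars k) u ∈ _ by
    rw [LinearMap.mem_ker, ← map_augBd, hu, (e _).apply_apply_eq_zero])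
  obtain ⟨w, rfl⟩ := map_surjective (R := R) (n + 3) (f := g.restrictScalars k) hg w
  rw [← map_augBd] at hw
  obtain ⟨u', hu'⟩ := (e (n + 2) (u - augBd N ε (n + 2) w)).1 (by rw [map_sub, hw, sub_self])
  refine ⟨u', map_injective (n + 1) (f := f.restrictScalars k) hf ?_⟩
  rw [map_augBd, hu', map_sub, augBd_augBd, sub_zero, hu]

/-- The identity of N factors through the finite direct sum of the P_j, hence so does the identity
of its homology. -/
theorem ker_augBd_le_of_retract {ι : Type*} [Fintype ι] {N : Type*} {P : ι → Type*}
    [AddCommGroup N] [Module k N] [Module R N] [IsScalarTower k R N] [∀ j, AddCommGroup (P j)]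
    [∀ j, Module k (P j)] [∀ j, Module R (P j)] [∀ j, IsScalarTower k R (P j)]
    (ε : R →ₐ[k] k) (f : ∀ j, N →ₗ[R] P j) (g : ∀ j, P j →ₗ[R] N)
    (hfg : ∀ x, ∑ j, g j (f j x) = x) (n : ℕ)
    (h : ∀ j, LinearMap.ker (augBd (P j) ε n) ≤ LinearMap.range (augBd (P j) ε (n + 1))) :
    LinearMap.ker (augBd N ε n) ≤ LinearMap.range (augBd N ε (n + 1)) := by
  intro x hx
  have hx' : x = ∑ j, map (n + 1) ((g j).restrictScalars k)
      (map (n + 1) ((f j).restrictScalars k) x) := by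
    simp only [← map_comp]
    rw [← LinearMap.sum_apply, ← map_sum]
    have : ∑ j, (g j).restrictScalars k ∘ₗ (f j).restrictScalars k = LinearMap.id := by
      ext y
      simpa using hfg y
    rw [this, map_id]
  rw [hx']
  refine sum_mem fun j _ => ?_
  obtain ⟨u, hu⟩ := h j (show map (n + 1) ((f j).restrictScalars k) x ∈ _ by
    rw [LinearMap.mem_ker, ← map_augBd, show augBd N ε n x = 0 from hx, map_zero])
  exact ⟨_, by rw [← hu, map_augBd]⟩

/-- An algebra `S` over `R` has no higher `Tor^R(S, k)` if its fiber ideal contains a regular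
sequence of the same length as the one generating `ker ε`. -/
theorem ker_augBd_le_of_isRegularSeq {S : Type*} [CommRing S] [Algebra R S] [Algebra k S]
    [IsScalarTower k R S] (ε : R →ₐ[k] k) {n : ℕ} {z : Fin n → R} (hz : IsRegularSeq z)
    (hε : prefixIdeal z n = RingHom.ker ε) {y : Fin n → S} (hy : IsRegularSeq y)
    (hyε : ∀ j, y j ∈ (RingHom.ker ε).map (algebraMap R S)) (m : ℕ) :
    LinearMap.ker (augBd S ε m) ≤ LinearMap.range (augBd S ε (m + 1)) := by
  -- Descending induction on s, with t = n - s, for Tor_i(S/(first s of the y_j)) = 0 when i > s. At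
  -- s = n this is the bound given by `z`. Stepping down uses that the next y lies in the fiber
  -- ideal and so acts as zero on Tor. At s = 0 all positive degrees are covered.
  have key : ∀ t s : ℕ, s + t = n → ∀ m, s ≤ m →
      LinearMap.ker (augBd (S ⧸ prefixIdeal y s) ε m) ≤
        LinearMap.range (augBd (S ⧸ prefixIdeal y s) ε (m + 1)) := by
    intro t
    induction t with
    | zero =>
      rintro s rfl m hm
      exact ker_augBd_le ε hz hε m hm
    | succ t ih =>
      intro s hs m hm
      have hsn : s < n := by omega
      refine ker_augBd_le_of_regular ε
        (f := (LinearMap.lsmul S (S ⧸ prefixIdeal y s) (y ⟨s, hsn⟩)).restrictScalars R)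
        (g := (Submodule.factor (prefixIdeal_le_succ y ⟨s, hsn⟩)).restrictScalars R)
        (hy.lsmul_injective ⟨s, hsn⟩) (exact_lsmul_factor y ⟨s, hsn⟩)
        (Submodule.factor_surjective (prefixIdeal_le_succ y ⟨s, hsn⟩)) m ?_
        (ih (s + 1) (by omega) (m + 1) (by omega))
      exact fun x hx => smul_mem_range_augBd ε (hyε _) m x hx
  have h0 := key n 0 (by omega) m (by omega)
  rw [prefixIdeal_zero] at h0
  let e : (S ⧸ (⊥ : Ideal S)) ≃ₗ[R] S :=
    (Submodule.quotEquivOfEqBot (⊥ : Ideal S) rfl).restrictScalars R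
  exact ker_augBd_le_of_retract (ι := Unit) ε (fun _ => e.symm.toLinearMap)
    (fun _ => e.toLinearMap) (by simp) m fun _ => h0

end

end Bar

end Vanishing

/-! ### Noether normalizations -/

section Normalization

/-- The kernel of any augmentation, not only the one at the origin, is generated by the differences
x_j - ε(x_j), which are monic linear polynomials in distinct variables. -/
theorem exists_isRegularSeq_ker {k S : Type*} [Field k] [CommRing S] [Algebra k S] {n : ℕ}
    {f : Fin n → S} (hf : AlgebraicIndependent k f) {R : Subalgebra k S}
    (hR : R = Algebra.adjoin k (Set.range f)) (ε : R →ₐ[k] k) :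
    ∃ z : Fin n → R, IsRegularSeq z ∧ prefixIdeal z n = RingHom.ker ε := by
  subst hR
  let e := hf.aevalEquiv
  let x : Fin n → Algebra.adjoin k (Set.range f) := fun j => e (MvPolynomial.X j)
  have hz := isRegularSeq_aeval e (Function.Embedding.refl (Fin n))
    (p := fun j => Polynomial.X - Polynomial.C (ε (x j))) fun j => Polynomial.monic_X_sub_C _
  set z : Fin n → Algebra.adjoin k (Set.range f) := fun j => Polynomial.aeval
    (e (MvPolynomial.X (Function.Embedding.refl (Fin n) j)))
      (Polynomial.X - Polynomial.C (ε (x j))) with hzdef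
  have hzx : ∀ j, z j = x j - algebraMap k _ (ε (x j)) := fun j => by simp [hzdef, x]
  refine ⟨z, hz, le_antisymm (Ideal.span_le.2 ?_) fun r hr => ?_⟩
  · rintro _ ⟨j, -, rfl⟩
    simp [RingHom.mem_ker, hzx]
  · have key : ((Ideal.Quotient.mkₐ k (prefixIdeal z n)).comp e.toAlgHom) =
        ((Algebra.ofId k _).comp ε).comp e.toAlgHom := by
      refine MvPolynomial.algHom_ext fun j => ?_
      change Ideal.Quotient.mk (prefixIdeal z n) (x j) =
        Ideal.Quotient.mk (prefixIdeal z n) (algebraMap k _ (ε (x j)))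
      rw [Ideal.Quotient.eq, ← hzx]
      exact Ideal.subset_span ⟨j, j.isLt, rfl⟩
    have h := DFunLike.congr_fun key (e.symm r)
    change Ideal.Quotient.mk (prefixIdeal z n) (e (e.symm r)) =
        Ideal.Quotient.mk (prefixIdeal z n) (algebraMap k _ (ε (e (e.symm r)))) at h
    rw [e.apply_symm_apply, show ε r = 0 from hr, map_zero, map_zero] at h
    exact Ideal.Quotient.eq_zero_iff_mem.1 h

variable {k V : Type*} [Field k] [AddCommGroup V] [Module k V]

theorem IsNoetherNormalization.exists_isRegularSeq {R B : Subalgebra k (Poly k V)}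
    (hR : IsNoetherNormalization R B) : ∃ n : ℕ, (∃ f : Fin n → Poly k V, AlgebraicIndependent k f) ∧
      ∀ ε : R →ₐ[k] k, ∃ z : Fin n → R, IsRegularSeq z ∧ prefixIdeal z n = RingHom.ker ε := by
  obtain ⟨n, f, hf, -, h⟩ := hR.polynomial
  exact ⟨n, ⟨f, hf⟩, exists_isRegularSeq_ker hf h⟩

theorem IsNoetherNormalization.isNoetherianRing {R B : Subalgebra k (Poly k V)}
    (hR : IsNoetherNormalization R B) : IsNoetherianRing R := by
  obtain ⟨n, f, hf, -, rfl⟩ := hR.polynomial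
  exact isNoetherianRing_of_ringEquiv _ hf.aevalEquiv.toRingEquiv

instance finiteType_poly [FiniteDimensional k V] : Algebra.FiniteType k (Poly k V) :=
  Algebra.FiniteType.equiv inferInstance
    (SymmetricAlgebra.equivMvPolynomial (Module.finBasis k (Module.Dual k V))).symm

theorem isIntegral_invariantAlgebra {G : Type*} [Group G] [Finite G] (ρ : Representation k G V) :
    Algebra.IsIntegral (invariantAlgebra ρ) (Poly k V) := by
  let : MulSemiringAction G (Poly k V) :=
    { smul g f := polyAct ρ g f
      one_smul f := by change polyAct ρ 1 f = f; simp
      mul_smul g h f := by change polyAct ρ (g * h) f = polyAct ρ g (polyAct ρ h f); simp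
      smul_zero g := map_zero _
      smul_add g := map_add _
      smul_one g := map_one _
      smul_mul g := map_mul _ }
  have : Algebra.IsInvariant (invariantAlgebra ρ) (Poly k V) G := ⟨fun b hb => ⟨⟨b, hb⟩, rfl⟩⟩
  exact Algebra.IsInvariant.isIntegral _ _ G

theorem IsNoetherNormalization.isIntegral {G : Type*} [Group G] [Finite G]
    {ρ : Representation k G V} {R : Subalgebra k (Poly k V)}
    (hR : IsNoetherNormalization R (invariantAlgebra ρ)) : Algebra.IsIntegral R (Poly k V) := by
  let : Algebra R (invariantAlgebra ρ) := (Subalgebra.inclusion hR.le).toAlgebra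
  have : IsScalarTower R (invariantAlgebra ρ) (Poly k V) := IsScalarTower.of_algebraMap_eq fun _ => rfl
  have : Module.Finite R (invariantAlgebra ρ) := hR.finite
  have := isIntegral_invariantAlgebra ρ
  exact Algebra.IsIntegral.trans (invariantAlgebra ρ)

theorem IsNoetherNormalization.finite_poly [FiniteDimensional k V] {G : Type*} [Group G] [Finite G]
    {ρ : Representation k G V} {R : Subalgebra k (Poly k V)}
    (hR : IsNoetherNormalization R (invariantAlgebra ρ)) : Module.Finite R (Poly k V) := by
  have := hR.isIntegral
  have : Algebra.FiniteType R (Poly k V) := Algebra.FiniteType.of_restrictScalars_finiteType k _ _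
  exact Algebra.IsIntegral.finite

/-- Reducing the coefficients of an integral equation. -/
theorem exists_monic_aeval_mem {R S : Type*} [CommRing R] [Algebra k R] [CommRing S]
    [Algebra R S] [Algebra k S] [IsScalarTower k R S] [Algebra.IsIntegral R S] (ε : R →ₐ[k] k)
    (x : S) : ∃ p : Polynomial k, p.Monic ∧
      Polynomial.aeval x p ∈ (RingHom.ker ε).map (algebraMap R S) := by
  obtain ⟨q, hq, hqx⟩ := Algebra.IsIntegral.isIntegral (R := R) x
  refine ⟨q.map (ε : R →+* k), hq.map _, ?_⟩
  rw [← Ideal.Quotient.eq_zero_iff_mem]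
  set J := (RingHom.ker ε).map (algebraMap R S)
  have h1 : Ideal.Quotient.mk J (Polynomial.aeval x (q.map (ε : R →+* k))) =
      Polynomial.eval₂ ((Ideal.Quotient.mk J).comp ((algebraMap k S).comp (ε : R →+* k)))
        (Ideal.Quotient.mk J x) q := by
    rw [Polynomial.aeval_def, Polynomial.eval₂_map, Polynomial.hom_eval₂]
  have h2 : (Ideal.Quotient.mk J).comp ((algebraMap k S).comp (ε : R →+* k)) =
      (Ideal.Quotient.mk J).comp (algebraMap R S) := by
    ext r
    simp only [RingHom.comp_apply, RingHom.coe_coe]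
    rw [Ideal.Quotient.eq, IsScalarTower.algebraMap_apply k R S, ← map_sub]
    exact Ideal.mem_map_of_mem _ (by simp [RingHom.mem_ker])
  rw [h1, h2, ← Polynomial.hom_eval₂, hqx, map_zero]

/-- The transcendence degree of k[V] is dim V. The bound guarantees enough coordinates for
`IsNoetherNormalization.ker_augBd_poly_le`. -/
theorem card_le_of_algebraicIndependent [FiniteDimensional k V] {n : ℕ} {f : Fin n → Poly k V}
    (hf : AlgebraicIndependent k f) : n ≤ Module.finrank k (Module.Dual k V) := by
  let e := SymmetricAlgebra.equivMvPolynomial (Module.finBasis k (Module.Dual k V))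
  have h := (hf.map' (f := e.toAlgHom) e.injective).lift_cardinalMk_le_trdeg
  rw [MvPolynomial.trdeg_of_isDomain] at h
  simpa using h

/-- `Tor^R_i(k[V], k) = 0` for `i > 0`, at every point of `Spec R`. -/
theorem IsNoetherNormalization.ker_augBd_poly_le [FiniteDimensional k V] {G : Type*} [Group G]
    [Finite G] {ρ : Representation k G V} {R : Subalgebra k (Poly k V)}
    (hR : IsNoetherNormalization R (invariantAlgebra ρ)) (ε : R →ₐ[k] k) (m : ℕ) :
    LinearMap.ker (Bar.augBd (Poly k V) ε m) ≤ LinearMap.range (Bar.augBd (Poly k V) ε (m + 1)) := by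
  obtain ⟨n, ⟨f, hf⟩, h⟩ := hR.exists_isRegularSeq
  obtain ⟨z, hz, hzε⟩ := h ε
  have := hR.isIntegral
  let e := SymmetricAlgebra.equivMvPolynomial (Module.finBasis k (Module.Dual k V))
  -- Any n of the coordinates will do: each is integral over R, and reducing its integral equation
  -- along ε gives a monic polynomial in it that lies in the fiber ideal.
  let i : Fin n ↪ Fin (Module.finrank k (Module.Dual k V)) :=
    (Fin.castLEEmb (card_le_of_algebraicIndependent hf))
  choose p hp hpε using fun j : Fin n =>
    exists_monic_aeval_mem (S := Poly k V) ε (e.symm (MvPolynomial.X (i j)))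
  exact Bar.ker_augBd_le_of_isRegularSeq ε hz hzε (isRegularSeq_aeval e.symm i hp) hpε m

end Normalization

/-! ### The trace -/

section Trace

/-- By the Nullstellensatz the residue field at P is finite over k, so it embeds into the algebraic
closure. -/
theorem exists_algHom_algebraicClosure {k S : Type*} [Field k] [CommRing S] [Algebra k S]
    [Algebra.FiniteType k S] (P : Ideal S) [P.IsMaximal] :
    ∃ w : S →ₐ[k] AlgebraicClosure k, ∀ f ∈ P, w f = 0 := by
  let _ : Field (S ⧸ P) := Ideal.Quotient.field P
  have : Algebra.FiniteType k (S ⧸ P) :=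
    Algebra.FiniteType.of_surjective (Ideal.Quotient.mkₐ k P) Ideal.Quotient.mk_surjective
  have : Module.Finite k (S ⧸ P) := finite_of_finite_type_of_isJacobsonRing k (S ⧸ P)
  refine ⟨(IsAlgClosed.lift (M := AlgebraicClosure k)).comp (Ideal.Quotient.mkₐ k P), fun f hf => ?_⟩
  have : Ideal.Quotient.mkₐ k P f = 0 := Ideal.Quotient.eq_zero_iff_mem.2 hf
  rw [AlgHom.comp_apply, this, map_zero]

variable {k V : Type*} [Field k] [AddCommGroup V] [Module k V] {G : Type*} [Group G]
  (ρ : Representation k G V)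

theorem pointAct_mul (a b : G) (w : GeomPoint k V) :
    pointAct ρ (a * b) w = pointAct ρ a (pointAct ρ b w) := by
  refine AlgHom.ext fun f => ?_
  simp [pointAct]

theorem pointAct_one (w : GeomPoint k V) : pointAct ρ 1 w = w := by
  refine AlgHom.ext fun f => ?_
  simp [pointAct]

variable [Fintype G]

/-- The trace from `k[V]` to `k[V]^G`. -/
def polyTrace : Poly k V →ₗ[invariantAlgebra ρ] invariantAlgebra ρ where
  toFun s := ⟨∑ g, polyAct ρ g s, fun h => by
    rw [map_sum]
    exact Fintype.sum_equiv (Equiv.mulLeft h) _ _ fun g => by simp⟩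
  map_add' s t := Subtype.ext (by simp [Finset.sum_add_distrib])
  map_smul' a s := by
    refine Subtype.ext ?_
    change ∑ g, polyAct ρ g ((a : Poly k V) * s) = (a : Poly k V) * ∑ g, polyAct ρ g s
    rw [Finset.mul_sum]
    exact Finset.sum_congr rfl fun g _ => by rw [map_mul, a.2 g]

theorem coe_polyTrace (s : Poly k V) : (polyTrace ρ s : Poly k V) = ∑ g, polyAct ρ g s := rfl

/-- If all traces vanished at w, the characters f ↦ w(g f) would have sum zero. They are pairwise
distinct because w has trivial stabilizer, so this contradicts Dedekind's independence of
characters. -/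
theorem exists_trace_ne_zero (w : GeomPoint k V) (hw : ∀ g, pointAct ρ g w = w → g = 1) :
    ∃ s, w (polyTrace ρ s : Poly k V) ≠ 0 := by
  by_contra! h
  have hinj : Function.Injective fun g : G => ((w.comp (polyAct ρ g) : GeomPoint k V) :
      Poly k V →* AlgebraicClosure k) := by
    intro a b hab
    have h1 : pointAct ρ a⁻¹ w = pointAct ρ b⁻¹ w := by
      refine AlgHom.ext fun f => ?_
      have := DFunLike.congr_fun hab f
      simpa [pointAct] using this
    have h2 := hw (b * a⁻¹) (by
      rw [pointAct_mul, h1, ← pointAct_mul, mul_inv_cancel, pointAct_one])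
    exact (mul_inv_eq_one.1 h2).symm
  have hli := (linearIndependent_monoidHom (Poly k V) (AlgebraicClosure k)).comp _ hinj
  have := Fintype.linearIndependent_iff.1 hli (fun _ => 1) (by
    ext f
    have := h f
    rw [coe_polyTrace, map_sum] at this
    simpa using this) 1
  exact one_ne_zero this

/-- If `G` acts freely on the fiber, then some trace is congruent to `1`. -/
theorem exists_one_sub_trace_mem [FiniteDimensional k V] {R : Subalgebra k (Poly k V)}
    (hR : R ≤ invariantAlgebra ρ) (v : V)
    (hfree : ∀ g, ∀ w ∈ fiber R v, pointAct ρ g w = w → g = 1) :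
    ∃ s, 1 - polyTrace ρ s ∈
      (pointIdeal R v).map (Subalgebra.inclusion hR : R →+* invariantAlgebra ρ) := by
  set J := (pointIdeal R v).map (Subalgebra.inclusion hR : R →+* invariantAlgebra ρ) with hJ
  -- The traces form an ideal of k[V]^G. If it and `J` lay in a maximal ideal Q, then a geometric
  -- point above Q would belong to the fiber, as `J` vanishes there, and all traces would vanish at
  -- it.
  have htop : LinearMap.range (polyTrace ρ) ⊔ J = ⊤ := by
    by_contra hne
    obtain ⟨Q, hQ, hle⟩ := Ideal.exists_le_maximal (α := invariantAlgebra ρ) _ hne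
    have := isIntegral_invariantAlgebra ρ
    obtain ⟨P, hP, hPQ⟩ := Ideal.exists_maximal_ideal_liesOver_of_isIntegral (S := Poly k V) Q
    obtain ⟨w, hw⟩ := exists_algHom_algebraicClosure (k := k) P
    have hwQ : ∀ a : invariantAlgebra ρ, a ∈ Q → w a = 0 := by
      intro a ha
      refine hw _ ?_
      rw [hPQ.over] at ha
      exact ha
    have hwv : w ∈ fiber R v := by
      intro f hf
      have hmem : (⟨f, hf⟩ - algebraMap k R (evalAt v f) : R) ∈ pointIdeal R v := by
        change evalAt v (f - algebraMap k (Poly k V) (evalAt v f)) = 0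
        simp
      have := hwQ _ (hle (Submodule.mem_sup_right (Ideal.mem_map_of_mem _ hmem)))
      change w (f - algebraMap k (Poly k V) (evalAt v f)) = 0 at this
      rwa [map_sub, AlgHom.commutes, sub_eq_zero] at this
    obtain ⟨s, hs⟩ := exists_trace_ne_zero ρ w fun g => hfree g w hwv
    exact hs (hwQ _ (hle (Submodule.mem_sup_left ⟨s, rfl⟩)))
  obtain ⟨_, ⟨s, rfl⟩, b, hb, hsb⟩ := Submodule.mem_sup.1
    (show (1 : invariantAlgebra ρ) ∈ LinearMap.range (polyTrace ρ) ⊔ J by rw [htop]; trivial)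
  exact ⟨s, by rw [← hsb, add_sub_cancel_left]; exact hb⟩

end Trace

/-! ### Homology in degree zero -/

section DegreeZero

variable {k R M : Type*} [Field k] [CommRing R] [Algebra k R] [AddCommGroup M] [Module k M]

namespace Bar

variable (k R M) in
/-- In homological degree zero the bar complex is the module itself. -/
def zeroEquiv : Bar k R M 0 ≃ₗ[k] M :=
  LinearEquiv.ofLinearMap
    (Bar.lift (MultilinearMap.constOfIsEmpty k (fun _ : Fin 0 => R) LinearMap.id))
    (Bar.mk 0 ![])
    (LinearMap.ext fun m => by simp [Bar.lift_mk])
    (Bar.hom_ext fun r m => by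
      rw [Subsingleton.elim r ![]]
      simp [Bar.lift_mk])

theorem zeroEquiv_mk (r : Fin 0 → R) (m : M) : zeroEquiv k R M (Bar.mk 0 r m) = m := by
  rw [Subsingleton.elim r ![]]
  exact (zeroEquiv k R M).apply_symm_apply m

variable [Module R M] [IsScalarTower k R M]

/-- The boundary of r ⊗ m is (ε(r) - r) m, and the elements ε(r) - r exhaust the kernel of ε; so the
homology in degree zero is M / (ker ε) M. -/
theorem mem_range_augBd_zero (ε : R →ₐ[k] k) (x : Bar k R M 0) :
    x ∈ LinearMap.range (augBd M ε 0) ↔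
      zeroEquiv k R M x ∈ RingHom.ker ε • (⊤ : Submodule R M) := by
  set J : Submodule R M := RingHom.ker ε • (⊤ : Submodule R M) with hJ
  have h : ∀ (r : R) (m : M), zeroEquiv k R M (augBd M ε 0 (cons 0 r (Bar.mk 0 ![] m))) =
      (algebraMap k R (ε r) - r) • m := by
    intro r m
    rw [augBd_cons, bd_zero, smulLast_mk, map_sub, map_smul, zeroEquiv_mk, zeroEquiv_mk, sub_smul,
      algebraMap_smul]
  constructor
  · rintro ⟨x, rfl⟩
    suffices (J.restrictScalars k).mkQ ∘ₗ (zeroEquiv k R M).toLinearMap ∘ₗ augBd M ε 0 = 0 from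
      (Submodule.Quotient.mk_eq_zero (J.restrictScalars k)).1 (DFunLike.congr_fun this x)
    refine cons_ext fun r y => ?_
    obtain ⟨m, rfl⟩ := mk_zero_surjective y
    refine (Submodule.Quotient.mk_eq_zero (J.restrictScalars k)).2 ?_
    rw [LinearMap.comp_apply, LinearEquiv.coe_coe, h]
    have hr : algebraMap k R (ε r) - r ∈ RingHom.ker ε := by simp [RingHom.mem_ker]
    have hm : (algebraMap k R (ε r) - r) • m ∈ J := Submodule.smul_mem_smul hr Submodule.mem_top
    exact hm
  · intro hx
    obtain ⟨m, rfl⟩ := (zeroEquiv k R M).symm.surjective x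
    rw [LinearEquiv.apply_symm_apply] at hx
    induction hx using Submodule.smul_induction_on' with
    | smul r hr m _ =>
      refine ⟨-cons 0 r (Bar.mk 0 ![] m), (zeroEquiv k R M).injective ?_⟩
      rw [map_neg, map_neg, h, show ε r = 0 from hr, map_zero, zero_sub, neg_smul, neg_neg,
        LinearEquiv.apply_symm_apply]
    | add x _ y _ hx hy =>
      rw [map_add]
      exact add_mem hx hy

end Bar

theorem smul_mem_of_mem_map {S : Type*} [CommRing S] [Algebra R S] [Module R M] [Module S M]
    [IsScalarTower R S M] {I : Ideal R} {y : S} (hy : y ∈ I.map (algebraMap R S)) (m : M) :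
    y • m ∈ I • (⊤ : Submodule R M) := by
  induction hy using Submodule.span_induction generalizing m with
  | mem y hy =>
    obtain ⟨a, ha, rfl⟩ := hy
    rw [algebraMap_smul]
    exact Submodule.smul_mem_smul ha trivial
  | zero => rw [zero_smul]; exact zero_mem _
  | add y y' _ _ hy hy' => rw [add_smul]; exact add_mem (hy m) (hy' m)
  | smul s y _ hy =>
    rw [smul_eq_mul, mul_comm, mul_smul]
    exact hy (s • m)

/-! ### Retracts up to an element congruent to 1 -/

section Retract

variable [Module R M] [IsScalarTower k R M] {A N : Type*} [CommRing A] [Algebra R A] [Module A M]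
  [IsScalarTower R A M] [AddCommGroup N] [Module k N] [Module R N] [IsScalarTower k R N]
  (ε : R →ₐ[k] k) {i : M →ₗ[R] N} {τ : N →ₗ[R] M} {t : A}

/-- A module is a retract up to an element that acts as the identity on the homology. -/
theorem Bar.ker_augBd_le_of_one_sub_mem (ht : 1 - t ∈ (RingHom.ker ε).map (algebraMap R A))
    (hτ : ∀ m, τ (i m) = t • m) (n : ℕ)
    (h : LinearMap.ker (augBd N ε n) ≤ LinearMap.range (augBd N ε (n + 1))) :
    LinearMap.ker (augBd M ε n) ≤ LinearMap.range (augBd M ε (n + 1)) := by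
  intro x hx
  -- Write x = (1 - t) x + τ(i x). The first summand is a boundary because 1 - t acts as zero on the
  -- homology, the second because it comes from N.
  have hx' : x = map (n + 1) ((Algebra.lsmul R R M (1 - t)).restrictScalars k) x +
      map (n + 1) (τ.restrictScalars k) (map (n + 1) (i.restrictScalars k) x) := by
    rw [← map_comp, ← LinearMap.add_apply, ← map_add]
    have : (Algebra.lsmul R R M (1 - t)).restrictScalars k +
        τ.restrictScalars k ∘ₗ i.restrictScalars k = LinearMap.id := by
      ext m
      simp [hτ]
    rw [this, map_id]
  rw [hx']
  refine add_mem (smul_mem_range_augBd ε ht n x hx) ?_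
  obtain ⟨u, hu⟩ := h (show map (n + 1) (i.restrictScalars k) x ∈ _ by
    rw [LinearMap.mem_ker, ← map_augBd, show augBd M ε n x = 0 from hx, map_zero])
  exact ⟨_, by rw [← hu, map_augBd]⟩

/-- The same decomposition m = (1 - t) m + τ(i m), in degree zero. -/
theorem mem_smul_top_of_one_sub_mem {I : Ideal R} (ht : 1 - t ∈ I.map (algebraMap R A))
    (hτ : ∀ m, τ (i m) = t • m) {m : M} (hm : i m ∈ I • (⊤ : Submodule R N)) :
    m ∈ I • (⊤ : Submodule R M) := by
  have h1 : τ (i m) ∈ I • (⊤ : Submodule R M) := by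
    have := Submodule.mem_map_of_mem (f := τ) hm
    rw [Submodule.map_smul''] at this
    exact Submodule.smul_mono le_rfl le_top this
  have h2 := add_mem (smul_mem_of_mem_map ht m) h1
  rwa [hτ, sub_smul, one_smul, sub_add_cancel] at h2

end Retract

end DegreeZero

/-! ### Relative invariants as modules -/

section Relative

set_option synthInstance.maxHeartbeats 200000

variable {k : Type*} [Field k] {V U : Type*} [AddCommGroup V] [Module k V] [AddCommGroup U]
  [Module k U]

/-- `U ⊗ k[V]` as a module over `k[V]`. -/
@[reducible]
def tensorModule : Module (Poly k V) (U ⊗[k] Poly k V) :=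
  Module.compHom _ (mulPoly (k := k) (V := V) (U := U)).toRingHom

attribute [local instance] tensorModule

theorem smul_tensor_def (f : Poly k V) (x : U ⊗[k] Poly k V) : f • x = mulPoly f x := rfl

theorem smul_tmul_poly (f : Poly k V) (u : U) (p : Poly k V) :
    f • (u ⊗ₜ[k] p) = u ⊗ₜ (f * p) := rfl

theorem isScalarTower_tensor : IsScalarTower k (Poly k V) (U ⊗[k] Poly k V) :=
  ⟨fun c f x => by rw [smul_tensor_def, map_smul]; rfl⟩

attribute [local instance] isScalarTower_tensor

/-- The inclusion of `k[V]` as `u ⊗ k[V]`. -/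
def tensorIncl (u : U) : Poly k V →ₗ[Poly k V] U ⊗[k] Poly k V where
  toFun p := u ⊗ₜ p
  map_add' _ _ := TensorProduct.tmul_add _ _ _
  map_smul' _ _ := rfl

/-- The contraction with a linear form on `U`. -/
def tensorCoord (l : Module.Dual k U) : U ⊗[k] Poly k V →ₗ[Poly k V] Poly k V where
  toFun x := TensorProduct.lid k _ (l.rTensor (Poly k V) x)
  map_add' x y := by simp
  map_smul' f x := by
    induction x with
    | zero => simp
    | add x y hx hy => rw [smul_add, map_add, map_add, hx, hy, map_add, map_add, smul_add]
    | tmul u p => simp [smul_tmul_poly]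

theorem sum_tensorIncl_tensorCoord {ι : Type*} [Fintype ι] (b : Module.Basis ι k U)
    (x : U ⊗[k] Poly k V) : ∑ j, tensorIncl (b j) (tensorCoord (b.coord j) x) = x := by
  induction x with
  | zero => simp
  | add x y hx hy => simp only [map_add, Finset.sum_add_distrib, hx, hy]
  | tmul u p =>
    have : ∀ j, tensorIncl (b j) (tensorCoord (b.coord j) (u ⊗ₜ[k] p)) =
        (b.repr u j • b j) ⊗ₜ p := by
      intro j
      change b j ⊗ₜ TensorProduct.lid k _ (b.repr u j ⊗ₜ p) = _
      rw [TensorProduct.lid_tmul, TensorProduct.smul_tmul]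
    simp only [this]
    rw [← TensorProduct.sum_tmul, b.sum_repr]

theorem finite_tensor [FiniteDimensional k U] {R : Subalgebra k (Poly k V)}
    [Module.Finite R (Poly k V)] : Module.Finite R (U ⊗[k] Poly k V) := by
  let b := Module.finBasis k U
  refine Module.Finite.of_surjective
    (∑ j, (tensorIncl (b j)).restrictScalars R ∘ₗ LinearMap.proj j :
      (Fin (Module.finrank k U) → Poly k V) →ₗ[R] U ⊗[k] Poly k V) fun x => ?_
  refine ⟨fun j => tensorCoord (b.coord j) x, ?_⟩
  rw [LinearMap.sum_apply]
  exact sum_tensorIncl_tensorCoord b x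

theorem ker_augBd_tensor_le [FiniteDimensional k U] {R : Subalgebra k (Poly k V)}
    (ε : R →ₐ[k] k) (n : ℕ) (h : LinearMap.ker (Bar.augBd (Poly k V) ε n) ≤
      LinearMap.range (Bar.augBd (Poly k V) ε (n + 1))) :
    LinearMap.ker (Bar.augBd (U ⊗[k] Poly k V) ε n) ≤
      LinearMap.range (Bar.augBd (U ⊗[k] Poly k V) ε (n + 1)) :=
  Bar.ker_augBd_le_of_retract ε
    (fun j => (tensorCoord ((Module.finBasis k U).coord j)).restrictScalars R)
    (fun j => (tensorIncl (Module.finBasis k U j)).restrictScalars R)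
    (sum_tensorIncl_tensorCoord (Module.finBasis k U)) n fun _ => h

/-! ### Module structures on the relative invariants, and restriction to the fiber -/

variable {G : Type*} [Group G] (ρG : Representation k G V) (τG : Representation k G U)

/-- The relative invariants as a module over the invariants. -/
@[reducible]
def invariantsModule : Module (invariantAlgebra ρG) (relativeInvariants ρG τG) where
  smul a x := ⟨mulPoly (a : Poly k V) x, fun g => by rw [tprod_mulPoly, a.2 g, x.2 g]⟩
  one_smul x := Subtype.ext (one_smul (Poly k V) (x : U ⊗[k] Poly k V))
  mul_smul a b x := Subtype.ext (mul_smul (a : Poly k V) (b : Poly k V) (x : U ⊗[k] Poly k V))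
  smul_zero a := Subtype.ext (smul_zero (a : Poly k V))
  smul_add a x y := Subtype.ext (smul_add (a : Poly k V) (x : U ⊗[k] Poly k V) y)
  add_smul a b x := Subtype.ext (add_smul (a : Poly k V) (b : Poly k V) (x : U ⊗[k] Poly k V))
  zero_smul x := Subtype.ext (zero_smul (Poly k V) (x : U ⊗[k] Poly k V))

attribute [local instance] invariantsModule

variable {R : Subalgebra k (Poly k V)} [hR : Fact (R ≤ invariantAlgebra ρG)]

/-- The invariants as an algebra over a subalgebra. -/
@[reducible]
def invariantsAlgebra : Algebra R (invariantAlgebra ρG) :=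
  (Subalgebra.inclusion hR.out).toAlgebra

attribute [local instance] invariantsAlgebra

/-- The relative invariants as a module over a subalgebra of the invariants. -/
@[reducible]
def relativeModule : Module R (relativeInvariants ρG τG) :=
  Module.compHom _ (Subalgebra.inclusion hR.out).toRingHom

attribute [local instance] relativeModule

theorem isScalarTower_relative : IsScalarTower k R (relativeInvariants ρG τG) :=
  ⟨fun c r x => Subtype.ext (smul_assoc c r (x : U ⊗[k] Poly k V))⟩

theorem isScalarTower_invariants :
    IsScalarTower R (invariantAlgebra ρG) (relativeInvariants ρG τG) :=
  ⟨fun r a x => Subtype.ext (mul_smul (r : Poly k V) (a : Poly k V) (x : U ⊗[k] Poly k V))⟩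

attribute [local instance] isScalarTower_relative isScalarTower_invariants

variable (R) in
/-- The inclusion of the relative invariants. -/
def relativeIncl : relativeInvariants ρG τG →ₗ[R] U ⊗[k] Poly k V where
  toFun x := x
  map_add' _ _ := rfl
  map_smul' _ _ := rfl

theorem finite_relative [FiniteDimensional k U] [IsNoetherianRing R] [Module.Finite R (Poly k V)] :
    Module.Finite R (relativeInvariants ρG τG) :=
  have : Module.Finite R (U ⊗[k] Poly k V) := finite_tensor
  Module.Finite.of_injective (relativeIncl ρG τG R) Subtype.val_injective

/-- The augmentation of `R` at the point `v`. -/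
abbrev augAt (R : Subalgebra k (Poly k V)) (v : V) : R →ₐ[k] k := (evalAt v).comp R.val

variable {v : V}

/-- Restriction to the fiber. -/
def restrictFiber (U : Type*) [AddCommGroup U] [Module k U] (R : Subalgebra k (Poly k V)) (v : V) :
    U ⊗[k] Poly k V →ₗ[k] U ⊗[k] FiberRing R v :=
  (Ideal.Quotient.mkₐ k (fiberIdeal R v)).toLinearMap.lTensor U

theorem restrictFiber_surjective : Function.Surjective (restrictFiber U R v) :=
  LinearMap.lTensor_surjective _ Ideal.Quotient.mk_surjective

/-- By exactness of U ⊗ -, the kernel of the restriction is the image of U ⊗ 𝔪 k[V], which is 𝔪 (U ⊗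
k[V]). -/
theorem restrictFiber_eq_zero_iff (x : U ⊗[k] Poly k V) :
    restrictFiber U R v x = 0 ↔ x ∈ pointIdeal R v • (⊤ : Submodule R (U ⊗[k] Poly k V)) := by
  constructor
  · intro hx
    have hex : Function.Exact ((fiberIdeal R v).restrictScalars k).subtype
        (Ideal.Quotient.mkₐ k (fiberIdeal R v)).toLinearMap := by
      intro f
      simp [Ideal.Quotient.eq_zero_iff_mem]
    obtain ⟨y, rfl⟩ := (lTensor_exact U hex Ideal.Quotient.mk_surjective x).1 hx
    induction y with
    | zero => simp
    | add y y' hy hy' =>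
      have e : ∀ y, restrictFiber U R v
        (((fiberIdeal R v).restrictScalars k).subtype.lTensor U y) = 0 := fun y =>
        (lTensor_exact U hex Ideal.Quotient.mk_surjective).apply_apply_eq_zero y
      rw [map_add]
      exact add_mem (hy (e y)) (hy' (e y'))
    | tmul u p =>
      obtain ⟨p, hp⟩ := p
      have h1 := smul_mem_of_mem_map (R := R) (M := Poly k V) (I := pointIdeal R v) hp (1 : Poly k V)
      rw [smul_eq_mul, mul_one] at h1
      have h2 := Submodule.mem_map_of_mem (f := (tensorIncl (k := k) (V := V) u).restrictScalars R) h1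
      rw [Submodule.map_smul''] at h2
      exact Submodule.smul_mono le_rfl le_top h2
  · intro hx
    induction hx using Submodule.smul_induction_on' with
    | smul r hr x _ =>
      induction x with
      | zero => simp
      | add x y hx hy => rw [smul_add, map_add, hx trivial, hy trivial, add_zero]
      | tmul u p =>
        change u ⊗ₜ Ideal.Quotient.mk (fiberIdeal R v) ((r : Poly k V) * p) = 0
        rw [Ideal.Quotient.eq_zero_iff_mem.2, TensorProduct.tmul_zero]
        exact Ideal.mul_mem_right _ _ (Ideal.mem_map_of_mem R.val hr)
    | add x _ y _ hx hy => rw [map_add, hx, hy, add_zero]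

theorem tprod_restrictFiber (g : G) (x : U ⊗[k] Poly k V) :
    (τG.tprod (fiberRep ρG (fiberIdeal_stable_of_invariant hR.out v))) g (restrictFiber U R v x) =
      restrictFiber U R v ((τG.tprod (polyRep ρG)) g x) := by
  induction x with
  | zero => simp
  | add x y hx hy => simp only [map_add, hx, hy]
  | tmul u p => rfl

variable (R v) in
/-- Restriction of relative invariants to the fiber. -/
def restrictRelative : relativeInvariants ρG τG →ₗ[k] fiberInvariants ρG τG R hR.out v :=
  (restrictFiber U R v).restrict fun x hx g => by rw [tprod_restrictFiber, hx g]

/-! ### The twisted trace and its consequences at the point v -/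

variable [Fintype G]

variable (R) in
/-- The map `x ↦ ∑ g (s x)`. -/
def twistedTrace (s : Poly k V) : U ⊗[k] Poly k V →ₗ[R] relativeInvariants ρG τG where
  toFun x := ⟨∑ g, (τG.tprod (polyRep ρG)) g (mulPoly s x), fun h => by
    rw [map_sum]
    exact Fintype.sum_equiv (Equiv.mulLeft h) _ _ fun g => by
      rw [Equiv.coe_mulLeft, map_mul, Module.End.mul_apply]⟩
  map_add' x y := Subtype.ext (by simp [Finset.sum_add_distrib])
  map_smul' r x := by
    refine Subtype.ext ?_
    change ∑ g, (τG.tprod (polyRep ρG)) g (mulPoly s (mulPoly (r : Poly k V) x)) =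
      mulPoly (r : Poly k V) (∑ g, (τG.tprod (polyRep ρG)) g (mulPoly s x))
    rw [map_sum]
    refine Finset.sum_congr rfl fun g _ => ?_
    rw [← Module.End.mul_apply (mulPoly s), ← map_mul, mul_comm, map_mul, Module.End.mul_apply,
      tprod_mulPoly, hR.out r.2 g]

/-- For invariant x one has g(s x) = g(s) x. So the twisted trace retracts U ⊗ k[V] onto M up to the
factor ∑ g(s), which plays the role of averaging when the order of G is not invertible. -/
theorem twistedTrace_relativeIncl (s : Poly k V) (x : relativeInvariants ρG τG) :
    twistedTrace ρG τG R s (relativeIncl ρG τG R x) = polyTrace ρG s • x := by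
  refine Subtype.ext ?_
  change ∑ g, (τG.tprod (polyRep ρG)) g (mulPoly s (x : U ⊗[k] Poly k V)) =
    mulPoly (polyTrace ρG s : Poly k V) (x : U ⊗[k] Poly k V)
  rw [coe_polyTrace, map_sum, LinearMap.sum_apply]
  exact Finset.sum_congr rfl fun g _ => by rw [tprod_mulPoly, x.2 g]

theorem ker_augBd_relative_le [FiniteDimensional k U] {s : Poly k V}
    (hs : 1 - polyTrace ρG s ∈ (pointIdeal R v).map (algebraMap R (invariantAlgebra ρG))) (n : ℕ)
    (h : LinearMap.ker (Bar.augBd (Poly k V) (augAt R v) n) ≤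
      LinearMap.range (Bar.augBd (Poly k V) (augAt R v) (n + 1))) :
    LinearMap.ker (Bar.augBd (relativeInvariants ρG τG) (augAt R v) n) ≤
      LinearMap.range (Bar.augBd (relativeInvariants ρG τG) (augAt R v) (n + 1)) :=
  Bar.ker_augBd_le_of_one_sub_mem (augAt R v) hs (twistedTrace_relativeIncl ρG τG (R := R) s) n
    (ker_augBd_tensor_le _ n h)

/-- The content is that 𝔪 (U ⊗ k[V]) meets M only in 𝔪 M; this follows from the retraction by the
twisted trace. -/
theorem restrictRelative_eq_zero_iff {s : Poly k V}
    (hs : 1 - polyTrace ρG s ∈ (pointIdeal R v).map (algebraMap R (invariantAlgebra ρG)))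
    (x : relativeInvariants ρG τG) : restrictRelative ρG τG R v x = 0 ↔
      x ∈ pointIdeal R v • (⊤ : Submodule R (relativeInvariants ρG τG)) := by
  rw [← Subtype.coe_inj]
  change restrictFiber U R v (x : U ⊗[k] Poly k V) = 0 ↔ _
  rw [restrictFiber_eq_zero_iff]
  refine ⟨fun h => mem_smul_top_of_one_sub_mem hs (twistedTrace_relativeIncl ρG τG (R := R) s) h, fun h => ?_⟩
  have h2 := Submodule.mem_map_of_mem (f := relativeIncl ρG τG R) h
  rw [Submodule.map_smul''] at h2
  exact Submodule.smul_mono le_rfl le_top h2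

/-- An invariant y on the fiber lifts to some x that need not be invariant. On the fiber, however, g
x and x agree, so ∑ g(s x) = ∑ g(s) g(x) restricts to (∑ g(s)) x, and the factor is 1 there. -/
theorem restrictRelative_surjective {s : Poly k V}
    (hs : 1 - polyTrace ρG s ∈ (pointIdeal R v).map (algebraMap R (invariantAlgebra ρG))) :
    Function.Surjective (restrictRelative ρG τG R v) := by
  rintro ⟨y, hy⟩
  obtain ⟨x, rfl⟩ := restrictFiber_surjective y
  refine ⟨twistedTrace ρG τG R s x, Subtype.ext ?_⟩
  change restrictFiber U R v (∑ g, (τG.tprod (polyRep ρG)) g (mulPoly s x)) = restrictFiber U R v x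
  have hmul : ∀ f : Poly k V, ∀ a b : U ⊗[k] Poly k V,
      restrictFiber U R v a = restrictFiber U R v b →
      restrictFiber U R v (mulPoly f a) = restrictFiber U R v (mulPoly f b) := by
    intro f a b hab
    rw [← sub_eq_zero, ← map_sub, restrictFiber_eq_zero_iff] at hab ⊢
    have h2 := Submodule.mem_map_of_mem
      (f := (Algebra.lsmul R R (U ⊗[k] Poly k V) f : U ⊗[k] Poly k V →ₗ[R] U ⊗[k] Poly k V)) hab
    rw [Submodule.map_smul''] at h2
    have h3 := Submodule.smul_mono le_rfl le_top h2
    rw [← map_sub]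
    exact h3
  have h1 : restrictFiber U R v (∑ g, (τG.tprod (polyRep ρG)) g (mulPoly s x)) =
      restrictFiber U R v (mulPoly (polyTrace ρG s : Poly k V) x) := by
    rw [coe_polyTrace, map_sum, map_sum, LinearMap.sum_apply, map_sum]
    refine Finset.sum_congr rfl fun g _ => ?_
    rw [tprod_mulPoly]
    exact hmul _ _ _ (by rw [← tprod_restrictFiber, hy g])
  have hs' : 1 - (polyTrace ρG s : Poly k V) ∈ (pointIdeal R v).map (algebraMap R (Poly k V)) := by
    have := Ideal.mem_map_of_mem (algebraMap (invariantAlgebra ρG) (Poly k V)) hs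
    rw [Ideal.map_map] at this
    exact this
  have h2 := smul_mem_of_mem_map (M := U ⊗[k] Poly k V) hs' x
  rw [← restrictFiber_eq_zero_iff, sub_smul, one_smul, map_sub, sub_eq_zero] at h2
  rw [h1]
  exact h2.symm

variable (R v) in
/-- Restriction to the fiber on the bar complex in degree zero. -/
def restrictBar : Bar k R (relativeInvariants ρG τG) 0 →ₗ[k] fiberInvariants ρG τG R hR.out v :=
  restrictRelative ρG τG R v ∘ₗ (Bar.zeroEquiv k R _).toLinearMap

theorem ker_restrictBar {s : Poly k V}
    (hs : 1 - polyTrace ρG s ∈ (pointIdeal R v).map (algebraMap R (invariantAlgebra ρG))) :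
    LinearMap.ker (restrictBar ρG τG R v) =
      LinearMap.range (Bar.augBd (relativeInvariants ρG τG) (augAt R v) 0) := by
  ext x
  rw [Bar.mem_range_augBd_zero]
  exact restrictRelative_eq_zero_iff ρG τG hs _

theorem restrictBar_surjective {s : Poly k V}
    (hs : 1 - polyTrace ρG s ∈ (pointIdeal R v).map (algebraMap R (invariantAlgebra ρG))) :
    Function.Surjective (restrictBar ρG τG R v) :=
  (restrictRelative_surjective ρG τG hs).comp (Bar.zeroEquiv k R _).surjective

end Relative

/-! ### Gradings -/

section Gradings

variable {k : Type*} [Field k]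

/-- The maps `π` are the projections of a grading by the submodules `part`. -/
structure IsGrading {W : Type*} [AddCommGroup W] [Module k W] (part : ℕ → Submodule k W)
    (π : ℕ → W →ₗ[k] W) : Prop where
  proj : ∀ i j, ∀ x ∈ part j, π i x = if i = j then x else 0
  iSup_eq : ⨆ j, part j = ⊤

namespace IsGrading

/-- Linear maps are determined by their restrictions to the homogeneous parts. -/
theorem hom_ext {W : Type*} [AddCommGroup W] [Module k W] {part : ℕ → Submodule k W}
    {π : ℕ → W →ₗ[k] W} (h : IsGrading part π) {N : Type*} [AddCommGroup N] [Module k N]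
    {f g : W →ₗ[k] N} (hfg : ∀ j, ∀ x ∈ part j, f x = g x) : f = g := by
  rw [← sub_eq_zero, ← LinearMap.ker_eq_top, eq_top_iff, ← h.iSup_eq, iSup_le_iff]
  intro j x hx
  simp [hfg j x hx]

theorem proj_mem {W : Type*} [AddCommGroup W] [Module k W] {part : ℕ → Submodule k W}
    {π : ℕ → W →ₗ[k] W} (h : IsGrading part π) (j : ℕ) (x : W) : π j x ∈ part j := by
  suffices (part j).mkQ ∘ₗ π j = 0 from
    (Submodule.Quotient.mk_eq_zero _).1 (DFunLike.congr_fun this x)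
  refine h.hom_ext fun i x hx => (Submodule.Quotient.mk_eq_zero _).2 ?_
  rw [h.proj j i x hx]
  split_ifs with hij
  · exact hij ▸ hx
  · exact zero_mem _

end IsGrading

namespace Bar

variable {R M : Type*} [CommRing R] [Algebra k R] [AddCommGroup M] [Module k M]

/-- The projections to the homogeneous parts of the bar complex. -/
def proj (πR : ℕ → R →ₗ[k] R) (πM : ℕ → M →ₗ[k] M) :
    (n : ℕ) → ℕ → Bar k R M n →ₗ[k] Bar k R M n
  | 0, j => map 0 (πM j)
  | n + 1, j => (consEquiv n).toLinearMap ∘ₗ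
      (∑ p ∈ Finset.HasAntidiagonal.antidiagonal j, TensorProduct.map (πR p.1) (proj πR πM n p.2)) ∘ₗ
        (consEquiv n).symm.toLinearMap

theorem proj_cons (πR : ℕ → R →ₗ[k] R) (πM : ℕ → M →ₗ[k] M) (n j : ℕ) (r : R)
    (x : Bar k R M n) : proj πR πM (n + 1) j (cons n r x) =
      ∑ p ∈ Finset.HasAntidiagonal.antidiagonal j, cons n (πR p.1 r) (proj πR πM n p.2 x) := by
  simp [proj, consEquiv_tmul]

end Bar

namespace EquivariantModule

variable {R M Θ : Type*} [CommRing R] [Algebra k R] [AddCommGroup M] [Module k M] [Group Θ]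
  (D : EquivariantModule k R M Θ)

theorem barPart_zero (j : ℕ) : D.barPart 0 j = (D.partM j).map (Bar.mk 0 ![]) := by
  refine le_antisymm (Submodule.span_le.2 ?_) ?_
  · rintro _ ⟨a, b, r, m, -, hm, hj, rfl⟩
    rw [Subsingleton.elim r ![]]
    have : b = j := by simpa using hj
    exact ⟨m, this ▸ hm, rfl⟩
  · rintro _ ⟨m, hm, rfl⟩
    exact Submodule.subset_span ⟨![], j, ![], m, fun i => i.elim0, hm, by simp, rfl⟩

/-- This recursive form matches `Bar.cons`, so that statements about internal degrees become
inductions on the number of factors. -/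
theorem barPart_succ (n j : ℕ) : D.barPart (n + 1) j = ⨆ p ∈ Finset.HasAntidiagonal.antidiagonal j,
    Submodule.map₂ (Bar.cons n) (D.partR p.1) (D.barPart n p.2) := by
  refine le_antisymm (Submodule.span_le.2 ?_) (iSup₂_le fun p hp => Submodule.map₂_le.2 ?_)
  · rintro _ ⟨a, b, r, m, hr, hm, hj, rfl⟩
    rw [← Fin.cons_self_tail r, ← Bar.cons_mk]
    refine Submodule.mem_iSup_of_mem (a 0, ∑ i, Fin.tail a i + b) (Submodule.mem_iSup_of_mem ?_
      (Submodule.apply_mem_map₂ _ (hr 0) (Submodule.subset_span ⟨Fin.tail a, b, Fin.tail r, m,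
        fun i => hr i.succ, hm, rfl, rfl⟩)))
    rw [Finset.HasAntidiagonal.mem_antidiagonal, ← hj, Fin.sum_univ_succ, add_assoc]
    rfl
  · intro r hr x hx
    suffices D.barPart n p.2 ≤ (D.barPart (n + 1) j).comap (Bar.cons n r) from this hx
    refine Submodule.span_le.2 ?_
    rintro _ ⟨a, b, s, m, hs, hm, hj, rfl⟩
    refine Submodule.subset_span ⟨Fin.cons p.1 a, b, Fin.cons r s, m, ?_, hm, ?_, Bar.cons_mk _ _ _ _⟩
    · exact Fin.cases (by simpa using hr) (by simpa using hs)
    · rw [Fin.sum_cons, add_assoc, hj]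
      exact Finset.HasAntidiagonal.mem_antidiagonal.1 hp

theorem cons_mem_barPart {n a b : ℕ} {r : R} {x : Bar k R M n} (hr : r ∈ D.partR a)
    (hx : x ∈ D.barPart n b) : Bar.cons n r x ∈ D.barPart (n + 1) (a + b) := by
  rw [barPart_succ]
  exact Submodule.mem_iSup_of_mem (a, b) (Submodule.mem_iSup_of_mem (by simp)
    (Submodule.apply_mem_map₂ _ hr hx))

theorem barPart_succ_le {n j : ℕ} {P : Submodule k (Bar k R M (n + 1))}
    (h : ∀ a b, a + b = j → ∀ r ∈ D.partR a, ∀ x ∈ D.barPart n b, Bar.cons n r x ∈ P) :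
    D.barPart (n + 1) j ≤ P := by
  rw [barPart_succ]
  exact iSup₂_le fun p hp => Submodule.map₂_le.2 fun r hr x hx =>
    h p.1 p.2 (Finset.HasAntidiagonal.mem_antidiagonal.1 hp) r hr x hx

theorem fg_barPart (hR : ∀ a, (D.partR a).FG) (hM : ∀ b, (D.partM b).FG) (n j : ℕ) :
    (D.barPart n j).FG := by
  induction n generalizing j with
  | zero =>
    rw [barPart_zero]
    exact (hM j).map _
  | succ n ih =>
    rw [barPart_succ]
    exact Submodule.fg_biSup _ _ fun p _ => (hR _).map₂ _ (ih _)

theorem isGrading_barPart {πR : ℕ → R →ₗ[k] R} {πM : ℕ → M →ₗ[k] M} (hR : IsGrading D.partR πR)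
    (hM : IsGrading D.partM πM) (n : ℕ) : IsGrading (D.barPart n) (Bar.proj πR πM n) := by
  induction n with
  | zero =>
    constructor
    · intro i j x hx
      rw [barPart_zero] at hx
      obtain ⟨m, hm, rfl⟩ := hx
      rw [Bar.proj, Bar.map_mk, hM.proj i j m hm]
      split_ifs <;> simp
    · simp only [barPart_zero]
      rw [← Submodule.map_iSup, hM.iSup_eq, Submodule.map_top, LinearMap.range_eq_top]
      exact Bar.mk_zero_surjective
  | succ n ih =>
    constructor
    · intro i j x hx
      suffices D.barPart (n + 1) j ≤ LinearMap.ker (Bar.proj πR πM (n + 1) i -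
          if i = j then LinearMap.id else 0) by
        have h := this hx
        rw [LinearMap.mem_ker, LinearMap.sub_apply, sub_eq_zero] at h
        rw [h]
        split_ifs <;> rfl
      refine D.barPart_succ_le fun a b hab r hr x hx => ?_
      rw [LinearMap.mem_ker, LinearMap.sub_apply, sub_eq_zero, Bar.proj_cons]
      have hterm : ∀ p : ℕ × ℕ, Bar.cons n (πR p.1 r) (Bar.proj πR πM n p.2 x) =
          if p = (a, b) then Bar.cons n r x else 0 := by
        rintro ⟨p, q⟩
        rw [hR.proj p a r hr, ih.proj q b x hx]
        by_cases hp : p = a <;> by_cases hq : q = b <;> simp [hp, hq]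
      simp only [hterm, Finset.sum_ite_eq', Finset.HasAntidiagonal.mem_antidiagonal, hab]
      by_cases hij : i = j
      · simp [hij]
      · rw [if_neg hij, if_neg (fun h => hij h.symm), LinearMap.zero_apply]
    · rw [eq_top_iff]
      intro x _
      suffices (⨆ j, D.barPart (n + 1) j).mkQ = 0 from
        (Submodule.Quotient.mk_eq_zero _).1 (DFunLike.congr_fun this x)
      refine Bar.cons_ext fun r x => ?_
      have key : (LinearMap.compr₂ (Bar.cons n) (⨆ j, D.barPart (n + 1) j).mkQ) = 0 := by
        refine hR.hom_ext fun a r hr => ih.hom_ext fun b x hx => ?_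
        exact (Submodule.Quotient.mk_eq_zero _).2
          (Submodule.mem_iSup_of_mem (a + b) (D.cons_mem_barPart hr hx))
      exact DFunLike.congr_fun (DFunLike.congr_fun key r) x

/-- The part of internal degree less than `J` of the bar complex. -/
def filt (n J : ℕ) : Submodule k (Bar k R M n) :=
  ⨆ j ∈ Finset.range J, D.barPart n j

theorem filt_zero (n : ℕ) : D.filt n 0 = ⊥ := by
  simp [filt]

theorem filt_succ (n J : ℕ) : D.filt n (J + 1) = D.filt n J ⊔ D.barPart n J := by
  rw [filt, filt, Finset.range_add_one, Finset.iSup_insert, sup_comm]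

theorem filt_mono (n : ℕ) : Monotone (D.filt n) := fun _ _ h =>
  biSup_mono fun _ hj => Finset.range_mono h hj

theorem barPart_le_filt {n j J : ℕ} (h : j < J) : D.barPart n j ≤ D.filt n J :=
  le_biSup (fun j => D.barPart n j) (Finset.mem_range.2 h)

theorem filt_le {n J : ℕ} {P : Submodule k (Bar k R M n)} (h : ∀ j < J, D.barPart n j ≤ P) :
    D.filt n J ≤ P :=
  iSup₂_le fun j hj => h j (Finset.mem_range.1 hj)

/-! ### Internal degree and the differential -/

section Differential

/-- Only factors of degree zero survive the augmentation, and dropping one of those does not change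
the internal degree. -/
theorem augFirst_mem_barPart {ε : R →ₐ[k] k} (hε : ∀ a, a ≠ 0 → ∀ r ∈ D.partR a, ε r = 0)
    (n j : ℕ) (x : Bar k R M (n + 1)) (hx : x ∈ D.barPart (n + 1) j) :
    Bar.augFirst M ε n x ∈ D.barPart n j := by
  suffices D.barPart (n + 1) j ≤ (D.barPart n j).comap (Bar.augFirst M ε n) from this hx
  refine D.barPart_succ_le fun a b hab r hr x hx => ?_
  rw [Submodule.mem_comap, Bar.augFirst_cons]
  by_cases ha : a = 0
  · rw [ha, zero_add] at hab
    exact hab ▸ Submodule.smul_mem _ _ hx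
  · rw [hε a ha r hr, zero_smul]
    exact zero_mem _

variable [Module R M] [IsScalarTower k R M]

theorem bd_mem_barPart (hmul : ∀ a b, ∀ r ∈ D.partR a, ∀ s ∈ D.partR b, r * s ∈ D.partR (a + b))
    (hsmul : ∀ a b, ∀ r ∈ D.partR a, ∀ m ∈ D.partM b, r • m ∈ D.partM (a + b)) (n j : ℕ)
    (x : Bar k R M (n + 1)) (hx : x ∈ D.barPart (n + 1) j) : Bar.bd k R M n x ∈ D.barPart n j := by
  suffices D.barPart (n + 1) j ≤ (D.barPart n j).comap (Bar.bd k R M n) from this hx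
  clear hx x
  induction n generalizing j with
  | zero =>
    refine D.barPart_succ_le fun a b hab r hr x hx => ?_
    rw [barPart_zero] at hx
    obtain ⟨m, hm, rfl⟩ := hx
    rw [Submodule.mem_comap, Bar.bd_zero, Bar.smulLast_mk, ← hab, barPart_zero]
    exact ⟨_, hsmul a b r hr m hm, rfl⟩
  | succ n ih =>
    refine D.barPart_succ_le fun a b hab r hr x hx => ?_
    rw [Submodule.mem_comap, Bar.bd_succ, ← hab]
    refine sub_mem ?_ (D.cons_mem_barPart hr (ih b hx))
    suffices D.barPart (n + 1) b ≤ (D.barPart (n + 1) (a + b)).comap (Bar.consMul k R M n r) from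
      this hx
    refine D.barPart_succ_le fun a' b' hab' r' hr' y hy => ?_
    rw [Submodule.mem_comap, Bar.consMul_cons, ← hab', ← add_assoc]
    exact D.cons_mem_barPart (hmul a a' r hr r' hr') hy

theorem augBd_mem_barPart
    (hmul : ∀ a b, ∀ r ∈ D.partR a, ∀ s ∈ D.partR b, r * s ∈ D.partR (a + b))
    (hsmul : ∀ a b, ∀ r ∈ D.partR a, ∀ m ∈ D.partM b, r • m ∈ D.partM (a + b)) {ε : R →ₐ[k] k}
    (hε : ∀ a, a ≠ 0 → ∀ r ∈ D.partR a, ε r = 0) (n j : ℕ) (x : Bar k R M (n + 1))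
    (hx : x ∈ D.barPart (n + 1) j) : Bar.augBd M ε n x ∈ D.barPart n j :=
  sub_mem (D.augFirst_mem_barPart hε n j x hx) (D.bd_mem_barPart hmul hsmul n j x hx)

/-- The differentials differ on r ⊗ x by (ε(r) - ε'(r)) x. For r of degree zero this vanishes;
otherwise x has smaller internal degree than r ⊗ x. -/
theorem augBd_sub_augBd_mem_filt {ε ε' : R →ₐ[k] k} (h : ∀ r ∈ D.partR 0, ε r = ε' r)
    (n j : ℕ) (x : Bar k R M (n + 1)) (hx : x ∈ D.barPart (n + 1) j) :
    Bar.augBd M ε n x - Bar.augBd M ε' n x ∈ D.filt n j := by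
  suffices D.barPart (n + 1) j ≤ (D.filt n j).comap (Bar.augBd M ε n - Bar.augBd M ε' n) from
    this hx
  refine D.barPart_succ_le fun a b hab r hr x hx => ?_
  rw [Submodule.mem_comap, LinearMap.sub_apply, Bar.augBd_cons, Bar.augBd_cons, sub_sub_sub_cancel_right,
    ← sub_smul]
  by_cases ha : a = 0
  · subst ha
    rw [h r hr, sub_self, zero_smul]
    exact zero_mem _
  · exact Submodule.smul_mem _ _ (D.barPart_le_filt (by omega) hx)

end Differential

end EquivariantModule

end Gradings

/-! ### Classes in the Grothendieck group -/

section Classes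

variable {k : Type u} [Field k] {Θ : Type*} [Group Θ]

theorem Groth.cls_of_exact {X' X X'' : Type u} [AddCommGroup X'] [Module k X'] [AddCommGroup X]
    [Module k X] [AddCommGroup X''] [Module k X''] {ρ' : Representation k Θ X'}
    {ρ : Representation k Θ X} {ρ'' : Representation k Θ X''} {f : X' →ₗ[k] X} {g : X →ₗ[k] X''}
    (hf : ∀ t x, f (ρ' t x) = ρ t (f x)) (hg : ∀ t x, g (ρ t x) = ρ'' t (g x))
    (inj : Function.Injective f) (ex : Function.Exact f g) (surj : Function.Surjective g)
    (h' : FiniteDimensional k X') (h : FiniteDimensional k X) (h'' : FiniteDimensional k X'') :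
    Groth.cls ρ h = Groth.cls ρ' h' + Groth.cls ρ'' h'' := by
  rw [← sub_eq_zero, ← sub_sub]
  refine (QuotientAddGroup.eq_zero_iff (FreeAbelianGroup.of (FDRep.of ρ) -
    FreeAbelianGroup.of (FDRep.of ρ') - FreeAbelianGroup.of (FDRep.of ρ''))).2 ?_
  exact AddSubgroup.subset_closure
    ⟨FDRep.of ρ', FDRep.of ρ, FDRep.of ρ'', f, g, hf, hg, inj, ex, surj, rfl⟩

variable {W W' : Type u} [AddCommGroup W] [Module k W] [AddCommGroup W'] [Module k W']

/-- A finite-dimensional subrepresentation. -/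
structure IsFDSub (ρ : Representation k Θ W) (P : Submodule k W) : Prop where
  stable : ∀ t, P ≤ P.comap (ρ t)
  fg : P.FG

open Classical in
/-- The class of a finite-dimensional subrepresentation. -/
def clsSub (ρ : Representation k Θ W) (P : Submodule k W) : Groth k Θ :=
  -- Being total in `P`, with value 0 as default, allows rewriting along equalities of submodules
  -- without transporting the proofs of stability.
  if h : IsFDSub ρ P then
    Groth.cls (ρ.subrepresentation P h.stable) (Module.Finite.iff_fg.2 h.fg) else 0

theorem clsSub_of {ρ : Representation k Θ W} {P : Submodule k W} (h : IsFDSub ρ P) :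
    clsSub ρ P = Groth.cls (ρ.subrepresentation P h.stable) (Module.Finite.iff_fg.2 h.fg) :=
  dif_pos h

section

variable {ρ : Representation k Θ W} {ρ' : Representation k Θ W'} {f : W →ₗ[k] W'}
  {P Q : Submodule k W}

theorem IsFDSub.of_le (h : IsFDSub ρ P) (hQ : ∀ t, Q ≤ Q.comap (ρ t)) (hle : Q ≤ P) :
    IsFDSub ρ Q :=
  ⟨hQ, Submodule.FG.of_le h.fg hle⟩

theorem IsFDSub.sup (hP : IsFDSub ρ P) (hQ : IsFDSub ρ Q) : IsFDSub ρ (P ⊔ Q) :=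
  ⟨fun t => sup_le ((hP.stable t).trans (Submodule.comap_mono le_sup_left))
    ((hQ.stable t).trans (Submodule.comap_mono le_sup_right)), hP.fg.sup hQ.fg⟩

theorem IsFDSub.bot (ρ : Representation k Θ W) : IsFDSub ρ ⊥ :=
  ⟨fun _ => bot_le, Submodule.fg_bot⟩

theorem IsFDSub.map (h : IsFDSub ρ P) (hf : ∀ t x, f (ρ t x) = ρ' t (f x)) :
    IsFDSub ρ' (P.map f) := by
  refine ⟨fun t => ?_, h.fg.map f⟩
  rintro _ ⟨x, hx, rfl⟩
  exact ⟨ρ t x, h.stable t hx, hf t x⟩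

theorem IsFDSub.inf_ker (h : IsFDSub ρ P) (hf : ∀ t x, f (ρ t x) = ρ' t (f x)) :
    IsFDSub ρ (P ⊓ LinearMap.ker f) := by
  refine h.of_le (fun t x hx => ⟨h.stable t hx.1, ?_⟩) inf_le_left
  have : f x = 0 := hx.2
  change f (ρ t x) = 0
  rw [hf, this, map_zero]

/-- Additivity for the restriction of an equivariant map to a subrepresentation. -/
theorem clsSub_eq_add (h : IsFDSub ρ P) (hf : ∀ t x, f (ρ t x) = ρ' t (f x)) :
    clsSub ρ P = clsSub ρ (P ⊓ LinearMap.ker f) + clsSub ρ' (P.map f) := by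
  rw [clsSub_of h, clsSub_of (h.inf_ker hf), clsSub_of (h.map hf)]
  refine Groth.cls_of_exact (ρ' := ρ.subrepresentation _ (h.inf_ker hf).stable)
    (ρ := ρ.subrepresentation P h.stable) (ρ'' := ρ'.subrepresentation _ (h.map hf).stable)
    (f := Submodule.inclusion inf_le_left)
    (g := f.restrict fun x hx => Submodule.mem_map_of_mem hx) (fun t x => rfl)
    (fun t x => Subtype.ext (hf t x)) (Submodule.inclusion_injective _) ?_ ?_ _ _ _
  · rintro ⟨x, hx⟩
    constructor
    · intro h0
      exact ⟨⟨x, hx, congrArg Subtype.val h0⟩, rfl⟩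
    · rintro ⟨⟨y, hy⟩, hyx⟩
      obtain rfl : y = x := congrArg Subtype.val hyx
      exact Subtype.ext hy.2
  · rintro ⟨_, x, hx, rfl⟩
    exact ⟨⟨x, hx⟩, rfl⟩

theorem clsSub_bot (ρ : Representation k Θ W) : clsSub ρ (⊥ : Submodule k W) = 0 := by
  -- Additivity for the identity of the zero space reads [0] = [0] + [0].
  have h := clsSub_eq_add (IsFDSub.bot ρ) (f := LinearMap.id) (ρ' := ρ) fun _ _ => rfl
  rw [Submodule.map_id, bot_inf_eq] at h
  exact left_eq_add.1 h

theorem clsSub_map_of_injective (h : IsFDSub ρ P) (hf : ∀ t x, f (ρ t x) = ρ' t (f x))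
    (inj : Function.Injective f) : clsSub ρ' (P.map f) = clsSub ρ P := by
  rw [clsSub_eq_add h hf, LinearMap.ker_eq_bot.2 inj, inf_bot_eq, clsSub_bot, zero_add]

/-- As types ⊤ and W differ; the exact sequence 0 → ⊥ → ⊤ → W → 0 identifies their classes. -/
theorem Groth.cls_eq_clsSub_top (ρ : Representation k Θ W) (h : FiniteDimensional k W) :
    Groth.cls ρ h = clsSub ρ ⊤ := by
  have htop : IsFDSub ρ ⊤ := ⟨fun _ _ _ => trivial, h.fg_top⟩
  have hbot := clsSub_bot ρ
  rw [clsSub_of (IsFDSub.bot ρ)] at hbot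
  rw [clsSub_of htop, Groth.cls_of_exact (ρ' := ρ.subrepresentation ⊥ (IsFDSub.bot ρ).stable)
    (ρ := ρ.subrepresentation ⊤ htop.stable) (ρ'' := ρ) (f := Submodule.inclusion bot_le)
    (g := (⊤ : Submodule k W).subtype) (fun _ _ => rfl) (fun _ _ => rfl)
    (Submodule.inclusion_injective _) ?_ (fun x => ⟨⟨x, trivial⟩, rfl⟩)
    (Module.Finite.iff_fg.2 Submodule.fg_bot) _ h, hbot, zero_add]
  rintro ⟨x, hx⟩
  constructor
  · intro h0
    exact ⟨0, Subtype.ext (by rw [map_zero]; exact h0.symm)⟩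
  · rintro ⟨⟨y, hy⟩, hyx⟩
    have : y = x := congrArg Subtype.val hyx
    rw [← this]
    exact hy

theorem Groth.cls_of_surjective {Y : Type u} [AddCommGroup Y] [Module k Y]
    {σ : Representation k Θ Y} {ψ : W →ₗ[k] Y} (h : IsFDSub ρ P)
    (hψ : ∀ t x, ψ (ρ t x) = σ t (ψ x)) (surj : P.map ψ = ⊤) (hY : FiniteDimensional k Y) :
    Groth.cls σ hY = clsSub ρ P - clsSub ρ (P ⊓ LinearMap.ker ψ) := by
  rw [Groth.cls_eq_clsSub_top, clsSub_eq_add h hψ, surj, add_sub_cancel_left]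

end

namespace EquivariantModule

variable {R M : Type u} [CommRing R] [Algebra k R] [AddCommGroup M] [Module k M]
  (D : EquivariantModule k R M Θ)

theorem cls_torRep {i j : ℕ} (hle : D.boundaries i j ≤ D.cycles i j) (hfg : (D.cycles i j).FG)
    (hT : FiniteDimensional k (D.Tor i j)) : Groth.cls (D.torRep i j) hT =
      clsSub (D.barRep i) (D.cycles i j) - clsSub (D.barRep i) (D.boundaries i j) := by
  have hc : IsFDSub (D.barRep i) (D.cycles i j) := ⟨D.cycles_stable i j, hfg⟩
  set σ := (D.barRep i).subrepresentation (D.cycles i j) (D.cycles_stable i j) with hσ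
  have htop : IsFDSub σ ⊤ :=
    ⟨fun _ _ _ => trivial, (Module.Finite.iff_fg.2 hfg : Module.Finite k (D.cycles i j)).fg_top⟩
  have h1 := Groth.cls_of_surjective (ρ := σ) (σ := D.torRep i j)
    (ψ := ((D.boundaries i j).submoduleOf (D.cycles i j)).mkQ) htop (fun _ _ => rfl)
    (by rw [Submodule.map_top, Submodule.range_mkQ]) hT
  rw [Submodule.ker_mkQ, top_inf_eq] at h1
  have hb : IsFDSub σ ((D.boundaries i j).submoduleOf (D.cycles i j)) :=
    htop.of_le (fun t _ hx => D.boundaries_stable i j t hx) le_top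
  rw [h1, ← clsSub_map_of_injective (f := (D.cycles i j).subtype) (ρ' := D.barRep i) htop
    (fun _ _ => rfl) Subtype.val_injective, ← clsSub_map_of_injective
    (f := (D.cycles i j).subtype) (ρ' := D.barRep i) hb (fun _ _ => rfl) Subtype.val_injective,
    Submodule.map_top, Submodule.range_subtype, Submodule.submoduleOf, Submodule.map_comap_subtype,
    inf_eq_right.2 hle]

end EquivariantModule

end Classes

/-! ### Perturbations of the differential -/

section Perturbation

variable {k R M Θ : Type*} [Field k] [CommRing R] [Algebra k R] [AddCommGroup M] [Module k M]
  [Group Θ]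

namespace EquivariantModule

theorem cycles_le_barPart (D : EquivariantModule k R M Θ) (i j : ℕ) :
    D.cycles i j ≤ D.barPart i j := by
  cases i with
  | zero => exact le_rfl
  | succ i => exact inf_le_right

/-- A differential on the bar complex that agrees with the given one up to terms of lower internal
degree. -/
structure IsPerturbation (D : EquivariantModule k R M Θ)
    (δ : ∀ n, Bar k R M (n + 1) →ₗ[k] Bar k R M n) (π : ∀ n, ℕ → Bar k R M n →ₗ[k] Bar k R M n) :
    Prop where
  grading : ∀ n, IsGrading (D.barPart n) (π n)
  d_mem : ∀ n j, ∀ x ∈ D.barPart (n + 1) j, D.d n x ∈ D.barPart n j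
  sub_mem : ∀ n j, ∀ x ∈ D.barPart (n + 1) j, δ n x - D.d n x ∈ D.filt n j
  d_d : ∀ n x, D.d n (D.d (n + 1) x) = 0
  δ_δ : ∀ n x, δ n (δ (n + 1) x) = 0

variable {D : EquivariantModule k R M Θ} {δ : ∀ n, Bar k R M (n + 1) →ₗ[k] Bar k R M n}
  {π : ∀ n, ℕ → Bar k R M n →ₗ[k] Bar k R M n}

namespace IsPerturbation

theorem proj_filt (h : D.IsPerturbation δ π) {n j J : ℕ} (hJ : J ≤ j) {x : Bar k R M n} (hx : x ∈ D.filt n J) :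
    π n j x = 0 := by
  suffices D.filt n J ≤ LinearMap.ker (π n j) from this hx
  refine D.filt_le fun i hi y hy => ?_
  rw [LinearMap.mem_ker, (h.grading n).proj j i y hy, if_neg (by omega)]

theorem exists_mem_filt (h : D.IsPerturbation δ π) (n : ℕ) (x : Bar k R M n) : ∃ J, x ∈ D.filt n J := by
  have hx : x ∈ ⨆ j, D.barPart n j := by rw [(h.grading n).iSup_eq]; trivial
  induction hx using Submodule.iSup_induction' with
  | mem j x hx => exact ⟨j + 1, D.barPart_le_filt (Nat.lt_succ_self j) hx⟩
  | zero => exact ⟨0, zero_mem _⟩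
  | add x y _ _ hx hy =>
    obtain ⟨J, hJ⟩ := hx
    obtain ⟨J', hJ'⟩ := hy
    exact ⟨max J J', add_mem (D.filt_mono n (le_max_left _ _) hJ)
      (D.filt_mono n (le_max_right _ _) hJ')⟩

theorem exists_le_filt (h : D.IsPerturbation δ π) (n : ℕ) {W : Submodule k (Bar k R M n)} (hW : W.FG) :
    ∃ J, W ≤ D.filt n J := by
  obtain ⟨S, rfl⟩ := hW
  choose J hJ using h.exists_mem_filt n
  refine ⟨S.sup J, Submodule.span_le.2 fun x hx => ?_⟩
  exact D.filt_mono n (Finset.le_sup (f := J) hx) (hJ x)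

theorem proj_d (h : D.IsPerturbation δ π) (n j : ℕ) (x : Bar k R M (n + 1)) : π n j (D.d n x) = D.d n (π (n + 1) j x) := by
  suffices π n j ∘ₗ D.d n = D.d n ∘ₗ π (n + 1) j from DFunLike.congr_fun this x
  refine (h.grading (n + 1)).hom_ext fun i x hx => ?_
  rw [LinearMap.comp_apply, LinearMap.comp_apply, (h.grading n).proj j i _ (h.d_mem n i x hx),
    (h.grading (n + 1)).proj j i x hx]
  split_ifs <;> simp

theorem proj_barRep (h : D.IsPerturbation δ π) (n j : ℕ) (t : Θ) (x : Bar k R M n) :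
    π n j (D.barRep n t x) = D.barRep n t (π n j x) := by
  suffices π n j ∘ₗ D.barRep n t = D.barRep n t ∘ₗ π n j from DFunLike.congr_fun this x
  refine (h.grading n).hom_ext fun i x hx => ?_
  rw [LinearMap.comp_apply, LinearMap.comp_apply,
    (h.grading n).proj j i _ (D.barRep_mem n i t x hx), (h.grading n).proj j i x hx]
  split_ifs <;> simp

theorem boundaries_le_cycles (h : D.IsPerturbation δ π) (i j : ℕ) : D.boundaries i j ≤ D.cycles i j := by
  rintro _ ⟨x, hx, rfl⟩
  cases i with
  | zero => exact h.d_mem 0 j x hx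
  | succ i => exact ⟨h.d_d i x, h.d_mem (i + 1) j x hx⟩

/-- Since d preserves the internal degree, a preimage may be replaced by its component of degree j.
-/
theorem mem_boundaries (h : D.IsPerturbation δ π) {i j : ℕ} {x : Bar k R M i} (hx : x ∈ D.barPart i j)
    (hx' : x ∈ LinearMap.range (D.d i)) : x ∈ D.boundaries i j := by
  obtain ⟨y, rfl⟩ := hx'
  refine ⟨π (i + 1) j y, (h.grading _).proj_mem _ _, ?_⟩
  rw [← h.proj_d, (h.grading i).proj j j _ hx, if_pos rfl]

/-- Exactness in one homological degree is inherited by the homogeneous parts. -/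
theorem cycles_le_of_ker_le (h : D.IsPerturbation δ π) {i : ℕ} (hi : LinearMap.ker (D.d i) ≤ LinearMap.range (D.d (i + 1)))
    (j : ℕ) : D.cycles (i + 1) j ≤ D.boundaries (i + 1) j :=
  fun _ hx => h.mem_boundaries hx.2 (hi hx.1)

/-- If the homology is finite-dimensional, it vanishes in large internal degrees. -/
theorem exists_cycles_le (h : D.IsPerturbation δ π) {i : ℕ} {Z W : Submodule k (Bar k R M i)} (hZ : ∀ j, D.cycles i j ≤ Z)
    (hW : W.FG) (hle : Z ≤ W ⊔ LinearMap.range (D.d i)) :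
    ∃ J, ∀ j, J ≤ j → D.cycles i j ≤ D.boundaries i j := by
  -- The finitely generated W lies in internal degrees below some J; projecting to degree j ≥ J
  -- removes its contribution and leaves a boundary.
  obtain ⟨J, hJ⟩ := h.exists_le_filt i hW
  refine ⟨J, fun j hj x hx => ?_⟩
  have hxp := cycles_le_barPart D i j hx
  obtain ⟨w, hw, _, ⟨u, rfl⟩, rfl⟩ := Submodule.mem_sup.1 (hle (hZ j hx))
  refine h.mem_boundaries hxp ⟨π (i + 1) j u, ?_⟩
  have := (h.grading i).proj j j _ hxp
  rw [if_pos rfl, map_add, h.proj_filt hj (hJ hw), zero_add, h.proj_d] at this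
  exact this

theorem δ_mem_filt (h : D.IsPerturbation δ π) {n J : ℕ} {x : Bar k R M (n + 1)} (hx : x ∈ D.filt (n + 1) J) :
    δ n x ∈ D.filt n J := by
  suffices D.filt (n + 1) J ≤ (D.filt n J).comap (δ n) from this hx
  refine D.filt_le fun j hj y hy => ?_
  have := add_mem (D.filt_mono n hj.le (h.sub_mem n j y hy))
    (D.barPart_le_filt hj (h.d_mem n j y hy))
  rwa [sub_add_cancel] at this

/-- The leading term of the differential. -/
theorem proj_δ (h : D.IsPerturbation δ π) {n J : ℕ} {x t : Bar k R M (n + 1)} (hx : x ∈ D.filt (n + 1) J)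
    (ht : t ∈ D.barPart (n + 1) J) : π n J (δ n (x + t)) = D.d n t := by
  have h1 : δ n (x + t) = (δ n x + (δ n t - D.d n t)) + D.d n t := by
    rw [map_add]
    abel
  rw [h1, map_add, h.proj_filt le_rfl (add_mem (h.δ_mem_filt hx) (h.sub_mem n J t ht)), zero_add,
    (h.grading n).proj J J _ (h.d_mem n J t ht), if_pos rfl]

/-- The leading term d u is cancelled by δ u up to terms of lower internal degree. -/
theorem sub_δ_mem_filt (h : D.IsPerturbation δ π) {n J : ℕ} {x : Bar k R M n} {u : Bar k R M (n + 1)}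
    (hx : x ∈ D.filt n J) (hu : u ∈ D.barPart (n + 1) J) :
    x + D.d n u - δ n u ∈ D.filt n J := by
  have : x + D.d n u - δ n u = x - (δ n u - D.d n u) := by abel
  rw [this]
  exact _root_.sub_mem hx (h.sub_mem n J u hu)

/-- A cycle modulo lower terms can be lowered by a boundary. -/
theorem exists_sub_δ_mem (h : D.IsPerturbation δ π) {n J : ℕ} {x : Bar k R M (n + 1)}
    (hx : x ∈ D.filt (n + 1) (J + 1)) (hδ : δ n x ∈ D.filt n J)
    (hJ : D.cycles (n + 1) J ≤ D.boundaries (n + 1) J) :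
    ∃ u ∈ D.barPart (n + 2) J, x - δ (n + 1) u ∈ D.filt (n + 1) J := by
  rw [D.filt_succ] at hx
  obtain ⟨y, hy, t, ht, rfl⟩ := Submodule.mem_sup.1 hx
  have hdt : D.d n t = 0 := by rw [← h.proj_δ hy ht, h.proj_filt le_rfl hδ]
  obtain ⟨u, hu, rfl⟩ := hJ ⟨hdt, ht⟩
  exact ⟨u, hu, h.sub_δ_mem_filt hy hu⟩

/-- In homological degree zero everything is a cycle, so no condition on δ x is needed. -/
theorem exists_sub_δ_mem_zero (h : D.IsPerturbation δ π) {J : ℕ} {x : Bar k R M 0}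
    (hx : x ∈ D.filt 0 (J + 1)) (hJ : D.cycles 0 J ≤ D.boundaries 0 J) :
    ∃ u ∈ D.barPart 1 J, x - δ 0 u ∈ D.filt 0 J := by
  rw [D.filt_succ] at hx
  obtain ⟨y, hy, t, ht, rfl⟩ := Submodule.mem_sup.1 hx
  obtain ⟨u, hu, rfl⟩ := hJ ht
  exact ⟨u, hu, h.sub_δ_mem_filt hy hu⟩

/-- If the homology of the homogeneous parts vanishes from `J` on, the homology of the
filtered piece below `J` injects into that of the total complex. -/
theorem mem_map_filt_of_mem_range (h : D.IsPerturbation δ π) {n J : ℕ}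
    (hJ : ∀ j, J ≤ j → D.cycles (n + 1) j ≤ D.boundaries (n + 1) j) {x : Bar k R M n}
    (hx : x ∈ D.filt n J) (hx' : x ∈ LinearMap.range (δ n)) : x ∈ (D.filt (n + 1) J).map (δ n) := by
  obtain ⟨y, rfl⟩ := hx'
  obtain ⟨J', hy⟩ := h.exists_mem_filt _ y
  induction J' generalizing y with
  | zero => exact ⟨y, D.filt_mono _ (Nat.zero_le _) hy, rfl⟩
  | succ J' ih =>
    by_cases hle : J' + 1 ≤ J
    · exact ⟨y, D.filt_mono _ hle hy, rfl⟩
    -- As δ y has degree below J ≤ J', the component of y in degree J' is a d-cycle, hence a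
    -- d-boundary. Subtracting δ u removes it without changing δ y.
    · obtain ⟨u, hu, hyu⟩ := h.exists_sub_δ_mem hy (D.filt_mono _ (by omega) hx) (hJ J' (by omega))
      have := ih (y - δ (n + 1) u) (by rwa [map_sub, h.δ_δ, sub_zero]) hyu
      rwa [map_sub, h.δ_δ, sub_zero] at this

/-- Leading terms of degree J or more are d-boundaries and are removed one after another. So the
part below J represents the whole homology of δ in degree zero. -/
theorem exists_sub_mem_filt (h : D.IsPerturbation δ π) {J : ℕ} (hJ : ∀ j, J ≤ j → D.cycles 0 j ≤ D.boundaries 0 j)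
    (x : Bar k R M 0) : ∃ u, x - δ 0 u ∈ D.filt 0 J := by
  obtain ⟨J', hx⟩ := h.exists_mem_filt _ x
  induction J' generalizing x with
  | zero => exact ⟨0, by rw [map_zero, sub_zero]; exact D.filt_mono _ (Nat.zero_le _) hx⟩
  | succ J' ih =>
    by_cases hle : J' + 1 ≤ J
    · exact ⟨0, by rw [map_zero, sub_zero]; exact D.filt_mono _ hle hx⟩
    · obtain ⟨u, hu, hxu⟩ := h.exists_sub_δ_mem_zero hx (hJ J' (by omega))
      obtain ⟨y, hy⟩ := ih _ hxu
      exact ⟨u + y, by rwa [map_add, ← sub_sub]⟩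

end IsPerturbation

end EquivariantModule

end Perturbation

/-! ### Euler characteristics -/

section EulerCharacteristic

/-- The Euler-Poincaré principle for classes z of cycles, b of boundaries and c of chains. Cutting
off after degree p leaves the term b p, which the chains of degree p + 1 would have accounted for.
-/
theorem alternating_sum_sub {A : Type*} [AddCommGroup A] {z b c : ℕ → A} (h0 : c 0 = z 0)
    (hs : ∀ i, c (i + 1) = z (i + 1) + b i) (p : ℕ) :
    ∑ i ∈ Finset.range (p + 1), (-1 : ℤ) ^ i • (z i - b i) =
      ∑ i ∈ Finset.range (p + 1), (-1 : ℤ) ^ i • c i - (-1 : ℤ) ^ p • b p := by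
  induction p with
  | zero => simp [h0]
  | succ p ih =>
    rw [Finset.sum_range_succ, ih, Finset.sum_range_succ _ (p + 1), hs, pow_succ]
    simp only [smul_sub, smul_add, mul_neg, mul_one, neg_smul]
    abel

variable {k : Type u} [Field k] {R M : Type u} [CommRing R] [Algebra k R] [AddCommGroup M]
  [Module k M] {Θ : Type*} [Group Θ] {D : EquivariantModule k R M Θ}
  {δ : ∀ n, Bar k R M (n + 1) →ₗ[k] Bar k R M n} {π : ∀ n, ℕ → Bar k R M n →ₗ[k] Bar k R M n}

namespace EquivariantModule

theorem isFDSub_barPart (hfg : ∀ n j, (D.barPart n j).FG) (n j : ℕ) :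
    IsFDSub (D.barRep n) (D.barPart n j) :=
  ⟨fun t x hx => D.barRep_mem n j t x hx, hfg n j⟩

theorem isFDSub_filt (hfg : ∀ n j, (D.barPart n j).FG) (n J : ℕ) :
    IsFDSub (D.barRep n) (D.filt n J) := by
  induction J with
  | zero =>
    rw [filt_zero]
    exact IsFDSub.bot _
  | succ J ih =>
    rw [filt_succ]
    exact ih.sup (isFDSub_barPart hfg n J)

theorem clsSub_barPart_succ (hfg : ∀ n j, (D.barPart n j).FG) (i j : ℕ) :
    clsSub (D.barRep (i + 1)) (D.barPart (i + 1) j) =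
      clsSub (D.barRep (i + 1)) (D.cycles (i + 1) j) +
        clsSub (D.barRep i) (D.boundaries i j) := by
  rw [clsSub_eq_add (isFDSub_barPart hfg (i + 1) j) (D.d_barRep i), inf_comm]
  rfl

theorem subsingleton_tor {i j : ℕ} (h : D.cycles i j ≤ D.boundaries i j) :
    Subsingleton (D.Tor i j) := by
  rw [Submodule.Quotient.subsingleton_iff, Submodule.submoduleOf,
    Submodule.comap_subtype_eq_top]
  exact h

namespace IsPerturbation

theorem filt_succ_inf_ker_proj (h : D.IsPerturbation δ π) (n J : ℕ) :
    D.filt n (J + 1) ⊓ LinearMap.ker (π n J) = D.filt n J := by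
  refine le_antisymm ?_ fun x hx => ⟨D.filt_mono n J.le_succ hx, h.proj_filt le_rfl hx⟩
  rintro x ⟨hx, hx'⟩
  rw [SetLike.mem_coe, filt_succ] at hx
  obtain ⟨y, hy, t, ht, rfl⟩ := Submodule.mem_sup.1 hx
  rw [SetLike.mem_coe, LinearMap.mem_ker, map_add, h.proj_filt le_rfl hy, zero_add,
    (h.grading n).proj J J t ht, if_pos rfl] at hx'
  rwa [hx', add_zero]

theorem map_proj_filt_succ (h : D.IsPerturbation δ π) (n J : ℕ) :
    (D.filt n (J + 1)).map (π n J) = D.barPart n J := by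
  refine le_antisymm ?_ fun x hx => ⟨x, D.barPart_le_filt J.lt_succ_self hx, ?_⟩
  · rintro _ ⟨x, -, rfl⟩
    exact (h.grading n).proj_mem J x
  · rw [(h.grading n).proj J J x hx, if_pos rfl]

theorem clsSub_filt (h : D.IsPerturbation δ π) (hfg : ∀ n j, (D.barPart n j).FG) (n J : ℕ) :
    clsSub (D.barRep n) (D.filt n J) =
      ∑ j ∈ Finset.range J, clsSub (D.barRep n) (D.barPart n j) := by
  induction J with
  | zero => rw [filt_zero, clsSub_bot, Finset.sum_range_zero]
  | succ J ih =>
    rw [clsSub_eq_add (isFDSub_filt hfg n (J + 1)) (h.proj_barRep n J),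
      h.filt_succ_inf_ker_proj, h.map_proj_filt_succ, ih, Finset.sum_range_succ]

/-- If δ x has no component in degree J, the leading term of x is a d-cycle, hence a d-boundary, and
x can be lowered into F_J without changing δ x. -/
theorem map_filt_succ_inf_ker_proj (h : D.IsPerturbation δ π) {n J : ℕ}
    (hJ : D.cycles (n + 1) J ≤ D.boundaries (n + 1) J) :
    (D.filt (n + 1) (J + 1)).map (δ n) ⊓ LinearMap.ker (π n J) =
      (D.filt (n + 1) J).map (δ n) := by
  refine le_antisymm ?_ (le_inf (Submodule.map_mono (D.filt_mono _ J.le_succ)) ?_)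
  · rintro _ ⟨⟨x, hx, rfl⟩, hx'⟩
    rw [SetLike.mem_coe, filt_succ] at hx
    obtain ⟨y, hy, t, ht, rfl⟩ := Submodule.mem_sup.1 hx
    rw [SetLike.mem_coe, LinearMap.mem_ker, h.proj_δ hy ht] at hx'
    obtain ⟨u, hu, rfl⟩ := hJ ⟨hx', ht⟩
    exact ⟨_, h.sub_δ_mem_filt hy hu, by rw [map_sub, h.δ_δ, sub_zero]⟩
  · rintro _ ⟨x, hx, rfl⟩
    exact h.proj_filt le_rfl (h.δ_mem_filt hx)

theorem map_proj_map_filt_succ (h : D.IsPerturbation δ π) (n J : ℕ) :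
    ((D.filt (n + 1) (J + 1)).map (δ n)).map (π n J) = D.boundaries n J := by
  refine le_antisymm ?_ ?_
  · rintro _ ⟨_, ⟨x, hx, rfl⟩, rfl⟩
    rw [SetLike.mem_coe, filt_succ] at hx
    obtain ⟨y, hy, t, ht, rfl⟩ := Submodule.mem_sup.1 hx
    rw [h.proj_δ hy ht]
    exact ⟨t, ht, rfl⟩
  · rintro _ ⟨t, ht, rfl⟩
    refine ⟨_, ⟨t, D.barPart_le_filt J.lt_succ_self ht, rfl⟩, ?_⟩
    rw [← zero_add t, h.proj_δ (zero_mem _) ht, zero_add]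

/-- The degree filtration on δ(F_J) has the d-boundaries as its successive quotients, provided the
graded homology one degree higher vanishes. This makes the truncation terms for d and δ equal. -/
theorem clsSub_map_filt (h : D.IsPerturbation δ π) (hfg : ∀ n j, (D.barPart n j).FG)
    (hδ : ∀ n t x, δ n (D.barRep (n + 1) t x) = D.barRep n t (δ n x)) {n : ℕ}
    (hn : ∀ j, D.cycles (n + 1) j ≤ D.boundaries (n + 1) j) (J : ℕ) :
    clsSub (D.barRep n) ((D.filt (n + 1) J).map (δ n)) =
      ∑ j ∈ Finset.range J, clsSub (D.barRep n) (D.boundaries n j) := by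
  induction J with
  | zero => rw [filt_zero, Submodule.map_bot, clsSub_bot, Finset.sum_range_zero]
  | succ J ih =>
    rw [clsSub_eq_add ((isFDSub_filt hfg (n + 1) (J + 1)).map (hδ n)) (h.proj_barRep n J),
      h.map_filt_succ_inf_ker_proj (hn J), h.map_proj_map_filt_succ, ih, Finset.sum_range_succ]

/-- The filtered piece `F_J` has the homology of the total complex, once the homology of the
homogeneous parts vanishes from `J` on. -/
theorem filt_inf_ker (h : D.IsPerturbation δ π) {n J : ℕ}
    (hJ : ∀ j, J ≤ j → D.cycles (n + 2) j ≤ D.boundaries (n + 2) j)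
    (hn : LinearMap.ker (δ n) ≤ LinearMap.range (δ (n + 1))) :
    D.filt (n + 1) J ⊓ LinearMap.ker (δ n) = (D.filt (n + 2) J).map (δ (n + 1)) := by
  refine le_antisymm (fun x hx => h.mem_map_filt_of_mem_range hJ hx.1 (hn hx.2)) ?_
  rintro _ ⟨x, hx, rfl⟩
  exact ⟨h.δ_mem_filt hx, h.δ_δ n x⟩

variable {Y : Type u} [AddCommGroup Y] [Module k Y] {σ : Representation k Θ Y}
  {ψ : Bar k R M 0 →ₗ[k] Y}

theorem map_filt_eq_top (h : D.IsPerturbation δ π) {J : ℕ}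
    (hJ : ∀ j, J ≤ j → D.cycles 0 j ≤ D.boundaries 0 j) (surj : Function.Surjective ψ)
    (hker : LinearMap.ker ψ = LinearMap.range (δ 0)) : (D.filt 0 J).map ψ = ⊤ := by
  rw [eq_top_iff]
  intro y _
  obtain ⟨x, rfl⟩ := surj y
  obtain ⟨u, hu⟩ := h.exists_sub_mem_filt hJ x
  refine ⟨_, hu, ?_⟩
  have : δ 0 u ∈ LinearMap.ker ψ := hker ▸ ⟨u, rfl⟩
  rw [map_sub, LinearMap.mem_ker.1 this, sub_zero]

/-- The differentials d and δ act on the same spaces F_J, so `alternating_sum_sub` computes the same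
sum of chain classes twice. The truncation terms at p agree by `clsSub_map_filt`. For δ all summands
in positive degree vanish by exactness, and degree zero contributes the class of Y. -/
theorem alternating_sum_eq_cls (h : D.IsPerturbation δ π) (hfg : ∀ n j, (D.barPart n j).FG)
    (hδ : ∀ n t x, δ n (D.barRep (n + 1) t x) = D.barRep n t (δ n x)) {p J : ℕ}
    (hp : ∀ j, D.cycles (p + 1) j ≤ D.boundaries (p + 1) j)
    (hJ : ∀ i j, J ≤ j → D.cycles i j ≤ D.boundaries i j)
    (hex : ∀ n, LinearMap.ker (δ n) ≤ LinearMap.range (δ (n + 1)))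
    (hψ : ∀ t x, ψ (D.barRep 0 t x) = σ t (ψ x)) (surj : Function.Surjective ψ)
    (hker : LinearMap.ker ψ = LinearMap.range (δ 0)) (hY : FiniteDimensional k Y) :
    ∑ i ∈ Finset.range (p + 1), (-1 : ℤ) ^ i • ∑ j ∈ Finset.range J,
      (clsSub (D.barRep i) (D.cycles i j) - clsSub (D.barRep i) (D.boundaries i j)) =
        Groth.cls σ hY := by
  let z : ℕ → Groth k Θ := fun i => ∑ j ∈ Finset.range J, clsSub (D.barRep i) (D.cycles i j)
  let b : ℕ → Groth k Θ := fun i => ∑ j ∈ Finset.range J, clsSub (D.barRep i) (D.boundaries i j)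
  let c : ℕ → Groth k Θ := fun i => clsSub (D.barRep i) (D.filt i J)
  let B : ℕ → Groth k Θ := fun i => clsSub (D.barRep i) ((D.filt (i + 1) J).map (δ i))
  -- Classes of δ-cycles in F_J: everything in degree zero, and by exactness the boundaries in
  -- positive degrees.
  let Z : ℕ → Groth k Θ := fun i => if i = 0 then c 0 else B i
  have h1 := alternating_sum_sub (z := z) (b := b) (c := c) (h.clsSub_filt hfg 0 J)
    (fun i => by
      simp only [c, z, b, h.clsSub_filt hfg, ← Finset.sum_add_distrib, clsSub_barPart_succ hfg]) p
  have h2 := alternating_sum_sub (z := Z) (b := B) (c := c) rfl (fun i => by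
    simp only [Z, c, B, if_neg i.succ_ne_zero]
    rw [clsSub_eq_add (isFDSub_filt hfg (i + 1) J) (hδ i),
      h.filt_inf_ker (hJ (i + 2)) (hex i)]) p
  have h3 : B p = b p := h.clsSub_map_filt hfg hδ hp J
  have h4 : ∑ i ∈ Finset.range (p + 1), (-1 : ℤ) ^ i • (Z i - B i) = c 0 - B 0 := by
    rw [Finset.sum_eq_single_of_mem 0 (by simp)]
    · simp [Z]
    · intro i _ hi
      simp [Z, hi]
  have h5 : D.filt 0 J ⊓ LinearMap.ker ψ = (D.filt 1 J).map (δ 0) := by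
    refine le_antisymm (fun x hx => h.mem_map_filt_of_mem_range (hJ 1) hx.1 (hker ▸ hx.2)) ?_
    rintro _ ⟨x, hx, rfl⟩
    exact ⟨h.δ_mem_filt hx, hker ▸ ⟨x, rfl⟩⟩
  simp only [Finset.sum_sub_distrib]
  rw [Groth.cls_of_surjective (isFDSub_filt hfg 0 J) hψ (h.map_filt_eq_top (hJ 0) surj hker) hY, h5]
  exact h1.trans ((h3 ▸ h2.symm).trans h4)

/-- If the homology of the complex is finite-dimensional and vanishes in high homological
degrees, then it vanishes in high internal degrees. -/
theorem exists_forall_cycles_le (h : D.IsPerturbation δ π) {p : ℕ}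
    (hp : ∀ i, p < i → ∀ j, D.cycles i j ≤ D.boundaries i j)
    {Z : ∀ i, Submodule k (Bar k R M i)} (hZ : ∀ i j, D.cycles i j ≤ Z i)
    (hW : ∀ i, ∃ W : Submodule k (Bar k R M i), W.FG ∧ Z i ≤ W ⊔ LinearMap.range (D.d i)) :
    ∃ J, ∀ i j, J ≤ j → D.cycles i j ≤ D.boundaries i j := by
  choose W hWfg hW using hW
  choose J hJ using fun i => h.exists_cycles_le (hZ i) (hWfg i) (hW i)
  refine ⟨(Finset.range (p + 1)).sup J, fun i j hj => ?_⟩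
  by_cases hi : p < i
  · exact hp i hi j
  · exact hJ i j ((Finset.le_sup (f := J) (Finset.mem_range.2 (by omega))).trans hj)

/-- The Euler characteristic of `Tor` can be computed from a perturbation of the bar complex
whose homology is concentrated in degree zero. -/
theorem finsum_cls_torRep (h : D.IsPerturbation δ π) (hfg : ∀ n j, (D.barPart n j).FG)
    (hδ : ∀ n t x, δ n (D.barRep (n + 1) t x) = D.barRep n t (δ n x)) {p : ℕ}
    (hp : ∀ i, p < i → ∀ j, D.cycles i j ≤ D.boundaries i j)
    {Z : ∀ i, Submodule k (Bar k R M i)} (hZ : ∀ i j, D.cycles i j ≤ Z i)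
    (hW : ∀ i, ∃ W : Submodule k (Bar k R M i), W.FG ∧ Z i ≤ W ⊔ LinearMap.range (D.d i))
    (hex : ∀ n, LinearMap.ker (δ n) ≤ LinearMap.range (δ (n + 1)))
    (hψ : ∀ t x, ψ (D.barRep 0 t x) = σ t (ψ x)) (surj : Function.Surjective ψ)
    (hker : LinearMap.ker ψ = LinearMap.range (δ 0)) :
    {p : ℕ × ℕ | Nontrivial (D.Tor p.1 p.2)}.Finite ∧
    ∃ (hT : ∀ i j, FiniteDimensional k (D.Tor i j)) (hY : FiniteDimensional k Y),
      ∑ᶠ i : ℕ, (-1 : ℤ) ^ i • ∑ᶠ j : ℕ, Groth.cls (D.torRep i j) (hT i j) = Groth.cls σ hY := by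
  obtain ⟨J, hJ⟩ := h.exists_forall_cycles_le hp hZ hW
  have hcfg : ∀ i j, (D.cycles i j).FG := fun i j =>
    Submodule.FG.of_le (hfg i j) (D.cycles_le_barPart i j)
  have hT : ∀ i j, FiniteDimensional k (D.Tor i j) := fun i j =>
    have : Module.Finite k (D.cycles i j) := Module.Finite.iff_fg.2 (hcfg i j)
    inferInstance
  -- Y is already the image of the finite-dimensional F_J in homological degree zero.
  have hY : FiniteDimensional k Y :=
    ⟨h.map_filt_eq_top (hJ 0) surj hker ▸ (isFDSub_filt hfg 0 J).fg.map ψ⟩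
  refine ⟨?_, hT, hY, ?_⟩
  · refine ((Set.finite_Iic p).prod (Set.finite_Iio J)).subset ?_
    rintro ⟨i, j⟩ hij
    by_contra hnot
    have : D.cycles i j ≤ D.boundaries i j := by
      by_cases hi : p < i
      · exact hp i hi j
      · exact hJ i j (by by_contra hj; exact hnot ⟨not_lt.1 hi, not_le.1 hj⟩)
    exact not_subsingleton_iff_nontrivial.2 hij (subsingleton_tor this)
  · have hcls : ∀ i j, Groth.cls (D.torRep i j) (hT i j) =
        clsSub (D.barRep i) (D.cycles i j) - clsSub (D.barRep i) (D.boundaries i j) :=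
      fun i j => cls_torRep D (h.boundaries_le_cycles i j) (hcfg i j) (hT i j)
    have hzero : ∀ i j, D.cycles i j ≤ D.boundaries i j →
        clsSub (D.barRep i) (D.cycles i j) - clsSub (D.barRep i) (D.boundaries i j) = 0 :=
      fun i j hij => by rw [le_antisymm hij (h.boundaries_le_cycles i j), sub_self]
    have hinner : ∀ i, ∑ᶠ j, Groth.cls (D.torRep i j) (hT i j) = ∑ j ∈ Finset.range J,
        (clsSub (D.barRep i) (D.cycles i j) - clsSub (D.barRep i) (D.boundaries i j)) := by
      intro i
      simp only [hcls]
      refine finsum_eq_sum_of_support_subset _ fun j hj => ?_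
      by_contra hnot
      rw [Finset.coe_range, Set.mem_Iio, not_lt] at hnot
      exact hj (hzero i j (hJ i j hnot))
    simp only [hinner]
    rw [← h.alternating_sum_eq_cls hfg hδ (hp (p + 1) p.lt_succ_self) hJ hex hψ surj hker hY]
    refine finsum_eq_sum_of_support_subset _ fun i hi => ?_
    by_contra hnot
    rw [Finset.coe_range, Set.mem_Iio, not_lt] at hnot
    refine hi ?_
    simp only [Finset.sum_eq_zero fun j _ => hzero i j (hp i hnot j), smul_zero]

end IsPerturbation

end EquivariantModule

end EulerCharacteristic

/-! ### Perturbing the augmentation -/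

section Augmentation

variable {k R M Θ : Type*} [Field k] [CommRing R] [Algebra k R] [AddCommGroup M] [Module k M]
  [Group Θ] (D : EquivariantModule k R M Θ)

namespace EquivariantModule

theorem zeroEquiv_barRep (t : Θ) (x : Bar k R M 0) :
    Bar.zeroEquiv k R M (D.barRep 0 t x) = D.actM t (Bar.zeroEquiv k R M x) := by
  obtain ⟨m, rfl⟩ := Bar.mk_zero_surjective x
  rw [barRep_mk, Bar.zeroEquiv_mk, Bar.zeroEquiv_mk]

variable [Module R M] [IsScalarTower k R M]

/-- Replacing the augmentation by another invariant one gives again an `EquivariantModule`, and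
`augBd` for ε is its differential. -/
theorem augBd_barRep (hact : ∀ r m, D.act r m = r • m) {ε : R →ₐ[k] k}
    (hε : ∀ t r, ε (D.actR t r) = ε r) (n : ℕ) (t : Θ) (x : Bar k R M (n + 1)) :
    Bar.augBd M ε n (D.barRep (n + 1) t x) = D.barRep n t (Bar.augBd M ε n x) := by
  have h := EquivariantModule.d_barRep { D with aug := ε, aug_actR := hε } n t x
  rwa [d_eq_augBd { D with aug := ε, aug_actR := hε } hact] at h

theorem isPerturbation_augBd (hact : ∀ r m, D.act r m = r • m) {πR : ℕ → R →ₗ[k] R}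
    {πM : ℕ → M →ₗ[k] M} (hR : IsGrading D.partR πR) (hM : IsGrading D.partM πM)
    (hmul : ∀ a b, ∀ r ∈ D.partR a, ∀ s ∈ D.partR b, r * s ∈ D.partR (a + b))
    (hsmul : ∀ a b, ∀ r ∈ D.partR a, ∀ m ∈ D.partM b, r • m ∈ D.partM (a + b))
    (haug : ∀ a, a ≠ 0 → ∀ r ∈ D.partR a, D.aug r = 0) {ε : R →ₐ[k] k}
    (hε : ∀ r ∈ D.partR 0, ε r = D.aug r) :
    D.IsPerturbation (Bar.augBd M ε) (Bar.proj πR πM) where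
  grading := D.isGrading_barPart hR hM
  d_mem n j x hx := by
    rw [d_eq_augBd D hact]
    exact D.augBd_mem_barPart hmul hsmul haug n j x hx
  sub_mem n j x hx := by
    rw [d_eq_augBd D hact]
    exact D.augBd_sub_augBd_mem_filt hε n j x hx
  d_d n x := by
    rw [d_eq_augBd D hact, d_eq_augBd D hact]
    exact Bar.augBd_augBd _ n x
  δ_δ := Bar.augBd_augBd ε

end EquivariantModule

end Augmentation

/-! ### The Euler characteristic under a regular sequence hypothesis -/

section RegularSeq

variable {k : Type u} [Field k] {R M : Type u} [CommRing R] [Algebra k R] [AddCommGroup M]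
  [Module k M] {Θ : Type*} [Group Θ] [Module R M] [IsScalarTower k R M]
  {D : EquivariantModule k R M Θ} {π : ∀ n, ℕ → Bar k R M n →ₗ[k] Bar k R M n}
  {Y : Type u} [AddCommGroup Y] [Module k Y] {σ : Representation k Θ Y} {ψ : Bar k R M 0 →ₗ[k] Y}

/-- The Euler characteristic of `Tor` over an algebra whose augmentation ideal is generated by a
regular sequence, computed at another augmentation. -/
theorem EquivariantModule.finsum_cls_torRep_of_isRegularSeq [IsNoetherianRing R] [Module.Finite R M]
    (hact : ∀ r m, D.act r m = r • m) {n : ℕ} {z : Fin n → R} (hz : IsRegularSeq z)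
    (hzε : prefixIdeal z n = RingHom.ker D.aug) {ε : R →ₐ[k] k}
    (h : D.IsPerturbation (Bar.augBd M ε) π) (hfg : ∀ n j, (D.barPart n j).FG)
    (hε : ∀ t r, ε (D.actR t r) = ε r)
    (hex : ∀ n, LinearMap.ker (Bar.augBd M ε n) ≤ LinearMap.range (Bar.augBd M ε (n + 1)))
    (hψ : ∀ t x, ψ (D.barRep 0 t x) = σ t (ψ x)) (surj : Function.Surjective ψ)
    (hker : LinearMap.ker ψ = LinearMap.range (Bar.augBd M ε 0)) :
    {p : ℕ × ℕ | Nontrivial (D.Tor p.1 p.2)}.Finite ∧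
    ∃ (hT : ∀ i j, FiniteDimensional k (D.Tor i j)) (hY : FiniteDimensional k Y),
      ∑ᶠ i : ℕ, (-1 : ℤ) ^ i • ∑ᶠ j : ℕ, Groth.cls (D.torRep i j) (hT i j) = Groth.cls σ hY := by
  have hd : ∀ i, D.d i = Bar.augBd M D.aug i := D.d_eq_augBd hact
  refine h.finsum_cls_torRep (p := n) (Z := Bar.augCycles M D.aug) hfg
    (D.augBd_barRep hact hε) ?_ ?_ ?_ hex hψ surj hker
  · intro i hi j
    obtain ⟨m, rfl⟩ := Nat.exists_eq_succ_of_ne_zero (Nat.ne_zero_of_lt hi)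
    refine h.cycles_le_of_ker_le ?_ j
    rw [hd, hd]
    -- Index m refers to homological degree i = m + 1, so i > n becomes n ≤ m.
    exact Bar.ker_augBd_le D.aug hz hzε m (Nat.lt_succ_iff.1 hi)
  · intro i j x hx
    cases i with
    | zero => trivial
    | succ i =>
      have := hx.1
      rwa [hd] at this
  · intro i
    rw [hd]
    exact Bar.augCycles_le_finite D.aug hz hzε i

end RegularSeq

/-! ### Restricting gradings -/

section Restrict

variable {k : Type*} [Field k] {W : Type*} [AddCommGroup W] [Module k W] {part : ℕ → Submodule k W}
  {π : ℕ → W →ₗ[k] W}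

namespace IsGrading

/-- Every larger cutoff is allowed as well, so that two elements can share one in the additive step.
-/
theorem exists_eq_sum (h : IsGrading part π) (x : W) :
    ∃ N, ∀ n, N ≤ n → x = ∑ j ∈ Finset.range n, π j x := by
  have hx : x ∈ ⨆ j, part j := by rw [h.iSup_eq]; trivial
  induction hx using Submodule.iSup_induction' with
  | mem j x hx =>
    refine ⟨j + 1, fun n hn => ?_⟩
    simp only [h.proj _ j x hx, Finset.sum_ite_eq', Finset.mem_range]
    rw [if_pos (by omega)]
  | zero => exact ⟨0, fun n _ => by simp⟩
  | add x y _ _ hx hy =>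
    obtain ⟨N, hN⟩ := hx
    obtain ⟨N', hN'⟩ := hy
    refine ⟨max N N', fun n hn => ?_⟩
    simp only [map_add, Finset.sum_add_distrib]
    rw [← hN n ((le_max_left _ _).trans hn), ← hN' n ((le_max_right _ _).trans hn)]

theorem restrict (h : IsGrading part π) {P : Submodule k W} (hP : ∀ j, ∀ x ∈ P, π j x ∈ P) :
    IsGrading (fun j => (part j).comap P.subtype) (fun j => (π j).restrict (hP j)) where
  proj i j x hx := by
    refine Subtype.ext ?_
    change π i x = _
    rw [h.proj i j x hx]
    split_ifs <;> rfl
  iSup_eq := by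
    rw [eq_top_iff]
    intro x _
    obtain ⟨N, hN⟩ := h.exists_eq_sum (x : W)
    have : x = ∑ j ∈ Finset.range N, (π j).restrict (hP j) x :=
      Subtype.ext (by rw [AddSubmonoidClass.coe_finsetSum]; exact hN N le_rfl)
    rw [this]
    exact sum_mem fun j _ => Submodule.mem_iSup_of_mem j (h.proj_mem j _)

end IsGrading

theorem fg_comap_of_injective {W' : Type*} [AddCommGroup W'] [Module k W'] {f : W' →ₗ[k] W}
    (hf : Function.Injective f) {P : Submodule k W} (hP : P.FG) : (P.comap f).FG :=
  Submodule.fg_of_fg_map_injective f hf (Submodule.FG.of_le hP (Submodule.map_comap_le _ _))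

end Restrict

/-! ### The grading of `k[V]` -/

section PolyGrading

variable {k : Type*} [Field k] {V : Type*} [AddCommGroup V] [Module k V]

variable (k V) in
/-- The algebra homomorphism sending a homogeneous polynomial `f` of degree `d` to `f tᵈ`. -/
def spread : Poly k V →ₐ[k] Polynomial (Poly k V) :=
  SymmetricAlgebra.lift
    ((Polynomial.monomial 1).restrictScalars k ∘ₗ SymmetricAlgebra.ι k (Module.Dual k V))

theorem spread_of_mem (d : ℕ) (f : Poly k V) (hf : f ∈ homogeneousPart k V d) :
    spread k V f = Polynomial.monomial d f := by
  induction d generalizing f with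
  | zero =>
    rw [homogeneousPart, pow_zero] at hf
    obtain ⟨c, rfl⟩ := Submodule.mem_one.1 hf
    rw [AlgHom.commutes]
    rfl
  | succ d ih =>
    rw [homogeneousPart, pow_succ] at hf
    refine Submodule.mul_induction_on hf (fun f hf g hg => ?_)
      fun f g hf hg => by rw [map_add, map_add, hf, hg]
    obtain ⟨l, rfl⟩ := hg
    rw [map_mul, ih f hf, spread, SymmetricAlgebra.lift_ι_apply]
    exact Polynomial.monomial_mul_monomial _ _ _ _

variable (k V) in
/-- The homogeneous component of degree `j`. -/
def homComp (j : ℕ) : Poly k V →ₗ[k] Poly k V :=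
  (Polynomial.lcoeff (Poly k V) j).restrictScalars k ∘ₗ (spread k V).toLinearMap

theorem homogeneousPart_mul_mem {a b : ℕ} {f g : Poly k V} (hf : f ∈ homogeneousPart k V a)
    (hg : g ∈ homogeneousPart k V b) : f * g ∈ homogeneousPart k V (a + b) := by
  rw [homogeneousPart, pow_add]
  exact Submodule.mul_mem_mul hf hg

theorem iSup_homogeneousPart : ⨆ j, homogeneousPart k V j = ⊤ := by
  rw [eq_top_iff]
  intro f _
  induction f using SymmetricAlgebra.induction with
  | algebraMap c =>
    refine Submodule.mem_iSup_of_mem 0 ?_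
    rw [homogeneousPart, pow_zero]
    exact Submodule.mem_one.2 ⟨c, rfl⟩
  | ι l =>
    refine Submodule.mem_iSup_of_mem 1 ?_
    rw [homogeneousPart, pow_one]
    exact ⟨l, rfl⟩
  | mul f g hf hg =>
    have h := Submodule.mul_mem_mul (hf trivial) (hg trivial)
    rw [Submodule.iSup_mul] at h
    refine (iSup_le fun a => ?_ : _ ≤ ⨆ j, homogeneousPart k V j) h
    rw [Submodule.mul_iSup]
    exact iSup_le fun b => Submodule.mul_le.2 fun f hf g hg =>
      Submodule.mem_iSup_of_mem (a + b) (homogeneousPart_mul_mem hf hg)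
  | add f g hf hg => exact add_mem (hf trivial) (hg trivial)

theorem isGrading_homogeneousPart : IsGrading (homogeneousPart k V) (homComp k V) where
  proj i j f hf := by
    change (spread k V f).coeff i = _
    rw [spread_of_mem j f hf, Polynomial.coeff_monomial]
    exact if_congr eq_comm rfl rfl
  iSup_eq := iSup_homogeneousPart

theorem fg_homogeneousPart [FiniteDimensional k V] (j : ℕ) : (homogeneousPart k V j).FG :=
  Submodule.FG.pow (Module.Finite.iff_fg.1 inferInstance) j

theorem evalAt_zero_of_mem {a : ℕ} (ha : a ≠ 0) {f : Poly k V} (hf : f ∈ homogeneousPart k V a) :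
    evalAt 0 f = 0 := by
  obtain ⟨d, rfl⟩ := Nat.exists_eq_succ_of_ne_zero ha
  rw [homogeneousPart, pow_succ] at hf
  refine Submodule.mul_induction_on hf (fun f hf g hg => ?_)
    fun f g hf hg => by rw [map_add, hf, hg, add_zero]
  obtain ⟨l, rfl⟩ := hg
  rw [map_mul, evalAt, SymmetricAlgebra.lift_ι_apply, Module.Dual.eval_apply, map_zero l, mul_zero]

theorem evalAt_eq_of_mem_zero (v w : V) {f : Poly k V} (hf : f ∈ homogeneousPart k V 0) :
    evalAt v f = evalAt w f := by
  rw [homogeneousPart, pow_zero] at hf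
  obtain ⟨c, rfl⟩ := Submodule.mem_one.1 hf
  rw [AlgHom.commutes, AlgHom.commutes]

theorem homComp_polyAct {H : Type*} [Group H] (ρ : Representation k H V) (h : H) (j : ℕ)
    (f : Poly k V) : homComp k V j (polyAct ρ h f) = polyAct ρ h (homComp k V j f) := by
  suffices homComp k V j ∘ₗ polyRep ρ h = polyRep ρ h ∘ₗ homComp k V j from
    DFunLike.congr_fun this f
  refine isGrading_homogeneousPart.hom_ext fun i f hf => ?_
  rw [LinearMap.comp_apply, LinearMap.comp_apply,
    isGrading_homogeneousPart.proj j i _ (polyAct_homogeneous ρ h i hf),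
    isGrading_homogeneousPart.proj j i f hf]
  split_ifs <;> simp

/-- An algebra generated by homogeneous polynomials contains the homogeneous components of its
elements. -/
theorem homComp_mem_adjoin {ι : Type*} {f : ι → Poly k V}
    (hf : ∀ i, ∃ d, f i ∈ homogeneousPart k V d) (j : ℕ) {g : Poly k V}
    (hg : g ∈ Algebra.adjoin k (Set.range f)) :
    homComp k V j g ∈ Algebra.adjoin k (Set.range f) := by
  -- The polynomials with coefficients in the subalgebra form a subring and `spread` is
  -- multiplicative, so only the homogeneous generators have to be checked.
  suffices spread k V g ∈
      Polynomial.lifts (algebraMap (Algebra.adjoin k (Set.range f)) (Poly k V)) by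
    obtain ⟨r, hr⟩ := (Polynomial.lifts_iff_coeff_lifts _).1 this j
    change (spread k V g).coeff j ∈ _
    rw [← hr]
    exact r.2
  induction hg using Algebra.adjoin_induction with
  | mem g hg =>
    obtain ⟨i, rfl⟩ := hg
    obtain ⟨d, hd⟩ := hf i
    rw [spread_of_mem d _ hd]
    exact Polynomial.monomial_mem_lifts d ⟨⟨f i, Algebra.subset_adjoin ⟨i, rfl⟩⟩, rfl⟩
  | algebraMap c =>
    rw [AlgHom.commutes]
    exact Polynomial.C'_mem_lifts ⟨algebraMap k _ c, rfl⟩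
  | add g g' _ _ hg hg' => rw [map_add]; exact add_mem hg hg'
  | mul g g' _ _ hg hg' => rw [map_mul]; exact mul_mem hg hg'

theorem IsNoetherNormalization.homComp_mem {R B : Subalgebra k (Poly k V)}
    (hR : IsNoetherNormalization R B) (j : ℕ) {f : Poly k V} (hf : f ∈ R) : homComp k V j f ∈ R := by
  obtain ⟨n, g, -, hg, rfl⟩ := hR.polynomial
  exact homComp_mem_adjoin hg j hf

/-! ### The grading of the relative invariants -/

variable {U : Type*} [AddCommGroup U] [Module k U]

theorem isGrading_tensorPart :
    IsGrading (tensorPart (k := k) (V := V) (U := U)) (fun j => (homComp k V j).lTensor U) where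
  proj i j x hx := by
    obtain ⟨y, rfl⟩ := hx
    induction y with
    | zero => simp
    | add y y' hy hy' => rw [map_add, map_add, hy, hy']; split_ifs <;> simp
    | tmul u p =>
      have h := isGrading_homogeneousPart.proj i j (p : Poly k V) p.2
      rw [LinearMap.lTensor_tmul, LinearMap.lTensor_tmul, Submodule.coe_subtype, h]
      split_ifs <;> simp
  iSup_eq := by
    rw [eq_top_iff]
    intro x _
    suffices (⨆ j, tensorPart (k := k) (V := V) (U := U) j).mkQ = 0 from
      (Submodule.Quotient.mk_eq_zero _).1 (DFunLike.congr_fun this x)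
    refine TensorProduct.ext (LinearMap.ext fun u => ?_)
    refine isGrading_homogeneousPart.hom_ext fun j f hf => (Submodule.Quotient.mk_eq_zero _).2 ?_
    exact Submodule.mem_iSup_of_mem j ⟨u ⊗ₜ ⟨f, hf⟩, rfl⟩

theorem fg_tensorPart [FiniteDimensional k V] [FiniteDimensional k U] (j : ℕ) :
    (tensorPart (k := k) (V := V) (U := U) j).FG := by
  have : Module.Finite k (homogeneousPart k V j) := Module.Finite.iff_fg.2 (fg_homogeneousPart j)
  rw [tensorPart, ← Module.Finite.iff_fg]
  exact Module.Finite.range _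

theorem mulPoly_mem_tensorPart {a b : ℕ} {f : Poly k V} (hf : f ∈ homogeneousPart k V a)
    {x : U ⊗[k] Poly k V} (hx : x ∈ tensorPart b) : mulPoly f x ∈ tensorPart (a + b) := by
  obtain ⟨y, rfl⟩ := hx
  induction y with
  | zero => simp
  | add y y' hy hy' => rw [map_add, map_add]; exact add_mem hy hy'
  | tmul u p => exact ⟨u ⊗ₜ ⟨f * p, homogeneousPart_mul_mem hf p.2⟩, rfl⟩

theorem lTensor_homComp_mem {G : Type*} [Group G] (ρG : Representation k G V)
    (τG : Representation k G U) (j : ℕ) {x : U ⊗[k] Poly k V} (hx : x ∈ relativeInvariants ρG τG) :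
    (homComp k V j).lTensor U x ∈ relativeInvariants ρG τG := by
  intro g
  have : ∀ x : U ⊗[k] Poly k V, (τG.tprod (polyRep ρG)) g ((homComp k V j).lTensor U x) =
      (homComp k V j).lTensor U ((τG.tprod (polyRep ρG)) g x) := by
    intro x
    induction x with
    | zero => simp
    | add x y hx hy => simp only [map_add, hx, hy]
    | tmul u p =>
      simp only [LinearMap.lTensor_tmul, Representation.tprod_apply, TensorProduct.map_tmul,
        polyRep_apply, homComp_polyAct]
  rw [this, hx g]

/-- The point v, viewed over the algebraic closure, lies in its own fiber, and so do its translates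
under C. This invariance of evaluation at v on R makes δ equivariant. -/
theorem evalAt_polyAct_of_fiber {C : Type*} [Group C] {ρ : Representation k C V}
    {R : Subalgebra k (Poly k V)} {v : V} (hv : ∀ c, ∀ w ∈ fiber R v, pointAct ρ c w ∈ fiber R v)
    (c : C) {f : Poly k V} (hf : f ∈ R) : evalAt v (polyAct ρ c f) = evalAt v f := by
  have := hv c⁻¹ ((Algebra.ofId k (AlgebraicClosure k)).comp (evalAt v)) (fun _ _ => rfl) f hf
  rw [pointAct, inv_inv] at this
  exact (algebraMap k (AlgebraicClosure k)).injective this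

theorem outerTensor_restrictFiber {Γ C : Type*} [Group Γ] [Group C] (τΓ : Representation k Γ U)
    (ρC : Representation k C V) {R : Subalgebra k (Poly k V)} {v : V}
    (h : ∀ a, fiberIdeal R v ≤ (fiberIdeal R v).comap (polyAct ρC a)) (t : Γ × C)
    (x : U ⊗[k] Poly k V) : restrictFiber U R v (outerTensor τΓ (polyRep ρC) t x) =
      outerTensor τΓ (fiberRep ρC h) t (restrictFiber U R v x) := by
  induction x with
  | zero => simp
  | add x y hx hy => simp only [map_add, hx, hy]
  | tmul u p => rfl

end PolyGrading

/-! ### Homogeneous parts and augmentations of the relative invariants -/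

section RelativeInvariantsModule

set_option synthInstance.maxHeartbeats 200000

variable {k : Type*} [Field k] {V U : Type*} [AddCommGroup V] [Module k V] [AddCommGroup U]
  [Module k U] {G Γ C : Type*} [Group G] [Group Γ] [Group C]
  {ρG : Representation k G V} {ρC : Representation k C V} {hV : ∀ g c, Commute (ρG g) (ρC c)}
  {τΓ : Representation k Γ U} {τG : Representation k G U}
  {hU : ∀ γ g, Commute (τΓ γ) (τG g)} {R : Subalgebra k (Poly k V)}
  [hR : Fact (R ≤ invariantAlgebra ρG)] {hRC : ∀ c, ∀ f ∈ R, polyAct ρC c f ∈ R} {v : V}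

attribute [local instance] relativeModule isScalarTower_relative

local notation "D" => relativeInvariantsModule ρG ρC hV τΓ τG hU R hR.out hRC

theorem isGrading_partR (h : ∀ j, ∀ f ∈ R, homComp k V j f ∈ R) :
    IsGrading (EquivariantModule.partR D) (fun j => (homComp k V j).restrict (p := R.toSubmodule)
      (q := R.toSubmodule) (h j)) :=
  isGrading_homogeneousPart.restrict (P := R.toSubmodule) h

theorem isGrading_partM : IsGrading (EquivariantModule.partM D)
    (fun j => ((homComp k V j).lTensor U).restrict fun _ hx => lTensor_homComp_mem ρG τG j hx) :=
  isGrading_tensorPart.restrict fun j _ hx => lTensor_homComp_mem ρG τG j hx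

theorem fg_barPart_relative [FiniteDimensional k V] [FiniteDimensional k U] (n j : ℕ) :
    (EquivariantModule.barPart D n j).FG :=
  EquivariantModule.fg_barPart _
    (fun a => fg_comap_of_injective Subtype.val_injective (fg_homogeneousPart a))
    (fun b => fg_comap_of_injective Subtype.val_injective (fg_tensorPart b)) n j

/-- Evaluation at 0 kills positive degrees, so d is homogeneous; evaluations at 0 and at v agree on
constants, so δ differs from d only in lower terms. -/
theorem isPerturbation_relative (h : ∀ j, ∀ f ∈ R, homComp k V j f ∈ R) (v : V) :
    ∃ π, EquivariantModule.IsPerturbation D (Bar.augBd (relativeInvariants ρG τG) (augAt R v)) π :=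
  ⟨_, EquivariantModule.isPerturbation_augBd D (fun _ _ => rfl) (isGrading_partR h)
    isGrading_partM (fun _ _ _ hr _ hs => homogeneousPart_mul_mem hr hs)
    (fun _ _ _ hr _ hm => mulPoly_mem_tensorPart hr hm) (fun _ ha _ hr => evalAt_zero_of_mem ha hr)
    (fun _ hr => evalAt_eq_of_mem_zero v 0 hr)⟩

theorem restrictRelative_actM (hstable : ∀ c, ∀ w ∈ fiber R v, pointAct ρC c w ∈ fiber R v)
    (t : Γ × C) (m : relativeInvariants ρG τG) :
    restrictRelative ρG τG R v (EquivariantModule.actM D t m) =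
      fiberInvariantsRep ρG ρC hV τΓ τG hU R hR.out hRC v hstable t
        (restrictRelative ρG τG R v m) :=
  Subtype.ext (outerTensor_restrictFiber τΓ ρC (fiberIdeal_stable_of_fiber hRC hstable) t m)

theorem restrictBar_barRep (hstable : ∀ c, ∀ w ∈ fiber R v, pointAct ρC c w ∈ fiber R v)
    (t : Γ × C) (x : Bar k R (relativeInvariants ρG τG) 0) :
    restrictBar ρG τG R v (EquivariantModule.barRep D 0 t x) =
      fiberInvariantsRep ρG ρC hV τΓ τG hU R hR.out hRC v hstable t (restrictBar ρG τG R v x) :=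
  (congrArg (restrictRelative ρG τG R v) (EquivariantModule.zeroEquiv_barRep D t x)).trans
    (restrictRelative_actM hstable t _)

end RelativeInvariantsModule

/-! ### The main theorem -/

section Main

set_option synthInstance.maxHeartbeats 200000

attribute [local instance] relativeModule isScalarTower_relative

set_option maxHeartbeats 1000000 in
theorem finsum_cls_tor_relative {k V U : Type u} [Field k]
    [AddCommGroup V] [Module k V] [FiniteDimensional k V]
    [AddCommGroup U] [Module k U] [FiniteDimensional k U]
    {G Γ C : Type*} [Group G] [Group Γ] [Group C] [Finite G]
    (ρG : Representation k G V) (ρC : Representation k C V)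
    (hV : ∀ g c, Commute (ρG g) (ρC c))
    (τΓ : Representation k Γ U) (τG : Representation k G U)
    (hU : ∀ γ g, Commute (τΓ γ) (τG g))
    (R : Subalgebra k (Poly k V)) (hR : IsNoetherNormalization R (invariantAlgebra ρG))
    (hRC : ∀ c, ∀ f ∈ R, polyAct ρC c f ∈ R)
    (v : V) (hfree : ∀ g, ∀ w ∈ fiber R v, pointAct ρG g w = w → g = 1)
    (hstable : ∀ c, ∀ w ∈ fiber R v, pointAct ρC c w ∈ fiber R v) :
    {p : ℕ × ℕ | Nontrivial ((relativeInvariantsModule ρG ρC hV τΓ τG hU R hR.le hRC).Tor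
      p.1 p.2)}.Finite ∧
    ∃ (hT : ∀ i j, FiniteDimensional k
          ((relativeInvariantsModule ρG ρC hV τΓ τG hU R hR.le hRC).Tor i j))
      (hA : FiniteDimensional k (fiberInvariants ρG τG R hR.le v)),
      ∑ᶠ i : ℕ, (-1 : ℤ) ^ i • ∑ᶠ j : ℕ,
          Groth.cls ((relativeInvariantsModule ρG ρC hV τΓ τG hU R hR.le hRC).torRep i j) (hT i j) =
        Groth.cls (fiberInvariantsRep ρG ρC hV τΓ τG hU R hR.le hRC v hstable) hA := by
  let _ := Fintype.ofFinite G
  have : Fact (R ≤ invariantAlgebra ρG) := ⟨hR.le⟩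
  have : IsNoetherianRing R := hR.isNoetherianRing
  have : Module.Finite R (Poly k V) := hR.finite_poly
  have : Module.Finite R (relativeInvariants ρG τG) := finite_relative ρG τG
  obtain ⟨s, hs⟩ := exists_one_sub_trace_mem ρG hR.le v hfree
  obtain ⟨n, -, hz⟩ := hR.exists_isRegularSeq
  -- The regular sequence here is the one at the origin, which controls the graded Tor; the element
  -- `s` and the exactness of δ belong to v.
  obtain ⟨z, hz, hzε⟩ := hz (augAt R 0)
  obtain ⟨π, h⟩ := isPerturbation_relative (ρG := ρG) (ρC := ρC) (hV := hV) (τΓ := τΓ) (τG := τG)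
    (hU := hU) (hRC := hRC) (fun j f hf => hR.homComp_mem j hf) v
  exact EquivariantModule.finsum_cls_torRep_of_isRegularSeq (fun _ _ => rfl) hz hzε h
    fg_barPart_relative (fun t r => evalAt_polyAct_of_fiber hstable t.2 r.2)
    (fun m => ker_augBd_relative_le ρG τG hs m (hR.ker_augBd_poly_le _ m))
    (restrictBar_barRep hstable) (restrictBar_surjective ρG τG hs) (ker_restrictBar ρG τG hs)

end Main

end RelInv

end

theorem mainTheorem2 {k V U : Type u} [Field k]
    [AddCommGroup V] [Module k V] [FiniteDimensional k V]
    [AddCommGroup U] [Module k U] [FiniteDimensional k U]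
    {G Γ C : Type*} [Group G] [Group Γ] [Group C] [Finite G] [Finite Γ] [Finite C]
    (ρG : Representation k G V) (ρC : Representation k C V)
    (hV : ∀ g c, Commute (ρG g) (ρC c)) (hfaithful : Function.Injective ρG)
    (τΓ : Representation k Γ U) (τG : Representation k G U)
    (hU : ∀ γ g, Commute (τΓ γ) (τG g))
    (R : Subalgebra k (Poly k V)) (hR : IsNoetherNormalization R (invariantAlgebra ρG))
    (hRC : ∀ c, ∀ f ∈ R, polyAct ρC c f ∈ R)
    (v : V) (hfree : ∀ g, ∀ w ∈ fiber R v, pointAct ρG g w = w → g = 1)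
    (hstable : ∀ c, ∀ w ∈ fiber R v, pointAct ρC c w ∈ fiber R v) :
    {p : ℕ × ℕ | Nontrivial ((relativeInvariantsModule ρG ρC hV τΓ τG hU R hR.le hRC).Tor
      p.1 p.2)}.Finite ∧
    ∃ (hT : ∀ i j, FiniteDimensional k
          ((relativeInvariantsModule ρG ρC hV τΓ τG hU R hR.le hRC).Tor i j))
      (hA : FiniteDimensional k (fiberInvariants ρG τG R hR.le v)),
      ∑ᶠ i : ℕ, (-1 : ℤ) ^ i • ∑ᶠ j : ℕ,
          Groth.cls ((relativeInvariantsModule ρG ρC hV τΓ τG hU R hR.le hRC).torRep i j) (hT i j) =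
        Groth.cls (fiberInvariantsRep ρG ρC hV τΓ τG hU R hR.le hRC v hstable) hA := by
  exact finsum_cls_tor_relative ρG ρC hV τΓ τG hU R hR hRC v hfree hstable
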